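/- **Setting.** Let $M$ be a smooth 4-manifold (Hausdorff, second countable, without boundary), $\eta=\mathrm{diag}(\pm1,\dots,\pm1)$ a flat metric on $\mathbb R^D$ of arbitrary signature, and $x=(x^a):M\to\mathbb R^D$ a smooth map with induced metric $g_{\mu\nu}=\eta_{ab}\partial_\mu x^a\partial_\nu x^b$. Let $\theta^{\mu\nu}$ be a smooth, possibly complexified, Poisson tensor on $M$, $\{f,h\}=\theta^{\mu\nu}\partial_\mu f\,\partial_\nu h$, such that $\det(\theta^{\mu\nu})\det(g_{\mu\nu})$ is real and positive (for Riemannian $g$ and real $\theta$ this only says that $\theta$ is non-degenerate; in Lorentzian signature $\theta$ has to be complexified). Put $$e^{2\sigma}=\det(\theta^{\mu\nu})\det(g_{\mu\nu}),\qquad G^{\mu\nu}=e^{-\sigma}\theta^{\mu\rho}\theta^{\nu\kappa}g_{\rho\kappa},\qquad h_{\mu\nu}=G_{\mu\nu}-g_{\mu\nu};$$ equivalently $e^{-\sigma}=\sqrt{|\det\theta^{-1}|}/\sqrt{|\det G_{\mu\nu}|}$. Write $g^{\mu\nu}$ for the inverse of $g_{\mu\nu}$, $(GgG)^{\mu\nu}=G^{\mu\alpha}g_{\alpha\beta}G^{\beta\nu}$,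 $\nabla$ and $\square_G$ for the Levi-Civita connection and the Laplacian of $G$, and $R_{\mu\nu}[\cdot]$, $R[\cdot]$ for Ricci and scalar curvature (positive on round spheres). Integrals are over $M$, with $\sqrt G=\sqrt{|\det G_{\mu\nu}|}$. So that all integrals converge and integrations by parts have no boundary terms, assume that outside some compact set all brackets $\{x^a,x^b\}$ are locally constant (a flat brane with constant $\theta$; no condition if $M$ is compact). **Quantization.** A quantization of $(M,\theta)$ is an associative algebra $\mathcal A$ over $\mathbb C$ with a central non-zero-divisor $\hbar$ and an algebra homomorphism $A\mapsto a$ ("$A\sim a$") from $\mathcal A$ to the smooth complex functions on $M$, with kernel $\hbar\mathcal A$, such that $[A,B]=\hbar C$ implies $C\sim i\{a,b\}$; together with a cyclic, $\mathbb{C}[\hbar]$-linear trace on a two-sided ideal of $\mathcal A$ (which contains $A$ whenever it contains $\hbar A$), with values in $\hbar^{-2}\mathbb C[[\hbar]]$, such that $e^{-\sigma}a$ is integrable with respect to $\sqrt G\,d^4x$ and $$\hbar^2\,\mathrm{Tr}\,A=\int\frac{d^4x}{(2\pi)^2}\sqrt G\,e^{-\sigma}a+O(\hbar)$$ for all $A$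 in the ideal. Let $X^a\in\mathcal A$ with $X^a\sim x^a$. Latin indices are raised and lowered with $\eta$, and $$H^{ab}=\tfrac12\big\{[X^a,X^c],[X^b,X_c]\big\}_+,\quad H=\eta_{ab}H^{ab},\quad T^{ab}=H^{ab}-\tfrac14\eta^{ab}H,\quad \square\Phi=[X^a,[X_a,\Phi]].$$ Consider, whenever the operator under the trace lies in the ideal, $$\begin{aligned} S_0&=\mathrm{Tr}\big(H^{ab}\square H_{ab}+2\,\square X^cH^{ab}[X_a,[X_b,X_c]]\big),\\ S_R&=\mathrm{Tr}\big(\tfrac12T^{ab}\square H_{ab}+\square X^cH^{ab}[X_a,[X_b,X_c]]\big),\\ \tilde S_R&=\mathrm{Tr}\big(\tfrac12H^{ab}(\square H_{ab}-[X_a,[X_b,H]])+\square X^cH^{ab}[X_a,[X_b,X_c]]\big). \end{aligned}$$ The semi-classical limit of such an action $S$ is the coefficient $S^{\mathrm{sc}}$ in $\hbar^2S=\hbar^6S^{\mathrm{sc}}+O(\hbar^7)$. **Theorem.** There are universal constants $C,\delta>0$ such that, for all such data, $\hbar^2S_0$, $\hbar^2S_R$ and $\hbar^2\tilde S_R$ are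 $O(\hbar^6)$, and $$\begin{aligned} S_0^{\mathrm{sc}}&=-\int\frac{d^4x}{(2\pi)^2}\sqrt G\,e^{2\sigma}\big(4R_{\mu\nu}[G](GgG)^{\mu\nu}-2R[G]+4e^{-\sigma}\square_Ge^{\sigma}+4\nabla_\beta g^{\alpha\beta}\partial_\alpha\sigma\big)+E_0,\\ S_R^{\mathrm{sc}}&=-\int\frac{d^4x}{(2\pi)^2}\sqrt G\,e^{2\sigma}\big(3R[G]-2R_{\mu\nu}[G]g^{\mu\nu}+2\nabla_\beta g^{\alpha\beta}\partial_\alpha\sigma\big)+E_1,\\ \tilde S_R^{\mathrm{sc}}&=-\int\frac{d^4x}{(2\pi)^2}\sqrt G\,e^{2\sigma}\big(3R[G]-2R_{\mu\nu}[G]g^{\mu\nu}\big)+E_2, \end{aligned}$$ where the integrands are integrable and the errors are of second order in $h$ with two derivatives, in the following sense: for every choice, at each point of $M$, of a basis of the tangent space that is orthonormal up to signs for $g$, if $|h|\le\delta$ everywhere, then $$|E_0|,\,|E_1|,\,|E_2|\;\le\; C\int d^4x\,\sqrt G\,e^{2\sigma}\Big(|\nabla h|^2+|h|^2\big(|\partial\sigma|^2+|\mathrm{Ric}[G]|\big)\Big),$$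 $|\cdot|$ being the Euclidean norm of the components in the chosen basis. In particular, if $G=g$, then $e^{2\sigma}R[g]$ is integrable and $$S_R^{\mathrm{sc}}=\tilde S_R^{\mathrm{sc}}=-\int\frac{d^4x}{(2\pi)^2}\sqrt g\,e^{2\sigma}R[g].$$ -/

import Mathlib

open scoped Manifold ContDiff
open MeasureTheory

noncomputable section

namespace EmergentGravity

/-- The model space of a four-dimensional manifold. -/
abbrev E4 : Type := EuclideanSpace ℝ (Fin 4)

/-- Complex `4 × 4` component matrices of tensors of rank two. -/
abbrev Mat4 : Type := Matrix (Fin 4) (Fin 4) ℂ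

/-! ### Tensor calculus in a coordinate patch -/

namespace Patch

/-- The partial derivative `∂_μ f` of a complex function of four real coordinates. -/
def pd (μ : Fin 4) (f : E4 → ℂ) (y : E4) : ℂ :=
  fderiv ℝ f y (EuclideanSpace.single μ (1 : ℝ))

/-- Christoffel symbols `Γ^l_{mn}` of the Levi-Civita connection of the metric `G_{μν}`. -/
def christoffel (G : E4 → Mat4) (y : E4) (l m n : Fin 4) : ℂ :=
  (1 / 2 : ℂ) * ∑ k, (G y)⁻¹ l k *
    (pd m (fun z => G z n k) y + pd n (fun z => G z m k) y - pd k (fun z => G z m n) y)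

/-- Ricci tensor `R_{mn}[G]`, with the sign that makes it positive on round spheres. -/
def ricci (G : E4 → Mat4) (y : E4) (m n : Fin 4) : ℂ :=
  (∑ l, pd l (fun z => christoffel G z l m n) y)
    - (∑ l, pd n (fun z => christoffel G z l m l) y)
    + (∑ l, ∑ k, christoffel G y l l k * christoffel G y k m n)
    - (∑ l, ∑ k, christoffel G y l n k * christoffel G y k m l)

/-- The contraction `R_{mn}[G] U^{mn}` of the Ricci tensor with a contravariant tensor. -/
def ricciContract (G : E4 → Mat4) (U : Mat4) (y : E4) : ℂ :=
  ∑ m, ∑ n, ricci G y m n * U m n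

/-- The scalar curvature `R[G] = R_{mn}[G] G^{mn}`. -/
def scalarCurvature (G : E4 → Mat4) (y : E4) : ℂ :=
  ricciContract G (G y)⁻¹ y

/-- The covariant derivative `∇_l h_{mn}` with respect to the metric `G`. -/
def covDeriv (G h : E4 → Mat4) (y : E4) (l m n : Fin 4) : ℂ :=
  pd l (fun z => h z m n) y
    - (∑ k, christoffel G y k l m * h y k n) - (∑ k, christoffel G y k l n * h y m k)

/-- The divergence `∇_b U^{ab}` of a contravariant tensor with respect to the metric `G`. -/
def covDiv (G U : E4 → Mat4) (y : E4) (a : Fin 4) : ℂ :=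
  ∑ b, (pd b (fun z => U z a b) y
    + (∑ k, christoffel G y a b k * U y k b) + (∑ k, christoffel G y b b k * U y a k))

/-- The Laplace-Beltrami operator `□_G f = G^{mn} ∇_m ∂_n f`. -/
def laplacian (G : E4 → Mat4) (f : E4 → ℂ) (y : E4) : ℂ :=
  ∑ m, ∑ n, (G y)⁻¹ m n *
    (pd m (fun z => pd n f z) y - ∑ k, christoffel G y k m n * pd k f y)

/-- The function `σ` with `e^{2σ} = |det θ^{μν} · det g_{μν}|`. -/
def sigma (g θ : E4 → Mat4) (y : E4) : ℝ :=
  Real.log ‖(θ y).det * (g y).det‖ / 2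

/-- The inverse effective metric `G^{μν} = e^{-σ} θ^{μρ} θ^{νκ} g_{ρκ}`. -/
def effInv (g θ : E4 → Mat4) (y : E4) : Mat4 :=
  (Real.exp (-sigma g θ y) : ℂ) • (θ y * g y * (θ y).transpose)

/-- The effective metric `G_{μν}`. -/
def effMetric (g θ : E4 → Mat4) (y : E4) : Mat4 :=
  (effInv g θ y)⁻¹

/-- In four dimensions the choice of `σ` above is the one required by
`e^{-σ} = ρ / √|det G_{μν}|` with `ρ = √|det θ⁻¹|`. -/
theorem exp_neg_sigma (g θ : E4 → Mat4) (y : E4) (hne : (θ y).det * (g y).det ≠ 0) :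
    Real.exp (-sigma g θ y) =
      Real.sqrt ‖((θ y)⁻¹).det‖ / Real.sqrt ‖(effMetric g θ y).det‖ := by
  have ht : 0 < ‖(θ y).det‖ := norm_pos_iff.2 (left_ne_zero_of_mul hne)
  have hg : 0 < ‖(g y).det‖ := norm_pos_iff.2 (right_ne_zero_of_mul hne)
  have hE : Real.exp (-sigma g θ y) ^ 2 * (‖(θ y).det‖ * ‖(g y).det‖) = 1 := by
    have h1 : Real.exp (-sigma g θ y) ^ 2 = (‖(θ y).det‖ * ‖(g y).det‖)⁻¹ := by
      rw [← Real.exp_nat_mul, sigma, norm_mul]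
      have : ((2 : ℕ) : ℝ) * -(Real.log (‖(θ y).det‖ * ‖(g y).det‖) / 2)
          = -Real.log (‖(θ y).det‖ * ‖(g y).det‖) := by push_cast; ring
      rw [this, Real.exp_neg, Real.exp_log (mul_pos ht hg)]
    rw [h1]
    exact inv_mul_cancel₀ (mul_pos ht hg).ne'
  have hdet : ‖(effMetric g θ y).det‖ =
      (Real.exp (-sigma g θ y) ^ 4 * (‖(θ y).det‖ * ‖(g y).det‖ * ‖(θ y).det‖))⁻¹ := by
    rw [effMetric, Matrix.det_nonsing_inv, Ring.inverse_eq_inv', norm_inv, effInv,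
      Matrix.det_smul, Matrix.det_mul, Matrix.det_mul, Matrix.det_transpose]
    simp only [Fintype.card_fin, norm_mul, norm_pow, Complex.norm_real, Real.norm_eq_abs,
      Real.abs_exp]
  have hi : ‖((θ y)⁻¹).det‖ = ‖(θ y).det‖⁻¹ := by
    rw [Matrix.det_nonsing_inv, Ring.inverse_eq_inv', norm_inv]
  have hep : 0 < Real.exp (-sigma g θ y) := Real.exp_pos _
  rw [hdet, hi, ← Real.sqrt_div' _ (by positivity)]
  symm
  rw [Real.sqrt_eq_iff_mul_self_eq (by positivity) hep.le]
  generalize Real.exp (-sigma g θ y) = e at *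
  generalize ‖(θ y).det‖ = t at *
  generalize ‖(g y).det‖ = d at *
  field_simp
  nlinarith [hE]

end Patch

/-! ### Branes: embedded Poisson manifolds -/

section Manifold

variable {M : Type*} [TopologicalSpace M] [ChartedSpace E4 M]

/-- Smooth complex functions on `M`. -/
def IsSmooth (f : M → ℂ) : Prop := ContMDiff (𝓡 4) 𝓘(ℝ, ℂ) ∞ f

/-- The differential `df` of a complex function at `p`. -/
def differential (f : M → ℂ) (p : M) : TangentSpace (𝓡 4) p →L[ℝ] ℂ :=
  mfderiv (𝓡 4) 𝓘(ℝ, ℂ) f p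

/-- The coordinate function `y^μ` of the preferred chart at `p`. -/
def coordFn (p : M) (μ : Fin 4) (q : M) : ℂ := ((chartAt E4 p q) μ : ℂ)

/-- The bracket `{f, g} = θ(df, dg) = θ^{μν} ∂_μ f ∂_ν g` of a bivector field `θ`. -/
def bracketOf
    (θ : ∀ p : M, (TangentSpace (𝓡 4) p →L[ℝ] ℂ) →ₗ[ℂ] (TangentSpace (𝓡 4) p →L[ℝ] ℂ) →ₗ[ℂ] ℂ)
    (f g : M → ℂ) (p : M) : ℂ :=
  θ p (differential f p) (differential g p)

/-- The components `θ^{μν}` in the preferred chart at `p`. -/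
def bivectorCoord
    (θ : ∀ p : M, (TangentSpace (𝓡 4) p →L[ℝ] ℂ) →ₗ[ℂ] (TangentSpace (𝓡 4) p →L[ℝ] ℂ) →ₗ[ℂ] ℂ)
    (p : M) (y : E4) : Mat4 :=
  Matrix.of fun μ ν => bracketOf θ (coordFn p μ) (coordFn p ν) ((chartAt E4 p).symm y)

/-- The components `g_{μν} = η_{ab} ∂_μ x^a ∂_ν x^b` of the induced metric in the preferred chart
at `p`, for `η = diag(η_1, …, η_D)`. -/
def inducedCoord {D : ℕ} (η : Fin D → ℝ) (x : Fin D → M → ℝ) (p : M) (y : E4) : Mat4 :=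
  Matrix.of fun μ ν => ∑ a, (η a : ℂ) *
    Patch.pd μ (fun z => (x a ((chartAt E4 p).symm z) : ℂ)) y *
    Patch.pd ν (fun z => (x a ((chartAt E4 p).symm z) : ℂ)) y

end Manifold

/-- A four-dimensional brane: a smooth map `x : M → ℝ^D` into the flat space with metric
`η = diag(±1, …, ±1)` and a Poisson tensor `θ` on `M` such that `det θ^{μν} · det g_{μν}` is real
and positive (in particular `θ` and the induced metric `g` are non-degenerate, and `x` is an
immersion). `θ` acts on complexified covectors; its components may be complex.
If `g` is positive definite and `θ` is real, the positivity just says that `θ` is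
non-degenerate; in Lorentzian signature it forces `θ` to be complexified. -/
structure Brane (D : ℕ) (M : Type*) [TopologicalSpace M] [ChartedSpace E4 M] where
  η : Fin D → ℝ
  η_sign : ∀ a, η a = 1 ∨ η a = -1
  x : Fin D → M → ℝ
  x_smooth : ∀ a, ContMDiff (𝓡 4) 𝓘(ℝ, ℝ) ∞ (x a)
  θ : ∀ p : M,
    (TangentSpace (𝓡 4) p →L[ℝ] ℂ) →ₗ[ℂ] (TangentSpace (𝓡 4) p →L[ℝ] ℂ) →ₗ[ℂ] ℂ
  θ_alt : ∀ p α, θ p α α = 0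
  θ_smooth : ∀ f g : M → ℂ, IsSmooth f → IsSmooth g → IsSmooth (bracketOf θ f g)
  jacobi : ∀ f g h : M → ℂ, IsSmooth f → IsSmooth g → IsSmooth h → ∀ p,
    bracketOf θ f (bracketOf θ g h) p + bracketOf θ g (bracketOf θ h f) p
      + bracketOf θ h (bracketOf θ f g) p = 0
  unimodular : ∀ p, ∃ r : ℝ, 0 < r ∧
    (bivectorCoord θ p (chartAt E4 p p)).det * (inducedCoord η x p (chartAt E4 p p)).det = (r : ℂ)

namespace Brane

variable {D : ℕ} {M : Type*} [TopologicalSpace M] [ChartedSpace E4 M] (B : Brane D M)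

/-- The Poisson bracket of the brane. -/
def bracket (f g : M → ℂ) : M → ℂ := bracketOf B.θ f g

/-- The embedding functions as complex functions. -/
def emb (a : Fin D) (p : M) : ℂ := (B.x a p : ℂ)

/-- The induced metric `g_{μν}` in the preferred chart at `p`. -/
def g (p : M) : E4 → Mat4 := inducedCoord B.η B.x p

/-- The Poisson tensor `θ^{μν}` in the preferred chart at `p`. -/
def θc (p : M) : E4 → Mat4 := bivectorCoord B.θ p

/-- The inverse induced metric `g^{μν}` in the preferred chart at `p`. -/
def gInv (p : M) (y : E4) : Mat4 := (B.g p y)⁻¹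

/-- The effective metric `G_{μν}` in the preferred chart at `p`. -/
def G (p : M) : E4 → Mat4 := Patch.effMetric (B.g p) (B.θc p)

/-- The deviation `h_{μν} = G_{μν} - g_{μν}` in the preferred chart at `p`. -/
def h (p : M) (y : E4) : Mat4 := B.G p y - B.g p y

/-- `σ` in the preferred chart at `p`. -/
def σc (p : M) : E4 → ℝ := Patch.sigma (B.g p) (B.θc p)

/-- The scalar function `σ` on the brane. -/
def σ (p : M) : ℝ := B.σc p (chartAt E4 p p)

/-- The volume measure `√|G| d⁴y` on `M`: the least measure that dominates (and then equals),
on the domain of each chart, the one with density `√|det G_{μν}|` in the coordinates. -/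
def vol [MeasurableSpace M] : Measure M :=
  ⨆ p : M, Measure.map (chartAt E4 p).symm
    ((volume.restrict (chartAt E4 p).target).withDensity
      fun y => ENNReal.ofReal (Real.sqrt ‖(B.G p y).det‖))

/-- The brane is a flat Moyal-Weyl brane (all Poisson brackets `{x^a, x^b}` are locally constant)
outside of `K`. No condition if `K` is all of `M`. -/
def FlatOutside (K : Set M) : Prop :=
  ∀ p, p ∉ K → ∀ a b, differential (B.bracket (B.emb a) (B.emb b)) p = 0

/-! ### Lagrangian densities at a point -/

/-- `R[G]` -/
def scalG (p : M) : ℂ := Patch.scalarCurvature (B.G p) (chartAt E4 p p)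

/-- `R[g]` -/
def scalg (p : M) : ℂ := Patch.scalarCurvature (B.g p) (chartAt E4 p p)

/-- `R_{μν}[G] g^{μν}` -/
def ricg (p : M) : ℂ :=
  Patch.ricciContract (B.G p) (B.gInv p (chartAt E4 p p)) (chartAt E4 p p)

/-- `R_{μν}[G] (GgG)^{μν}` -/
def ricGgG (p : M) : ℂ :=
  Patch.ricciContract (B.G p)
    ((B.G p (chartAt E4 p p))⁻¹ * B.g p (chartAt E4 p p) * (B.G p (chartAt E4 p p))⁻¹)
    (chartAt E4 p p)

/-- `∂_μ σ` -/
def dσ (p : M) (μ : Fin 4) : ℂ := Patch.pd μ (fun y => (B.σc p y : ℂ)) (chartAt E4 p p)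

/-- `∇_β g^{αβ} ∂_α σ` -/
def divgdσ (p : M) : ℂ :=
  ∑ a, Patch.covDiv (B.G p) (B.gInv p) (chartAt E4 p p) a * B.dσ p a

/-- `e^{-σ} □_G e^σ` -/
def boxExp (p : M) : ℂ :=
  (Real.exp (-B.σ p) : ℂ) *
    Patch.laplacian (B.G p) (fun y => (Real.exp (B.σc p y) : ℂ)) (chartAt E4 p p)

/-- `e^{2σ} (4 R_{μν}[G] (GgG)^{μν} - 2 R[G] + 4 e^{-σ} □_G e^σ + 4 ∇_β g^{αβ} ∂_α σ)` -/
def densityBare (p : M) : ℂ :=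
  (Real.exp (2 * B.σ p) : ℂ) *
    (4 * B.ricGgG p - 2 * B.scalG p + 4 * B.boxExp p + 4 * B.divgdσ p)

/-- `e^{2σ} (3 R[G] - 2 R_{μν}[G] g^{μν} + 2 ∇_β g^{αβ} ∂_α σ)` -/
def densityR (p : M) : ℂ :=
  (Real.exp (2 * B.σ p) : ℂ) * (3 * B.scalG p - 2 * B.ricg p + 2 * B.divgdσ p)

/-- `e^{2σ} (3 R[G] - 2 R_{μν}[G] g^{μν})` -/
def densityRtilde (p : M) : ℂ :=
  (Real.exp (2 * B.σ p) : ℂ) * (3 * B.scalG p - 2 * B.ricg p)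

/-- `e^{2σ} R[g]` -/
def densityEH (p : M) : ℂ := (Real.exp (2 * B.σ p) : ℂ) * B.scalg p

/-! ### The size of `h` and of its first derivatives -/

/-- `F p` is a basis of the tangent space at `p` (given by its components `F p μ i = e_i^μ` in the
preferred chart) that is orthonormal, up to signs, for the induced metric. -/
def IsOrthonormalFrame (F : M → Matrix (Fin 4) (Fin 4) ℝ) : Prop :=
  ∀ p, ∃ ε : Fin 4 → ℝ, (∀ i, ε i = 1 ∨ ε i = -1) ∧
    ((F p).map Complex.ofReal).transpose * B.g p (chartAt E4 p p) * (F p).map Complex.ofReal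
      = Matrix.diagonal fun i => (ε i : ℂ)

/-- `|h|²`: the sum of the squares of the frame components of `h`. -/
def hSq (F : M → Matrix (Fin 4) (Fin 4) ℝ) (p : M) : ℝ :=
  ∑ i, ∑ j, ‖∑ m, ∑ n, B.h p (chartAt E4 p p) m n * F p m i * F p n j‖ ^ 2

/-- `|∇h|²`, with the Levi-Civita connection of `G`. -/
def nablahSq (F : M → Matrix (Fin 4) (Fin 4) ℝ) (p : M) : ℝ :=
  ∑ k, ∑ i, ∑ j, ‖∑ l, ∑ m, ∑ n, Patch.covDeriv (B.G p) (B.h p) (chartAt E4 p p) l m n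
    * F p l k * F p m i * F p n j‖ ^ 2

/-- `|∂σ|²` -/
def dσSq (F : M → Matrix (Fin 4) (Fin 4) ℝ) (p : M) : ℝ :=
  ∑ i, ‖∑ m, B.dσ p m * F p m i‖ ^ 2

/-- `|Ric[G]|` -/
def ricNorm (F : M → Matrix (Fin 4) (Fin 4) ℝ) (p : M) : ℝ :=
  Real.sqrt (∑ i, ∑ j,
    ‖∑ m, ∑ n, Patch.ricci (B.G p) (chartAt E4 p p) m n * F p m i * F p n j‖ ^ 2)

/-- The error density `e^{2σ} (|∇h|² + |h|² (|∂σ|² + |Ric[G]|))`: quadratic in `h`, with two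
derivatives. -/
def errorDensity (F : M → Matrix (Fin 4) (Fin 4) ℝ) (p : M) : ℝ :=
  Real.exp (2 * B.σ p) *
    (B.nablahSq F p + B.hSq F p * (B.dσSq F p + B.ricNorm F p))

end Brane

/-! ### Quantization -/

/-- A quantization of a brane: an algebra `𝒜` of operators, with a central deformation parameter
`ħ`, whose classical limit `ħ → 0` is the algebra of smooth functions, where
`[A, B] = iħ {a, b} + O(ħ²)`. The trace takes values in formal power series in `ħ` and is
normalized by the factor `ħ²`, so that `ħ² Tr A = ∫ d⁴y / (2π)² √G e^{-σ} a + O(ħ)`.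
(Examples: star products, and families of matrices with asymptotic expansions in `ħ`.) -/
structure Quantization {D : ℕ} {M : Type*} [TopologicalSpace M] [ChartedSpace E4 M]
    [MeasurableSpace M] (B : Brane D M) (𝒜 : Type*) [Ring 𝒜] [Algebra ℂ 𝒜] where
  hbar : 𝒜
  hbar_central : ∀ A, hbar * A = A * hbar
  hbar_regular : ∀ A, hbar * A = 0 → A = 0
  /-- the classical limit `Φ ∼ φ` -/
  symbol : 𝒜 →ₐ[ℂ] (M → ℂ)
  symbol_smooth : ∀ A, IsSmooth (symbol A)
  symbol_eq_zero_iff : ∀ A, symbol A = 0 ↔ ∃ A', A = hbar * A'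
  symbol_commutator : ∀ A A' C, A * A' - A' * A = hbar * C →
    ∀ p, symbol C p = Complex.I * B.bracket (symbol A) (symbol A') p
  /-- the ideal of operators that have a trace -/
  traceClass : Submodule ℂ 𝒜
  mul_mem_left : ∀ A, ∀ T ∈ traceClass, A * T ∈ traceClass
  mul_mem_right : ∀ A, ∀ T ∈ traceClass, T * A ∈ traceClass
  mem_of_hbar_mul : ∀ A, hbar * A ∈ traceClass → A ∈ traceClass
  tr : traceClass →ₗ[ℂ] PowerSeries ℂ
  tr_cyclic : ∀ A, ∀ T : traceClass,
    tr ⟨A * T, mul_mem_left A T T.2⟩ = tr ⟨T * A, mul_mem_right A T T.2⟩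
  tr_hbar : ∀ T : traceClass,
    tr ⟨hbar * T, mul_mem_left hbar T T.2⟩ = PowerSeries.X * tr T
  tr_integrable : ∀ T : traceClass,
    Integrable (fun p => (Real.exp (-B.σ p) : ℂ) * symbol (T : 𝒜) p) B.vol
  tr_leading : ∀ T : traceClass, PowerSeries.constantCoeff (tr T) =
    (1 / (2 * Real.pi) ^ 2 : ℂ) * ∫ p, (Real.exp (-B.σ p) : ℂ) * symbol (T : 𝒜) p ∂B.vol

/-! ### Matrix operators -/

namespace Op

variable {D : ℕ} {𝒜 : Type*} [Ring 𝒜] [Algebra ℂ 𝒜]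

/-- The commutator `[A, B]`. -/
def comm (A B : 𝒜) : 𝒜 := A * B - B * A

/-- `H^{ab} = ½ {[X^a, X^c], [X^b, X_c]}` (anticommutator) -/
def H (η : Fin D → ℝ) (X : Fin D → 𝒜) (a b : Fin D) : 𝒜 :=
  (1 / 2 : ℂ) • ∑ c, (η c : ℂ) •
    (comm (X a) (X c) * comm (X b) (X c) + comm (X b) (X c) * comm (X a) (X c))

/-- `H = η_{ab} H^{ab}` -/
def trH (η : Fin D → ℝ) (X : Fin D → 𝒜) : 𝒜 := ∑ a, (η a : ℂ) • H η X a a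

/-- `T^{ab} = H^{ab} - ¼ η^{ab} H` -/
def T (η : Fin D → ℝ) (X : Fin D → 𝒜) (a b : Fin D) : 𝒜 :=
  H η X a b - (1 / 4 : ℂ) • (if a = b then (η a : ℂ) • trH η X else 0)

/-- `□Φ = [X^a, [X_a, Φ]]` -/
def box (η : Fin D → ℝ) (X : Fin D → 𝒜) (Φ : 𝒜) : 𝒜 :=
  ∑ a, (η a : ℂ) • comm (X a) (comm (X a) Φ)

/-- `□X^c H^{ab} [X_a, [X_b, X_c]]` -/
def boxXHXX (η : Fin D → ℝ) (X : Fin D → 𝒜) : 𝒜 :=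
  ∑ a, ∑ b, ∑ c, ((η a * η b * η c : ℝ) : ℂ) •
    (box η X (X c) * H η X a b * comm (X a) (comm (X b) (X c)))

/-- `H^{ab} □H_{ab} + 2 □X^c H^{ab} [X_a, [X_b, X_c]]` -/
def opBare (η : Fin D → ℝ) (X : Fin D → 𝒜) : 𝒜 :=
  (∑ a, ∑ b, ((η a * η b : ℝ) : ℂ) • (H η X a b * box η X (H η X a b)))
    + (2 : ℂ) • boxXHXX η X

/-- `½ T^{ab} □H_{ab} + □X^c H^{ab} [X_a, [X_b, X_c]]` -/
def opR (η : Fin D → ℝ) (X : Fin D → 𝒜) : 𝒜 :=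
  (∑ a, ∑ b, ((η a * η b : ℝ) : ℂ) • ((1 / 2 : ℂ) • (T η X a b * box η X (H η X a b))))
    + boxXHXX η X

/-- `½ H^{ab} (□H_{ab} - [X_a, [X_b, H]]) + □X^c H^{ab} [X_a, [X_b, X_c]]` -/
def opRtilde (η : Fin D → ℝ) (X : Fin D → 𝒜) : 𝒜 :=
  (∑ a, ∑ b, ((η a * η b : ℝ) : ℂ) • ((1 / 2 : ℂ) •
      (H η X a b * (box η X (H η X a b) - comm (X a) (comm (X b) (trH η X))))))
    + boxXHXX η X

end Op

/-- The trace of the operator `O` starts at order `ħ⁶` (relative to the normalization of the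
trace), and its leading coefficient, the semi-classical limit, is
`-∫ d⁴y / (2π)² √G 𝓛` up to an error that is at most `C` times the integral of the error density,
as soon as `|h| ≤ δ` everywhere. -/
def HasSemiclassicalLimit {D : ℕ} {M : Type*} [TopologicalSpace M] [ChartedSpace E4 M]
    [MeasurableSpace M] {B : Brane D M} {𝒜 : Type*} [Ring 𝒜] [Algebra ℂ 𝒜]
    (Q : Quantization B 𝒜) (O : Q.traceClass) (L : M → ℂ) (C δ : ℝ) : Prop :=
  PowerSeries.X ^ 6 ∣ Q.tr O ∧
  Integrable L B.vol ∧
  ∀ F : M → Matrix (Fin 4) (Fin 4) ℝ, B.IsOrthonormalFrame F → (∀ p, B.hSq F p ≤ δ ^ 2) →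
    ENNReal.ofReal
      ‖PowerSeries.coeff 6 (Q.tr O) - (-((1 / (2 * Real.pi) ^ 2 : ℂ) * ∫ p, L p ∂B.vol))‖
      ≤ ENNReal.ofReal C * ∫⁻ p, ENNReal.ofReal (B.errorDensity F p) ∂B.vol

end EmergentGravity

end

open scoped Manifold ContDiff
open MeasureTheory

noncomputable section

namespace EmergentGravity

/-! ### Partial derivatives and Jacobi's formula for determinants -/

section

namespace Patch

/-! In the classical limit every commutator becomes iħ times a Poisson bracket, so each of the three
operators is ħ⁶ times an operator whose symbol is a polynomial in iterated brackets of the x^a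
(`HasOrder.comm`, `IsEmbedding.opBare`, `IsEmbedding.opR`, `IsEmbedding.opRtilde`). Powers of ħ can
be divided out of operators and traces, so the sixth coefficient of the trace is the integral of
that symbol against e^{-σ}√G, up to (2π)⁻² (`HasOrder.trace`). Everything else is classical.

Two facts turn brackets into geometry. Since θᵀgθ = e^σ G⁻¹, the sum {x_a, f}{x^a, k} is e^σ⟨df, dk⟩
for the effective metric (`sum_brk_brk`). The Jacobi identity makes θ/pf θ divergence free, and 1/pf
θ is locally proportional to e^{-σ}√G; hence Hamiltonian vector fields preserve this measure,
brackets are divergences, and {x_a, {x^a, f}} = e^σ □_G f (`sum_brk_brk_comp`). In particular H^{ab}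
= e^σ u^{ab} with u^{ab} = ⟨dx^a, dx^b⟩. By the Leibniz rule and the Jacobi identity the symbols
take, up to divergences, a form in which second derivatives of u^{ab} enter only through
u_{ab}(□u^{ab} - 2⟨dx^a, d□x^b⟩) (`two_bare`). Bochner's formula replaces this by Ricci terms and
squares of the Hessians of the x^a.

The rest is an exact pointwise identity: Lagrangian = geometric density + divergence + e^{2σ} times
an explicit remainder (`bare_eq`, `R_eq`, `Rtilde_eq`). Each term of the remainder is quadratic in
small quantities, for two reasons. In dimension four the product θgθg satisfies a quadratic equation
(`theta_g_quadratic`). With U = G⁻¹ and τ = tr Ug it gives g⁻¹ = ½τU - UgU, which relates the three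
Ricci contractions, and 2 tr (Uh)² = -τ(4 - τ), which makes 4 - τ of second order in h and dτ a
product of h and ∇h (`norm_four_sub_τ`, `frame_dτ`). Secondly, the Hessians enter only through their
tangential components ∂_i x_a ∇_l ∂_n x^a, and these are linear in ∇h because ∇G = 0 (`covDeriv_h`,
`tang_eq`). For G = g the remainders vanish identically, which gives the Einstein-Hilbert action.

Globally, flatness outside K makes the H^{ab} locally constant there, and then also σ, because
8e^{2σ} = H² - 2H_{ab}H^{ab} (`isFlat`). So the Lagrangians vanish outside K, and the divergences
are sums of e^{-σ}{f, k} with k supported in K, which integrate to zero (`integral_br`). The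
curvature densities are defined chart by chart. Solving Bochner's formula for the Ricci tensor
expresses them through brackets, hence as values of global smooth functions (`ricGgG_eq`,
`scalG_eq`, `ricg_eq`); no transformation law for curvature is needed to see that they are
continuous and vanish outside K. -/

/-- Smooth complex functions on a subset of the model space. -/
abbrev SmoothOn (Ω : Set E4) (f : E4 → ℂ) : Prop := ContDiffOn ℝ ∞ f Ω

variable {Ω : Set E4} {f g : E4 → ℂ} {y : E4}

theorem SmoothOn.differentiableAt (hf : SmoothOn Ω f) (hΩ : IsOpen Ω) (hy : y ∈ Ω) :
    DifferentiableAt ℝ f y :=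
  (hf.contDiffAt (hΩ.mem_nhds hy)).differentiableAt (by simp)

theorem SmoothOn.pd (hf : SmoothOn Ω f) (hΩ : IsOpen Ω) (μ : Fin 4) : SmoothOn Ω (pd μ f) := by
  have h : ContDiffOn ℝ ∞ (fderiv ℝ f) Ω := hf.fderiv_of_isOpen hΩ (by simp)
  exact h.clm_apply contDiffOn_const

theorem SmoothOn.sum {ι : Type*} {s : Finset ι} {F : ι → E4 → ℂ}
    (hF : ∀ i ∈ s, SmoothOn Ω (F i)) : SmoothOn Ω (fun z => ∑ i ∈ s, F i z) :=
  ContDiffOn.sum hF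

theorem SmoothOn.inv (hf : SmoothOn Ω f) (h0 : ∀ z ∈ Ω, f z ≠ 0) :
    SmoothOn Ω (fun z => (f z)⁻¹) := ContDiffOn.inv hf h0

theorem SmoothOn.det {A : E4 → Mat4} (hA : ∀ m n, SmoothOn Ω fun z => A z m n) :
    SmoothOn Ω (fun z => (A z).det) := by
  simp only [Matrix.det_apply, Units.smul_def, zsmul_eq_mul]
  exact .sum fun i _ => contDiffOn_const.mul (contDiffOn_prod fun j _ => hA _ _)

theorem SmoothOn.log_norm (hf : SmoothOn Ω f) (h0 : ∀ z ∈ Ω, f z ≠ 0) :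
    ContDiffOn ℝ ∞ (fun z => Real.log ‖f z‖) Ω :=
  (ContDiffOn.norm ℝ hf h0).log fun z hz => norm_ne_zero_iff.2 (h0 z hz)

theorem SmoothOn.ofReal {r : E4 → ℝ} (hr : ContDiffOn ℝ ∞ r Ω) :
    SmoothOn Ω (fun z => (r z : ℂ)) := Complex.ofRealCLM.contDiff.comp_contDiffOn hr

theorem pd_congr (h : f =ᶠ[nhds y] g) (μ : Fin 4) : pd μ f y = pd μ g y := by
  rw [pd, pd, h.fderiv_eq]

theorem pd_congr_on (hΩ : IsOpen Ω) (hy : y ∈ Ω) (h : ∀ z ∈ Ω, f z = g z) (μ : Fin 4) :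
    pd μ f y = pd μ g y :=
  pd_congr (Filter.eventuallyEq_of_mem (hΩ.mem_nhds hy) h) μ

theorem pd_const (c : ℂ) (μ : Fin 4) : pd μ (fun _ => c) y = 0 := by
  simp [pd]

theorem pd_add (hf : DifferentiableAt ℝ f y) (hg : DifferentiableAt ℝ g y) (μ : Fin 4) :
    pd μ (fun z => f z + g z) y = pd μ f y + pd μ g y := by
  simp [pd, fderiv_fun_add hf hg]

theorem pd_sub (hf : DifferentiableAt ℝ f y) (hg : DifferentiableAt ℝ g y) (μ : Fin 4) :
    pd μ (fun z => f z - g z) y = pd μ f y - pd μ g y := by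
  simp [pd, fderiv_fun_sub hf hg]

theorem pd_neg (μ : Fin 4) : pd μ (fun z => -f z) y = -pd μ f y := by
  simp [pd, fderiv_fun_neg]

theorem pd_mul (hf : DifferentiableAt ℝ f y) (hg : DifferentiableAt ℝ g y) (μ : Fin 4) :
    pd μ (fun z => f z * g z) y = f y * pd μ g y + pd μ f y * g y := by
  simp [pd, fderiv_fun_mul hf hg, mul_comm]

theorem pd_const_mul (hf : DifferentiableAt ℝ f y) (c : ℂ) (μ : Fin 4) :
    pd μ (fun z => c * f z) y = c * pd μ f y := by
  rw [pd_mul (differentiableAt_const c) hf, pd_const]; ring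

theorem pd_sum {ι : Type*} {s : Finset ι} {F : ι → E4 → ℂ}
    (hF : ∀ i ∈ s, DifferentiableAt ℝ (F i) y) (μ : Fin 4) :
    pd μ (fun z => ∑ i ∈ s, F i z) y = ∑ i ∈ s, pd μ (F i) y := by
  simp [pd, fderiv_fun_sum hF]

theorem pd_sum_mul {ι : Type*} {s : Finset ι} {F K : ι → E4 → ℂ}
    (hF : ∀ i, DifferentiableAt ℝ (F i) y) (hK : ∀ i, DifferentiableAt ℝ (K i) y) (μ : Fin 4) :
    pd μ (fun z => ∑ i ∈ s, F i z * K i z) y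
      = ∑ i ∈ s, (F i y * pd μ (K i) y + pd μ (F i) y * K i y) := by
  rw [pd_sum fun i _ => (hF i).fun_mul (hK i)]
  exact Finset.sum_congr rfl fun i _ => pd_mul (hF i) (hK i) μ

theorem pd_exp (hf : DifferentiableAt ℝ f y) (μ : Fin 4) :
    pd μ (fun z => Complex.exp (f z)) y = Complex.exp (f y) * pd μ f y := by
  have h := ((Complex.hasDerivAt_exp (f y)).comp_hasFDerivAt y hf.hasFDerivAt)
  have h' : HasFDerivAt (fun z => Complex.exp (f z)) _ y := h
  rw [pd, h'.fderiv]; simp [pd]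

theorem pd_comm (hf : SmoothOn Ω f) (hΩ : IsOpen Ω) (hy : y ∈ Ω) (μ ν : Fin 4) :
    pd μ (fun z => pd ν f z) y = pd ν (fun z => pd μ f z) y := by
  have hc := hf.contDiffAt (hΩ.mem_nhds hy)
  have hs : IsSymmSndFDerivAt ℝ f y := hc.isSymmSndFDerivAt (by
    rw [minSmoothness_of_isRCLikeNormedField]
    exact WithTop.coe_le_coe.2 le_top)
  have hd : DifferentiableAt ℝ (fderiv ℝ f) y :=
    ((hf.fderiv_of_isOpen hΩ (m := ∞) (by simp)).contDiffAt (hΩ.mem_nhds hy)).differentiableAt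
      (by simp)
  have key : ∀ μ ν : Fin 4, pd μ (fun z => pd ν f z) y =
      fderiv ℝ (fderiv ℝ f) y (EuclideanSpace.single μ 1) (EuclideanSpace.single ν 1) := by
    intro μ ν
    simp only [pd]
    rw [fderiv_clm_apply hd (differentiableAt_const _)]
    simp
  rw [key, key, hs]

/-- Factoring out A leaves det(1 + sM), a polynomial in s that begins with 1 + s tr M; the rest is
divisible by s² and has no derivative at 0. -/
theorem hasDerivAt_det_line (A B : Mat4) (hA : A.det ≠ 0) :
    HasDerivAt (fun s : ℂ => (A + s • B).det) (A.det * (A⁻¹ * B).trace) 0 := by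
  have h1 : ∀ s : ℂ, (A + s • B).det = A.det * (1 + (A⁻¹ * B).trace * s
      + (Matrix.det (1 + (Polynomial.X : Polynomial ℂ) • (A⁻¹ * B).map Polynomial.C)).divX.divX.eval s
        * s ^ 2) := by
    intro s
    rw [← Matrix.det_one_add_smul, ← Matrix.det_mul]
    congr 1
    rw [mul_add, mul_one, Matrix.mul_smul, Matrix.mul_nonsing_inv_cancel_left _ _ (isUnit_iff_ne_zero.2 hA)]
  simp_rw [h1]
  set P := (Matrix.det (1 + (Polynomial.X : Polynomial ℂ) • (A⁻¹ * B).map Polynomial.C)).divX.divX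
  have h2 : HasDerivAt (fun s : ℂ => 1 + (A⁻¹ * B).trace * s + P.eval s * s ^ 2)
      ((A⁻¹ * B).trace * 1 + (P.derivative.eval 0 * 0 ^ 2 + P.eval 0 * (2 * 0))) 0 := by
    refine (((hasDerivAt_id (0 : ℂ)).const_mul _).const_add 1).add ?_
    refine (P.hasDerivAt 0).mul ?_
    simpa using hasDerivAt_pow 2 (0 : ℂ)
  have h3 := h2.const_mul A.det
  simpa using h3

/-- Jacobi's formula. The determinant is a polynomial in the entries, so the chain rule applies, and
its differential is read off along straight lines by `hasDerivAt_det_line`. It later gives the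
logarithmic derivatives of √|det G| and of e^σ. -/
theorem pd_det {A : E4 → Mat4} (hA : ∀ m n, DifferentiableAt ℝ (fun z => A z m n) y)
    (h0 : (A y).det ≠ 0) (μ : Fin 4) :
    pd μ (fun z => (A z).det) y
      = (A y).det * ∑ m, ∑ n, (A y)⁻¹ m n * pd μ (fun z => A z n m) y := by
  set B : Mat4 := Matrix.of fun n m => pd μ (fun z => A z n m) y with hB
  let d : (Fin 4 → Fin 4 → ℂ) → ℂ := fun A => Matrix.det (Matrix.of A)
  have hd : DifferentiableAt ℂ d (A y) := by
    have : d = fun A => ∑ σ : Equiv.Perm (Fin 4), (Equiv.Perm.sign σ : ℂ) * ∏ i, A (σ i) i := by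
      funext A
      simp [d, Matrix.det_apply', Matrix.of_apply]
    rw [this]
    fun_prop
  have hdR : HasFDerivAt d ((fderiv ℂ d (A y)).restrictScalars ℝ) (A y) :=
    hd.hasFDerivAt.restrictScalars ℝ
  have hAd : DifferentiableAt ℝ (fun z => (fun m n => A z m n : Fin 4 → Fin 4 → ℂ)) y :=
    differentiableAt_pi.2 fun m => differentiableAt_pi.2 fun n => hA m n
  have hc : HasFDerivAt (fun z => (A z).det) _ y := hdR.comp y hAd.hasFDerivAt
  have h1 : fderiv ℝ (fun z => (fun m n => A z m n : Fin 4 → Fin 4 → ℂ)) y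
      (EuclideanSpace.single μ 1) = B := by
    funext m n
    have := fderiv_pi (𝕜 := ℝ) (φ := fun m z => (fun n => A z m n : Fin 4 → ℂ)) (x := y)
      (fun m => differentiableAt_pi.2 fun n => hA m n)
    rw [this, ContinuousLinearMap.pi_apply, fderiv_pi (fun n => hA m n),
      ContinuousLinearMap.pi_apply]
    rfl
  have h2 : fderiv ℂ d (A y) B = (A y).det * ((A y)⁻¹ * B).trace := by
    -- The matrices are retyped as functions of two indices, so that the line is differentiated in
    -- the normed space on which `d` was defined.
    obtain ⟨A₀, hA₀⟩ : ∃ A₀ : Fin 4 → Fin 4 → ℂ, A₀ = A y := ⟨_, rfl⟩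
    obtain ⟨B₀, hB₀⟩ : ∃ B₀ : Fin 4 → Fin 4 → ℂ, B₀ = B := ⟨_, rfl⟩
    have h4 : HasDerivAt (fun s : ℂ => A₀ + s • B₀) B₀ 0 := by
      simpa using ((hasDerivAt_id (0 : ℂ)).smul_const B₀).const_add A₀
    have h5 : HasFDerivAt d (fderiv ℂ d (A y)) (A₀ + (0 : ℂ) • B₀) := by
      rw [zero_smul, add_zero, hA₀]
      exact hd.hasFDerivAt
    have hl : HasDerivAt (fun s : ℂ => d (A y + s • B)) (fderiv ℂ d (A y) B) 0 := by
      rw [← hA₀, ← hB₀]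
      exact hA₀ ▸ h5.comp_hasDerivAt (0 : ℂ) h4
    exact hl.unique (hasDerivAt_det_line (A y) B h0)
  rw [pd, hc.fderiv]
  simp only [ContinuousLinearMap.comp_apply, ContinuousLinearMap.coe_restrictScalars']
  rw [h1, h2]
  simp [Matrix.trace, Matrix.mul_apply, hB]

end Patch

end

/-! ### Skew 4 × 4 matrices and the quadratic equation of the effective metric -/

section

open Matrix

/-- The Pfaffian of a skew-symmetric `4 × 4` matrix. -/
def pfaffian (A : Mat4) : ℂ := A 0 1 * A 2 3 - A 0 2 * A 1 3 + A 0 3 * A 1 2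

/-- The dual of a skew-symmetric `4 × 4` matrix. -/
def skewDual (A : Mat4) : Mat4 :=
  !![0, A 2 3, -A 1 3, A 1 2; -A 2 3, 0, A 0 3, -A 0 2; A 1 3, -A 0 3, 0, A 0 1;
    -A 1 2, A 0 2, -A 0 1, 0]

theorem skew_eta {A : Mat4} (hA : Aᵀ = -A) : A = !![0, A 0 1, A 0 2, A 0 3; -A 0 1, 0, A 1 2, A 1 3;
    -A 0 2, -A 1 2, 0, A 2 3; -A 0 3, -A 1 3, -A 2 3, 0] := by
  have h : ∀ i j, A j i = -A i j := fun i j => congrFun (congrFun hA i) j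
  have hd : ∀ i, A i i = 0 := fun i => self_eq_neg.1 (h i i)
  ext i j
  fin_cases i <;> fin_cases j <;> simp [hd] <;> exact h _ _

theorem symm_eta {A : Mat4} (hA : Aᵀ = A) : A = !![A 0 0, A 0 1, A 0 2, A 0 3;
    A 0 1, A 1 1, A 1 2, A 1 3; A 0 2, A 1 2, A 2 2, A 2 3; A 0 3, A 1 3, A 2 3, A 3 3] := by
  have h : ∀ i j, A j i = A i j := fun i j => congrFun (congrFun hA i) j
  ext i j
  fin_cases i <;> fin_cases j <;> simp <;> exact h _ _

theorem skew_mul_skewDual {A : Mat4} (hA : Aᵀ = -A) : A * skewDual A = -pfaffian A • 1 := by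
  rw [skew_eta hA]
  ext i j
  fin_cases i <;> fin_cases j <;>
    simp [skewDual, pfaffian, Matrix.mul_apply, Fin.sum_univ_four] <;> ring

theorem det_eq_pfaffian_sq {A : Mat4} (hA : Aᵀ = -A) : A.det = pfaffian A ^ 2 := by
  rw [skew_eta hA]
  simp [pfaffian, Matrix.det_succ_row_zero, Fin.sum_univ_succ, Fin.succAbove]
  ring

/-- The dual is an involution that preserves the Pfaffian, so this is the polarization of the
quadratic identity `skew_mul_skewDual` at A plus the dual of B. It is the source of everything
special to dimension four. -/
theorem skew_polarization {A B : Mat4} (hA : Aᵀ = -A) (hB : Bᵀ = -B) :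
    A * B + skewDual B * skewDual A = ((1 / 2 : ℂ) * (A * B).trace) • 1 := by
  rw [skew_eta hA, skew_eta hB]
  ext i j
  fin_cases i <;> fin_cases j <;>
    simp [skewDual, Matrix.trace, Fin.sum_univ_four] <;> ring

theorem pfaffian_congr {g A : Mat4} (hg : gᵀ = g) (hA : Aᵀ = -A) :
    pfaffian (g * A * g) = g.det * pfaffian A := by
  rw [skew_eta hA, symm_eta hg]
  simp [pfaffian, Matrix.mul_apply, Matrix.det_succ_row_zero, Fin.sum_univ_succ,
    Fin.succAbove]
  ring

theorem skewDual_eq {A : Mat4} (hA : Aᵀ = -A) (h0 : A.det ≠ 0) :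
    skewDual A = -pfaffian A • A⁻¹ := by
  have h := congrArg (A⁻¹ * ·) (skew_mul_skewDual hA)
  simpa [Matrix.nonsing_inv_mul_cancel_left _ _ (isUnit_iff_ne_zero.2 h0)] using h

section EffectiveMetric

variable {g θ : Mat4} {l : ℂ}

/-- The quadratic equation satisfied by `θ g θ g`. -/
theorem theta_g_quadratic (hg : gᵀ = g) (hθ : θᵀ = -θ) (hl : l ^ 2 = θ.det * g.det)
    (hl0 : l ≠ 0) :
    (θ * g * θ * g) * (θ * g * θ * g) + l ^ 2 • (1 : Mat4)
      = ((1 / 2 : ℂ) * (θ * g * θ * g).trace) • (θ * g * θ * g) := by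
  have hne : θ.det * g.det ≠ 0 := hl ▸ pow_ne_zero 2 hl0
  have ht := left_ne_zero_of_mul hne
  have hd := right_ne_zero_of_mul hne
  have hB : (g * θ * g)ᵀ = -(g * θ * g) := by
    simp [Matrix.transpose_mul, hg, hθ, Matrix.mul_assoc]
  have hBd : (g * θ * g).det ≠ 0 := by simp [ht, hd]
  -- The two skew matrices are θ and gθg. Their duals are multiples of their inverses, so
  -- multiplying by θgθg turns the second product into a scalar, pf(θ)² det g = det θ det g = l².
  have h1 := skew_polarization hθ hB
  rw [skewDual_eq hθ ht, skewDual_eq hB hBd, pfaffian_congr hg hθ] at h1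
  have e : θ * (g * θ * g) = θ * g * θ * g := by simp only [Matrix.mul_assoc]
  rw [e] at h1
  have h2 := congrArg (· * (θ * g * θ * g)) h1
  simp only [add_mul, Matrix.smul_mul, Matrix.mul_smul, one_mul, neg_smul, neg_mul, mul_neg, neg_neg]
    at h2
  rw [← h2]
  congr 1
  have h3 : (g * θ * g)⁻¹ * θ⁻¹ * (θ * g * θ * g) = 1 := by
    have : θ * g * θ * g = θ * (g * θ * g) := e.symm
    rw [this, Matrix.mul_assoc, Matrix.nonsing_inv_mul_cancel_left _ _ (isUnit_iff_ne_zero.2 ht),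
      Matrix.nonsing_inv_mul _ (isUnit_iff_ne_zero.2 hBd)]
  rw [h3, hl, det_eq_pfaffian_sq hθ, smul_smul]
  congr 1
  ring

variable {U : Mat4}

theorem effInv_transpose (hg : gᵀ = g) (hU : U = l⁻¹ • (θ * g * θᵀ)) : Uᵀ = U := by
  rw [hU]; simp [Matrix.transpose_mul, hg, Matrix.mul_assoc]

theorem effInv_mul_eq (hθ : θᵀ = -θ) (hl0 : l ≠ 0) (hU : U = l⁻¹ • (θ * g * θᵀ)) :
    θ * g * θ * g = -l • (U * g) := by
  rw [hU, hθ]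
  simp [smul_smul, hl0]

/-- The characteristic equation of the effective metric. -/
theorem effInv_quadratic (hg : gᵀ = g) (hθ : θᵀ = -θ) (hl : l ^ 2 = θ.det * g.det)
    (hl0 : l ≠ 0) (hU : U = l⁻¹ • (θ * g * θᵀ)) :
    g⁻¹ = ((1 / 2 : ℂ) * (U * g).trace) • U - U * g * U := by
  have hne : θ.det * g.det ≠ 0 := hl ▸ pow_ne_zero 2 hl0
  have hd := isUnit_iff_ne_zero.2 (right_ne_zero_of_mul hne)
  have h := theta_g_quadratic hg hθ hl hl0
  rw [effInv_mul_eq hθ hl0 hU] at h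
  -- Since θgθg = -l Ug, division by l² normalizes the quadratic equation to constant term 1.
  have h1 : (U * g) * (U * g) + 1 = ((1 / 2 : ℂ) * (U * g).trace) • (U * g) := by
    have h2 := congrArg ((l ^ 2)⁻¹ • ·) h
    simp only [Matrix.smul_mul, Matrix.mul_smul, smul_add, smul_smul, Matrix.trace_smul] at h2
    have e1 : (l ^ 2)⁻¹ * (-l * -l) = 1 := by field_simp
    have e2 : (l ^ 2)⁻¹ * l ^ 2 = 1 := by field_simp
    have e3 : (l ^ 2)⁻¹ * (1 / 2 * -l • (U * g).trace * -l) = 1 / 2 * (U * g).trace := by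
      simp only [smul_eq_mul]; field_simp
    rw [e1, e2, e3] at h2
    simpa using h2
  have h2 := congrArg (· * g⁻¹) h1
  simp only [add_mul, one_mul, Matrix.smul_mul] at h2
  rw [Matrix.mul_nonsing_inv_cancel_right _ _ hd] at h2
  rw [← h2]
  have : U * g * (U * g) * g⁻¹ = U * g * U := by
    rw [← Matrix.mul_assoc, Matrix.mul_nonsing_inv_cancel_right _ _ hd]
  rw [this]; abel

/-- The scalar l⁻¹ enters a 4 × 4 determinant to the fourth power and cancels (det θ det g)² = l⁴.
With this normalization of σ, and in this dimension, G and g have the same determinant. -/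
theorem effInv_det (hl : l ^ 2 = θ.det * g.det)
    (hl0 : l ≠ 0) (hU : U = l⁻¹ • (θ * g * θᵀ)) : U.det * g.det = 1 := by
  rw [hU]
  simp only [det_smul, det_mul, det_transpose, Fintype.card_fin]
  have : l⁻¹ ^ 4 * (θ.det * g.det * θ.det) * g.det = l⁻¹ ^ 4 * (θ.det * g.det) ^ 2 := by ring
  rw [this, ← hl]
  field_simp

/-- The effective metric is a polynomial in the induced metric and the inverse effective metric. -/
theorem effInv_inv (hg : gᵀ = g) (hθ : θᵀ = -θ) (hl : l ^ 2 = θ.det * g.det)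
    (hl0 : l ≠ 0) (hU : U = l⁻¹ • (θ * g * θᵀ)) :
    U⁻¹ = ((1 / 2 : ℂ) * (U * g).trace) • g - g * U * g := by
  have hne : θ.det * g.det ≠ 0 := hl ▸ pow_ne_zero 2 hl0
  have hd := isUnit_iff_ne_zero.2 (right_ne_zero_of_mul hne)
  refine Matrix.inv_eq_right_inv ?_
  have h := congrArg (· * g) (effInv_quadratic hg hθ hl hl0 hU)
  simp only [sub_mul, Matrix.smul_mul, Matrix.nonsing_inv_mul _ hd] at h
  rw [h, mul_sub, Matrix.mul_smul]
  simp only [Matrix.mul_assoc]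

theorem theta_transpose_g_theta (hθ : θᵀ = -θ) (hl0 : l ≠ 0) (hU : U = l⁻¹ • (θ * g * θᵀ)) :
    θᵀ * g * θ = l • U := by
  rw [hU, smul_smul, mul_inv_cancel₀ hl0, one_smul, hθ]
  simp

/-- The square of the trace-reversed effective metric. -/
theorem effInv_trace_sq (hg : gᵀ = g) (hθ : θᵀ = -θ) (hl : l ^ 2 = θ.det * g.det)
    (hl0 : l ≠ 0) (hU : U = l⁻¹ • (θ * g * θᵀ)) :
    (U * g * (U * g)).trace = (1 / 2 : ℂ) * (U * g).trace ^ 2 - 4 := by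
  have hne : θ.det * g.det ≠ 0 := hl ▸ pow_ne_zero 2 hl0
  have hd := isUnit_iff_ne_zero.2 (right_ne_zero_of_mul hne)
  have h := congrArg (fun A => (A * g).trace) (effInv_quadratic hg hθ hl hl0 hU)
  simp only [sub_mul, Matrix.smul_mul, Matrix.nonsing_inv_mul _ hd, Matrix.trace_sub,
    Matrix.trace_smul, Matrix.trace_one, Fintype.card_fin, smul_eq_mul] at h
  have e : U * g * U * g = U * g * (U * g) := by simp only [Matrix.mul_assoc]
  rw [e] at h
  push_cast at h
  linear_combination h

end EffectiveMetric

end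

/-! ### Levi-Civita connection of a complex metric and the Ricci identity -/

section

namespace Patch

/-- A smooth complex metric `G` on an open subset of the model space, with inverse `U`. -/
structure MetricOn (Ω : Set E4) (G U : E4 → Mat4) : Prop where
  isOpen : IsOpen Ω
  smooth : ∀ m n, SmoothOn Ω fun z => G z m n
  smooth_inv : ∀ m n, SmoothOn Ω fun z => U z m n
  symm : ∀ y ∈ Ω, ∀ m n, G y m n = G y n m
  symm_inv : ∀ y ∈ Ω, ∀ m n, U y m n = U y n m
  mul_inv : ∀ y ∈ Ω, G y * U y = 1

/-- The gradient `U^{mn} ∂_n f`. -/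
def gradient (U : E4 → Mat4) (f : E4 → ℂ) (y : E4) (m : Fin 4) : ℂ := ∑ n, U y m n * pd n f y

/-- The covariant derivative `∇_l X^m` of a vector field. -/
def covDerivVec (G : E4 → Mat4) (X : E4 → Fin 4 → ℂ) (y : E4) (l m : Fin 4) : ℂ :=
  pd l (fun z => X z m) y + ∑ j, christoffel G y m l j * X y j

/-- The divergence `∇_l X^l` of a vector field. -/
def divergence (G : E4 → Mat4) (X : E4 → Fin 4 → ℂ) (y : E4) : ℂ := ∑ l, covDerivVec G X y l l

/-- The Hessian `∇_l ∂_n f`. -/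
def hessian (G : E4 → Mat4) (f : E4 → ℂ) (y : E4) (l n : Fin 4) : ℂ :=
  pd l (fun z => pd n f z) y - ∑ j, christoffel G y j l n * pd j f y

/-- The inner product `U^{mn} ∂_m f ∂_n k` of two differentials. -/
def gradInner (U : E4 → Mat4) (f k : E4 → ℂ) (y : E4) : ℂ :=
  ∑ m, gradient U k y m * pd m f y

namespace MetricOn

variable {Ω : Set E4} {G U : E4 → Mat4} {y : E4}

theorem inv_eq (h : MetricOn Ω G U) (hy : y ∈ Ω) : (G y)⁻¹ = U y :=
  Matrix.inv_eq_right_inv (h.mul_inv y hy)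

theorem christoffel_eq (h : MetricOn Ω G U) (hy : y ∈ Ω) (l m n : Fin 4) :
    christoffel G y l m n = (1 / 2 : ℂ) * ∑ k, U y l k *
      (pd m (fun z => G z n k) y + pd n (fun z => G z m k) y - pd k (fun z => G z m n) y) := by
  rw [christoffel, h.inv_eq hy]

theorem pd_symm (h : MetricOn Ω G U) (hy : y ∈ Ω) (k m n : Fin 4) :
    pd k (fun z => G z m n) y = pd k (fun z => G z n m) y :=
  pd_congr_on h.isOpen hy (fun z hz => h.symm z hz m n) k

theorem christoffel_symm (h : MetricOn Ω G U) (hy : y ∈ Ω) (l m n : Fin 4) :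
    christoffel G y l m n = christoffel G y l n m := by
  simp only [christoffel, h.pd_symm hy _ m n]
  congr 1
  exact Finset.sum_congr rfl fun k _ => by ring

theorem christoffel_smooth (h : MetricOn Ω G U) (l m n : Fin 4) :
    SmoothOn Ω fun z => christoffel G z l m n := by
  have : SmoothOn Ω fun z => (1 / 2 : ℂ) * ∑ k, U z l k *
      (pd m (fun z => G z n k) z + pd n (fun z => G z m k) z - pd k (fun z => G z m n) z) :=
    contDiffOn_const.mul <| .sum fun k _ => (h.smooth_inv _ _).mul
      ((((h.smooth _ _).pd h.isOpen _).add ((h.smooth _ _).pd h.isOpen _)).sub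
        ((h.smooth _ _).pd h.isOpen _))
  exact this.congr fun z hz => h.christoffel_eq hz l m n

/-- `Γ_{n,lm} + Γ_{m,ln} = ∂_l G_{mn}` -/
theorem lower_christoffel (h : MetricOn Ω G U) (hy : y ∈ Ω) (l m n : Fin 4) :
    ∑ k, G y n k * christoffel G y k l m = (1 / 2 : ℂ) *
      (pd l (fun z => G z m n) y + pd m (fun z => G z l n) y - pd n (fun z => G z l m) y) := by
  set v : Fin 4 → ℂ := fun k =>
    pd l (fun z => G z m k) y + pd m (fun z => G z l k) y - pd k (fun z => G z l m) y with hv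
  have e : (fun k => christoffel G y k l m) = (1 / 2 : ℂ) • (U y).mulVec v := by
    funext k
    rw [h.christoffel_eq hy]; rfl
  have : (G y).mulVec (fun k => christoffel G y k l m) n = ((1 / 2 : ℂ) • v) n := by
    rw [e, Matrix.mulVec_smul, Matrix.mulVec_mulVec, h.mul_inv y hy, Matrix.one_mulVec]
  exact this

/-- Adding the two lowered Christoffel symbols cancels all but the derivative in direction l: the
metric is parallel. -/
theorem compat (h : MetricOn Ω G U) (hy : y ∈ Ω) (l m n : Fin 4) :
    pd l (fun z => G z m n) y =
      (∑ k, christoffel G y k l m * G y k n) + ∑ k, christoffel G y k l n * G y m k := by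
  have h1 := h.lower_christoffel hy l m n
  have h2 := h.lower_christoffel hy l n m
  simp only [h.symm y hy n, h.pd_symm hy _ n m] at h1 h2
  simp only [mul_comm (christoffel G y _ l _)]
  rw [h1, h2, h.pd_symm hy n l m, h.pd_symm hy m l n]
  ring

/-- `∇_l U^{mn} = 0` -/
theorem compat_inv (h : MetricOn Ω G U) (hy : y ∈ Ω) (l m n : Fin 4) :
    pd l (fun z => U z m n) y =
      -((∑ k, christoffel G y m l k * U y k n) + ∑ k, christoffel G y n l k * U y m k) := by
  set Γ : Mat4 := Matrix.of fun m k => christoffel G y m l k with hΓ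
  set dG : Mat4 := Matrix.of fun m n => pd l (fun z => G z m n) y with hdG
  set dU : Mat4 := Matrix.of fun m n => pd l (fun z => U z m n) y with hdU
  have e1 : dG = Γ.transpose * G y + G y * Γ := by
    ext m n
    rw [hdG, Matrix.of_apply, h.compat hy]
    simp [Matrix.mul_apply, hΓ, mul_comm]
  -- The product GU is the constant 1; its derivative determines that of U from `compat`.
  have e2 : dG * U y + G y * dU = 0 := by
    ext m n
    have : pd l (fun z => ∑ k, G z m k * U z k n) y = 0 := by
      have hc : ∀ z ∈ Ω, ∑ k, G z m k * U z k n = (1 : Mat4) m n := fun z hz => by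
        rw [← h.mul_inv z hz, Matrix.mul_apply]
      rw [pd_congr_on h.isOpen hy hc, pd_const]
    rw [pd_sum_mul (fun k => (h.smooth m k).differentiableAt h.isOpen hy)
      (fun k => (h.smooth_inv k n).differentiableAt h.isOpen hy)] at this
    rw [Finset.sum_add_distrib] at this
    simp only [Matrix.add_apply, Matrix.mul_apply, hdG, hdU, Matrix.of_apply, Matrix.zero_apply]
    rw [add_comm]; exact this
  have hUG : U y * G y = 1 := mul_eq_one_comm.1 (h.mul_inv y hy)
  have hUs : (U y).transpose = U y := Matrix.ext fun m n => (h.symm_inv y hy n m)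
  have e3 : dU = -(Γ * U y + U y * Γ.transpose) := by
    have h1 : U y * (dG * U y + G y * dU) = U y * Γ.transpose + Γ * U y + dU := by
      rw [e1, Matrix.mul_add, Matrix.add_mul, Matrix.mul_add, ← Matrix.mul_assoc (U y) (G y) dU,
        hUG, Matrix.one_mul, Matrix.mul_assoc Γ.transpose, h.mul_inv y hy, Matrix.mul_one,
        ← Matrix.mul_assoc (U y), ← Matrix.mul_assoc (U y), hUG, Matrix.one_mul]
    rw [e2, Matrix.mul_zero] at h1
    rw [eq_neg_iff_add_eq_zero, h1]; abel
  have := congrFun (congrFun e3 m) n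
  rw [hdU, Matrix.of_apply] at this
  rw [this]
  simp [Matrix.mul_apply, hΓ, mul_comm]

/-- `Γ^m_{mj} = ½ U^{mn} ∂_j G_{mn}` -/
theorem christoffel_trace (h : MetricOn Ω G U) (hy : y ∈ Ω) (j : Fin 4) :
    ∑ m, christoffel G y m m j
      = (1 / 2 : ℂ) * ∑ m, ∑ n, U y m n * pd j (fun z => G z n m) y := by
  have h1 : ∀ m, christoffel G y m m j = (1 / 2 : ℂ) * ∑ n, U y m n *
      (pd j (fun z => G z n m) y + pd m (fun z => G z j n) y - pd n (fun z => G z j m) y) := by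
    intro m
    rw [h.christoffel_eq hy]
    congr 1
    refine Finset.sum_congr rfl fun n _ => ?_
    rw [h.pd_symm hy j m n, h.pd_symm hy n m j]
    ring
  have h2 : ∑ m, ∑ n, U y m n * pd m (fun z => G z j n) y
      = ∑ m, ∑ n, U y m n * pd n (fun z => G z j m) y := by
    rw [Finset.sum_comm]
    exact Finset.sum_congr rfl fun m _ => Finset.sum_congr rfl fun n _ => by
      rw [h.symm_inv y hy]
  simp only [h1, mul_sub, mul_add, Finset.sum_add_distrib, Finset.sum_sub_distrib,
    ← Finset.mul_sum, h2]
  ring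

theorem gradient_smooth (h : MetricOn Ω G U) {f : E4 → ℂ} (hf : SmoothOn Ω f) (m : Fin 4) :
    SmoothOn Ω fun z => gradient U f z m :=
  .sum fun n _ => (h.smooth_inv m n).mul (hf.pd h.isOpen n)

theorem covDerivVec_smooth (h : MetricOn Ω G U) {X : E4 → Fin 4 → ℂ}
    (hX : ∀ m, SmoothOn Ω fun z => X z m) (l m : Fin 4) :
    SmoothOn Ω fun z => covDerivVec G X z l m :=
  ((hX m).pd h.isOpen l).add (.sum fun j _ => (h.christoffel_smooth _ _ _).mul (hX j))

theorem gradInner_smooth (h : MetricOn Ω G U) {f k : E4 → ℂ} (hf : SmoothOn Ω f)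
    (hk : SmoothOn Ω k) : SmoothOn Ω fun z => gradInner U f k z :=
  .sum fun m _ => (h.gradient_smooth hk m).mul (hf.pd h.isOpen m)

theorem hessian_symm (h : MetricOn Ω G U) (hy : y ∈ Ω) {f : E4 → ℂ} (hf : SmoothOn Ω f)
    (l n : Fin 4) : hessian G f y l n = hessian G f y n l := by
  simp only [hessian, pd_comm hf h.isOpen hy l n, h.christoffel_symm hy _ l n]

/-- `∇_l (grad f)^m = U^{mn} ∇_l ∂_n f` -/
theorem covDerivVec_gradient (h : MetricOn Ω G U) (hy : y ∈ Ω) {f : E4 → ℂ} (hf : SmoothOn Ω f)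
    (l m : Fin 4) :
    covDerivVec G (gradient U f) y l m = ∑ n, U y m n * hessian G f y l n := by
  have h1 : pd l (fun z => gradient U f z m) y
      = ∑ n, (U y m n * pd l (fun z => pd n f z) y + pd l (fun z => U z m n) y * pd n f y) := by
    exact pd_sum_mul (fun n => (h.smooth_inv m n).differentiableAt h.isOpen hy)
      (fun n => (hf.pd h.isOpen n).differentiableAt h.isOpen hy) l
  rw [covDerivVec, h1]
  simp only [h.compat_inv hy, gradient, hessian]
  simp only [Fin.sum_univ_four]
  ring

/-- The commutator of covariant derivatives: `∇_l ∇_m X^l - ∂_m ∇_l X^l = R_{jm} X^j`. -/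
theorem ricci_identity (h : MetricOn Ω G U) (hy : y ∈ Ω) {X : E4 → Fin 4 → ℂ}
    (hX : ∀ m, SmoothOn Ω fun z => X z m) (m : Fin 4) :
    (∑ l, (pd l (fun z => covDerivVec G X z m l) y
        + (∑ j, christoffel G y l l j * covDerivVec G X y m j)
        - ∑ j, christoffel G y j l m * covDerivVec G X y j l))
      = pd m (divergence G X) y + ∑ j, ricci G y j m * X y j := by
  have hd := fun j => (hX j).differentiableAt h.isOpen hy
  have hdd := fun i j => ((hX j).pd h.isOpen i).differentiableAt h.isOpen hy
  have hΓ := fun i j k => (h.christoffel_smooth i j k).differentiableAt h.isOpen hy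
  have h1 : ∀ i l k, pd i (fun z => covDerivVec G X z l k) y = pd i (fun z => pd l (fun z => X z k) z) y
      + ∑ j, (christoffel G y k l j * pd i (fun z => X z j) y
        + pd i (fun z => christoffel G z k l j) y * X y j) := by
    intro i l k
    have := pd_sum_mul (s := Finset.univ) (fun j => hΓ k l j) hd i
    rw [← this]
    exact pd_add (hdd _ _) (DifferentiableAt.fun_sum fun j _ => (hΓ _ _ _).fun_mul (hd _)) i
  have h2 : pd m (divergence G X) y = ∑ l, pd m (fun z => covDerivVec G X z l l) y :=
    pd_sum (fun l _ => (h.covDerivVec_smooth hX l l).differentiableAt h.isOpen hy) m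
  rw [h2]
  simp only [h1, pd_comm (hX _) h.isOpen hy m]
  simp only [ricci, covDerivVec, h.christoffel_symm hy _ _ m]
  -- The symmetry of the Christoffel symbols is used under the derivative as well, to bring all
  -- lower indices into one order; what is left is a polynomial identity.
  have h3 : ∀ l k j, pd l (fun z => christoffel G z k j m) y = pd l (fun z => christoffel G z k m j) y :=
    fun l k j => pd_congr_on h.isOpen hy (fun z hz => h.christoffel_symm hz _ _ _) l
  have h4 : ∀ l k j, pd m (fun z => christoffel G z k l j) y = pd m (fun z => christoffel G z k j l) y :=
    fun l k j => pd_congr_on h.isOpen hy (fun z hz => h.christoffel_symm hz _ _ _) m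
  simp only [h3]
  simp only [Fin.sum_univ_four, h4 1 _ 0, h4 2 _ 0, h4 3 _ 0, h4 2 _ 1, h4 3 _ 1, h4 3 _ 2,
    h.christoffel_symm hy _ 1 0, h.christoffel_symm hy _ 2 0, h.christoffel_symm hy _ 3 0,
    h.christoffel_symm hy _ 2 1, h.christoffel_symm hy _ 3 1, h.christoffel_symm hy _ 3 2]
  ring

end MetricOn

end Patch

end

/-! ### Gradients, Hessians and Bochner's formula -/

section

namespace Patch

namespace MetricOn

variable {Ω : Set E4} {G U : E4 → Mat4} {y : E4}

theorem gradInner_comm (h : MetricOn Ω G U) (hy : y ∈ Ω) (f k : E4 → ℂ) :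
    gradInner U f k y = gradInner U k f y := by
  simp only [gradInner, gradient, Finset.sum_mul]
  rw [Finset.sum_comm]
  refine Finset.sum_congr rfl fun m _ => Finset.sum_congr rfl fun n _ => ?_
  rw [h.symm_inv y hy m n]; ring

theorem divergence_congr (h : MetricOn Ω G U) (hy : y ∈ Ω) {X Y : E4 → Fin 4 → ℂ}
    (hXY : ∀ z ∈ Ω, ∀ m, X z m = Y z m) : divergence G X y = divergence G Y y := by
  simp only [divergence, covDerivVec, hXY y hy]
  refine Finset.sum_congr rfl fun l _ => ?_
  rw [pd_congr_on h.isOpen hy (fun z hz => hXY z hz l)]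

theorem divergence_add (h : MetricOn Ω G U) (hy : y ∈ Ω) {X Y : E4 → Fin 4 → ℂ}
    (hX : ∀ m, SmoothOn Ω fun z => X z m) (hY : ∀ m, SmoothOn Ω fun z => Y z m) :
    divergence G (fun z m => X z m + Y z m) y = divergence G X y + divergence G Y y := by
  simp only [divergence, covDerivVec, ← Finset.sum_add_distrib]
  refine Finset.sum_congr rfl fun l _ => ?_
  rw [pd_add ((hX l).differentiableAt h.isOpen hy) ((hY l).differentiableAt h.isOpen hy)]
  simp only [mul_add, Finset.sum_add_distrib]
  ring

/-- `∂_l (w X^l) = w ∇_l X^l` for a density `w` that is proportional to `√|det G|`. -/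
theorem divergence_density (h : MetricOn Ω G U) (hy : y ∈ Ω) {X : E4 → Fin 4 → ℂ}
    (hX : ∀ m, SmoothOn Ω fun z => X z m) {w : E4 → ℂ} (hw : SmoothOn Ω w)
    (hwd : ∀ j, pd j w y = w y * ∑ m, christoffel G y m m j) :
    ∑ l, pd l (fun z => w z * X z l) y = w y * divergence G X y := by
  simp only [pd_mul (hw.differentiableAt h.isOpen hy) ((hX _).differentiableAt h.isOpen hy), hwd,
    divergence, covDerivVec, Fin.sum_univ_four]
  ring

theorem laplacian_eq (h : MetricOn Ω G U) (hy : y ∈ Ω) {f : E4 → ℂ} (hf : SmoothOn Ω f) :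
    laplacian G f y = divergence G (gradient U f) y := by
  simp only [divergence, h.covDerivVec_gradient hy hf, laplacian, h.inv_eq hy]
  refine Finset.sum_congr rfl fun m _ => Finset.sum_congr rfl fun n _ => rfl

/-- Leibniz rule for a parallel metric: the derivative falls on the two differentials only, and the
Christoffel terms make it covariant. -/
theorem pd_gradInner (h : MetricOn Ω G U) (hy : y ∈ Ω) {f k : E4 → ℂ} (hf : SmoothOn Ω f)
    (hk : SmoothOn Ω k) (l : Fin 4) :
    pd l (gradInner U f k) y = ∑ m, (gradient U k y m * hessian G f y l m
      + gradient U f y m * hessian G k y l m) := by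
  have h1 : pd l (gradInner U f k) y = ∑ m, (gradient U k y m * pd l (fun z => pd m f z) y
      + pd l (fun z => gradient U k z m) y * pd m f y) :=
    pd_sum_mul (fun m => (h.gradient_smooth hk m).differentiableAt h.isOpen hy)
      (fun m => (hf.pd h.isOpen m).differentiableAt h.isOpen hy) l
  have h2 : ∀ m, pd l (fun z => gradient U k z m) y
      = (∑ n, U y m n * hessian G k y l n) - ∑ j, christoffel G y m l j * gradient U k y j := by
    intro m
    rw [← h.covDerivVec_gradient hy hk, covDerivVec]; ring
  have h3 : ∀ m, gradient U f y m = ∑ n, U y n m * pd n f y := fun m =>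
    Finset.sum_congr rfl fun n _ => by rw [h.symm_inv y hy]
  rw [h1]
  simp only [h2, h3 _]
  simp only [hessian, Fin.sum_univ_four]
  ring

/-- `grad ⟨f, k⟩ = ∇_{grad f} grad k + ∇_{grad k} grad f` -/
theorem gradient_gradInner (h : MetricOn Ω G U) (hy : y ∈ Ω) {f k : E4 → ℂ} (hf : SmoothOn Ω f)
    (hk : SmoothOn Ω k) (p : Fin 4) :
    gradient U (gradInner U f k) y p =
      (∑ m, gradient U k y m * covDerivVec G (gradient U f) y m p)
        + ∑ m, gradient U f y m * covDerivVec G (gradient U k) y m p := by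
  simp only [h.covDerivVec_gradient hy hf, h.covDerivVec_gradient hy hk]
  rw [gradient]
  simp only [h.pd_gradInner hy hf hk, Finset.mul_sum, Finset.sum_add_distrib, mul_add]
  congr 1
  all_goals
    rw [Finset.sum_comm]
    refine Finset.sum_congr rfl fun m _ => Finset.sum_congr rfl fun n _ => ?_
  · rw [h.hessian_symm hy hf m n]; ring
  · rw [h.hessian_symm hy hk m n]; ring

/-- For the divergence of ∇_Y X, the derivative either falls on Y, giving the product of the two
covariant derivatives, or on ∇X, where `ricci_identity` exchanges the order of differentiation at
the price of a Ricci term. -/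
theorem divergence_contract (h : MetricOn Ω G U) (hy : y ∈ Ω) {X Y : E4 → Fin 4 → ℂ}
    (hX : ∀ m, SmoothOn Ω fun z => X z m) (hY : ∀ m, SmoothOn Ω fun z => Y z m) :
    divergence G (fun z p => ∑ m, Y z m * covDerivVec G X z m p) y =
      (∑ p, ∑ m, covDerivVec G Y y p m * covDerivVec G X y m p)
        + ∑ m, Y y m * (pd m (divergence G X) y + ∑ j, ricci G y j m * X y j) := by
  simp only [← h.ricci_identity hy hX]
  have h1 : ∀ p, pd p (fun z => ∑ m, Y z m * covDerivVec G X z m p) y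
      = ∑ m, (Y y m * pd p (fun z => covDerivVec G X z m p) y
        + pd p (fun z => Y z m) y * covDerivVec G X y m p) := fun p =>
    pd_sum_mul (fun m => (hY m).differentiableAt h.isOpen hy)
      (fun m => (h.covDerivVec_smooth hX m p).differentiableAt h.isOpen hy) p
  have h2 : ∀ p m, pd p (fun z => Y z m) y
      = covDerivVec G Y y p m - ∑ j, christoffel G y m p j * Y y j := fun p m => by
    rw [covDerivVec]; ring
  rw [divergence]
  simp only [covDerivVec.eq_1 G (fun z p => ∑ m, Y z m * covDerivVec G X z m p), h1, h2]
  simp only [Fin.sum_univ_four, h.christoffel_symm hy _ 1 0, h.christoffel_symm hy _ 2 0,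
    h.christoffel_symm hy _ 3 0, h.christoffel_symm hy _ 2 1, h.christoffel_symm hy _ 3 1,
    h.christoffel_symm hy _ 3 2]
  ring

/-- The contraction `(∇_p (grad f)^m) (∇_m (grad k)^p)` of two Hessians. -/
def _root_.EmergentGravity.Patch.hessInner (G U : E4 → Mat4) (f k : E4 → ℂ) (y : E4) : ℂ :=
  ∑ p, ∑ m, covDerivVec G (gradient U f) y p m * covDerivVec G (gradient U k) y m p

theorem _root_.EmergentGravity.Patch.hessInner_comm (G U : E4 → Mat4) (f k : E4 → ℂ) (y : E4) :
    hessInner G U f k y = hessInner G U k f y := by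
  rw [hessInner, hessInner, Finset.sum_comm]
  exact Finset.sum_congr rfl fun p _ => Finset.sum_congr rfl fun m _ => mul_comm _ _

/-- The Ricci tensor evaluated on two gradients. -/
def _root_.EmergentGravity.Patch.ricciGrad (G U : E4 → Mat4) (f k : E4 → ℂ) (y : E4) : ℂ :=
  ∑ m, ∑ j, gradient U f y m * ricci G y j m * gradient U k y j

/-- Bochner's formula. -/
theorem bochner (h : MetricOn Ω G U) (hy : y ∈ Ω) {f k : E4 → ℂ} (hf : SmoothOn Ω f)
    (hk : SmoothOn Ω k) :
    divergence G (gradient U (gradInner U f k)) y = 2 * hessInner G U f k y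
      + gradInner U (divergence G (gradient U k)) f y
      + gradInner U (divergence G (gradient U f)) k y
      + ricciGrad G U f k y + ricciGrad G U k f y := by
  have hX := fun m => h.gradient_smooth hf m
  have hY := fun m => h.gradient_smooth hk m
  -- The gradient of the inner product is ∇_{grad k} grad f + ∇_{grad f} grad k, and
  -- `divergence_contract` applies to each summand. The two Hessian products agree; both orders of
  -- the Ricci term are kept, so no symmetry of the Ricci tensor is needed.
  rw [h.divergence_congr hy (fun z hz p => h.gradient_gradInner hz hf hk p),
    h.divergence_add hy
      (fun p => .sum fun m _ => (hY m).mul (h.covDerivVec_smooth hX m p))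
      (fun p => .sum fun m _ => (hX m).mul (h.covDerivVec_smooth hY m p)),
    h.divergence_contract hy hX hY, h.divergence_contract hy hY hX]
  rw [← hessInner, ← hessInner, hessInner_comm G U k f]
  simp only [mul_add, Finset.sum_add_distrib, ← gradInner.eq_1]
  simp only [gradInner, ricciGrad, Finset.mul_sum, mul_assoc]
  ring

end MetricOn

end Patch

end

/-! ### Branes in a coordinate patch: algebra and smoothness of the effective metric -/

section

namespace Patch

/-- The metric `η_{ab} ∂_μ ξ^a ∂_ν ξ^b` induced by the functions `ξ^a`. -/
def inducedMetric {D : ℕ} (η : Fin D → ℝ) (ξ : Fin D → E4 → ℂ) (y : E4) : Mat4 :=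
  Matrix.of fun μ ν => ∑ a, (η a : ℂ) * pd μ (ξ a) y * pd ν (ξ a) y

/-- The bracket `θ^{μν} ∂_μ f ∂_ν k` in a coordinate patch. -/
def brk (θ : E4 → Mat4) (f k : E4 → ℂ) (y : E4) : ℂ :=
  ∑ ν, (∑ μ, θ y μ ν * pd μ f y) * pd ν k y

end Patch

open Patch

/-- A brane in a coordinate patch: functions `ξ^a` and a Poisson tensor `θ^{μν}` on an open set,
such that `det θ · det g` is positive and `det g` is real for the induced metric `g`. -/
structure PatchBrane (D : ℕ) where
  η : Fin D → ℝ
  ξ : Fin D → E4 → ℂ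
  θ : E4 → Mat4
  Ω : Set E4
  isOpen : IsOpen Ω
  ξ_smooth : ∀ a, SmoothOn Ω (ξ a)
  θ_smooth : ∀ m n, SmoothOn Ω fun z => θ z m n
  θ_skew : ∀ y ∈ Ω, (θ y).transpose = -θ y
  jacobi : ∀ y ∈ Ω, ∀ i j k, (∑ ν, (θ y i ν * pd ν (fun z => θ z j k) y
    + θ y j ν * pd ν (fun z => θ z k i) y + θ y k ν * pd ν (fun z => θ z i j) y)) = 0
  unimodular : ∀ y ∈ Ω, ∃ r : ℝ, 0 < r ∧ (θ y).det * (inducedMetric η ξ y).det = (r : ℂ)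
  det_real : ∀ y ∈ Ω, ∃ r : ℝ, (inducedMetric η ξ y).det = (r : ℂ)

namespace PatchBrane

variable {D : ℕ} (P : PatchBrane D) {y : E4}

/-- The induced metric. -/
def g : E4 → Mat4 := inducedMetric P.η P.ξ

/-- The inverse effective metric. -/
def U : E4 → Mat4 := effInv P.g P.θ

/-- The effective metric. -/
def G : E4 → Mat4 := effMetric P.g P.θ

/-- The function `e^σ`. -/
def l (y : E4) : ℂ := (Real.exp (sigma P.g P.θ y) : ℂ)

/-- The density `√|det G|`. -/
def w (y : E4) : ℂ := (Real.sqrt ‖(P.G y).det‖ : ℂ)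

/-- The trace `G^{μν} g_{μν}`. -/
def τ (y : E4) : ℂ := (P.U y * P.g y).trace

variable {P}

theorem ne_zero (hy : y ∈ P.Ω) : (P.θ y).det * (P.g y).det ≠ 0 := by
  obtain ⟨r, hr, h⟩ := P.unimodular y hy
  rw [g, h]
  exact_mod_cast hr.ne'

theorem l_ne_zero : P.l y ≠ 0 := by
  rw [l]; exact_mod_cast (Real.exp_pos _).ne'

theorem l_sq (hy : y ∈ P.Ω) : P.l y ^ 2 = (P.θ y).det * (P.g y).det := by
  obtain ⟨r, hr, h⟩ := P.unimodular y hy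
  have h' : (P.θ y).det * (P.g y).det = (r : ℂ) := h
  rw [l, sigma, h', Complex.norm_real, Real.norm_of_nonneg hr.le, ← Complex.ofReal_pow,
    ← Real.exp_nat_mul]
  congr 1
  push_cast
  rw [mul_div_cancel₀ _ (two_ne_zero), Real.exp_log hr]

theorem g_symm (y : E4) : (P.g y).transpose = P.g y := by
  ext m n
  simp only [Matrix.transpose_apply, g, inducedMetric, Matrix.of_apply]
  exact Finset.sum_congr rfl fun a _ => by ring

theorem U_eq (y : E4) : P.U y = (P.l y)⁻¹ • (P.θ y * P.g y * (P.θ y).transpose) := by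
  rw [U, effInv, l, Real.exp_neg, Complex.ofReal_inv]

theorem gInv_eq (hy : y ∈ P.Ω) :
    (P.g y)⁻¹ = ((1 / 2 : ℂ) * P.τ y) • P.U y - P.U y * P.g y * P.U y :=
  effInv_quadratic (g_symm y) (P.θ_skew y hy) (l_sq hy) l_ne_zero (U_eq y)

theorem G_eq (hy : y ∈ P.Ω) :
    P.G y = ((1 / 2 : ℂ) * P.τ y) • P.g y - P.g y * P.U y * P.g y :=
  effInv_inv (g_symm y) (P.θ_skew y hy) (l_sq hy) l_ne_zero (U_eq y)

theorem U_det (hy : y ∈ P.Ω) : (P.U y).det * (P.g y).det = 1 :=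
  effInv_det (l_sq hy) l_ne_zero (U_eq y)

theorem G_mul_U (hy : y ∈ P.Ω) : P.G y * P.U y = 1 :=
  Matrix.nonsing_inv_mul _ (isUnit_iff_ne_zero.2 (left_ne_zero_of_mul_eq_one (U_det hy)))

/-- Both determinants invert det U. As g comes from the embedding, facts about det G (being real,
being nonzero, its change between charts) can be read off from g. -/
theorem G_det (hy : y ∈ P.Ω) : (P.G y).det = (P.g y).det := by
  have h1 := congrArg Matrix.det (G_mul_U hy)
  rw [Matrix.det_mul, Matrix.det_one] at h1
  have h2 := U_det hy
  have h3 := left_ne_zero_of_mul_eq_one h2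
  exact mul_right_cancel₀ h3 (by rw [h1, mul_comm, h2])

theorem g_det_ne_zero (hy : y ∈ P.Ω) : (P.g y).det ≠ 0 := right_ne_zero_of_mul (ne_zero hy)

theorem τ_sq (hy : y ∈ P.Ω) :
    (P.U y * P.g y * (P.U y * P.g y)).trace = (1 / 2 : ℂ) * P.τ y ^ 2 - 4 :=
  effInv_trace_sq (g_symm y) (P.θ_skew y hy) (l_sq hy) l_ne_zero (U_eq y)

theorem g_smooth (m n : Fin 4) : SmoothOn P.Ω fun z => P.g z m n :=
  SmoothOn.sum (s := Finset.univ)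
    (F := fun a z => (P.η a : ℂ) * pd m (P.ξ a) z * pd n (P.ξ a) z)
    fun a _ => (contDiffOn_const.mul ((P.ξ_smooth a).pd P.isOpen m)).mul
      ((P.ξ_smooth a).pd P.isOpen n)

theorem σ_smooth : ContDiffOn ℝ ∞ (sigma P.g P.θ) P.Ω :=
  (SmoothOn.log_norm ((SmoothOn.det P.θ_smooth).mul (SmoothOn.det g_smooth))
    fun _ hz => ne_zero hz).div_const 2

theorem l_smooth : SmoothOn P.Ω P.l := SmoothOn.ofReal (Real.contDiff_exp.comp_contDiffOn σ_smooth)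

theorem mul_smooth {Ω : Set E4} {A B : E4 → Mat4} (hA : ∀ m n, SmoothOn Ω fun z => A z m n)
    (hB : ∀ m n, SmoothOn Ω fun z => B z m n) (m n : Fin 4) :
    SmoothOn Ω fun z => (A z * B z) m n := by
  simp only [Matrix.mul_apply]
  exact .sum fun k _ => (hA m k).mul (hB k n)

theorem U_smooth (m n : Fin 4) : SmoothOn P.Ω fun z => P.U z m n := by
  have h := mul_smooth (mul_smooth P.θ_smooth g_smooth)
    (B := fun z => (P.θ z).transpose) (fun m n => P.θ_smooth n m) m n
  refine ((l_smooth.inv fun _ _ => l_ne_zero).mul h).congr fun z _ => ?_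
  rw [U_eq, Matrix.smul_apply, smul_eq_mul]

theorem τ_smooth : SmoothOn P.Ω P.τ :=
  SmoothOn.sum (s := Finset.univ) (F := fun m z => (P.U z * P.g z) m m)
    fun m _ => mul_smooth U_smooth g_smooth m m

/-- By `G_eq`, G is a polynomial in g, U and τ, so its smoothness requires no inversion. -/
theorem G_smooth (m n : Fin 4) : SmoothOn P.Ω fun z => P.G z m n := by
  have h := ((contDiffOn_const (c := (1 / 2 : ℂ))).mul (τ_smooth (P := P))).mul (g_smooth m n)
  refine (h.sub (mul_smooth (mul_smooth g_smooth U_smooth) g_smooth m n)).congr fun z hz => ?_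
  rw [G_eq hz, Matrix.sub_apply, Matrix.smul_apply, smul_eq_mul]

theorem U_symm (y : E4) : (P.U y).transpose = P.U y := effInv_transpose (g_symm y) (U_eq y)

theorem metricOn (P : PatchBrane D) : MetricOn P.Ω P.G P.U where
  isOpen := P.isOpen
  smooth := G_smooth
  smooth_inv := U_smooth
  symm y hy m n := by
    have : (P.G y).transpose = P.G y := by
      rw [G, effMetric, ← U, Matrix.transpose_nonsing_inv, U_symm]
    exact congrFun (congrFun this n) m
  symm_inv y _ m n := congrFun (congrFun (U_symm y) n) m
  mul_inv _ hy := G_mul_U hy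

theorem w_ne_zero (hy : y ∈ P.Ω) : P.w y ≠ 0 := by
  rw [w, Ne, Complex.ofReal_eq_zero, Real.sqrt_eq_zero (norm_nonneg _), norm_eq_zero, G_det hy]
  exact g_det_ne_zero hy

theorem w_smooth : SmoothOn P.Ω P.w := by
  have h : SmoothOn P.Ω fun z => (P.G z).det := SmoothOn.det G_smooth
  have h0 : ∀ z ∈ P.Ω, (P.G z).det ≠ 0 := fun z hz => by rw [G_det hz]; exact g_det_ne_zero hz
  exact SmoothOn.ofReal ((ContDiffOn.norm ℝ h h0).sqrt fun z hz => norm_ne_zero_iff.2 (h0 z hz))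

/-- det G is real but may have either sign, so w² is only its absolute value; the fourth power is
free of the sign and can be differentiated with `pd_det`. -/
theorem w_pow (hy : y ∈ P.Ω) : P.w y ^ 4 = (P.G y).det ^ 2 := by
  obtain ⟨r, hr⟩ := P.det_real y hy
  have hr' : (P.G y).det = (r : ℂ) := (G_det hy).trans hr
  rw [w, hr', Complex.norm_real, Real.norm_eq_abs]
  norm_cast
  rw [show 4 = 2 * 2 from rfl, pow_mul, Real.sq_sqrt (abs_nonneg r), sq_abs]

/-- Differentiating `w_pow` gives the logarithmic derivative of √|det G|, which is the trace of the
Christoffel symbols. This is the hypothesis of `divergence_density`. -/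
theorem pd_w (hy : y ∈ P.Ω) (j : Fin 4) :
    pd j P.w y = P.w y * ∑ m, christoffel P.G y m m j := by
  have hw := w_smooth.differentiableAt P.isOpen hy
  have hG : SmoothOn P.Ω fun z => (P.G z).det := SmoothOn.det G_smooth
  have hGd := hG.differentiableAt P.isOpen hy
  have h1 := pd_congr_on P.isOpen hy (f := fun z => P.w z * P.w z * (P.w z * P.w z))
    (g := fun z => (P.G z).det * (P.G z).det)
    (fun z hz => by have := w_pow hz; linear_combination this) j
  have h0 : (P.G y).det ≠ 0 := by rw [G_det hy]; exact g_det_ne_zero hy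
  rw [pd_mul (hw.fun_mul hw) (hw.fun_mul hw), pd_mul hw hw, pd_mul hGd hGd,
    pd_det (A := P.G) (fun m n => (G_smooth m n).differentiableAt P.isOpen hy) h0] at h1
  rw [P.metricOn.christoffel_trace hy]
  rw [P.metricOn.inv_eq hy] at h1
  have h2 := w_pow hy
  have hw0 := w_ne_zero hy
  set S := ∑ m, ∑ n, P.U y m n * pd j (fun z => P.G z n m) y
  refine mul_left_cancel₀ (mul_ne_zero (by norm_num : (4 : ℂ) ≠ 0) (pow_ne_zero 3 hw0)) ?_
  linear_combination h1 - 2 * S * h2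

theorem pfaffian_ne_zero (hy : y ∈ P.Ω) : pfaffian (P.θ y) ≠ 0 := by
  have := left_ne_zero_of_mul (ne_zero hy)
  rw [det_eq_pfaffian_sq (P.θ_skew y hy)] at this
  exact fun h => this (by rw [h]; simp)

theorem pfaffian_smooth : SmoothOn P.Ω fun z => pfaffian (P.θ z) :=
  (((P.θ_smooth 0 1).mul (P.θ_smooth 2 3)).sub ((P.θ_smooth 0 2).mul (P.θ_smooth 1 3))).add
    ((P.θ_smooth 0 3).mul (P.θ_smooth 1 2))

theorem θ_pd_skew (hy : y ∈ P.Ω) (j m n : Fin 4) :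
    pd j (fun z => P.θ z m n) y = -pd j (fun z => P.θ z n m) y := by
  rw [← pd_neg]
  exact pd_congr_on P.isOpen hy (fun z hz => congrFun (congrFun (P.θ_skew z hz) n) m) j

/-- The Jacobi identity makes `θ^{μν} / pf θ` divergence free. -/
theorem pfaffian_divergence (hy : y ∈ P.Ω) (i : Fin 4) :
    pfaffian (P.θ y) * ∑ ν, pd ν (fun z => P.θ z i ν) y
      = ∑ ν, P.θ y i ν * pd ν (fun z => pfaffian (P.θ z)) y := by
  have hd := fun m n => (P.θ_smooth m n).differentiableAt P.isOpen hy
  have h1 : ∀ ν, pd ν (fun z => pfaffian (P.θ z)) y =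
      (P.θ y 0 1 * pd ν (fun z => P.θ z 2 3) y + pd ν (fun z => P.θ z 0 1) y * P.θ y 2 3)
      - (P.θ y 0 2 * pd ν (fun z => P.θ z 1 3) y + pd ν (fun z => P.θ z 0 2) y * P.θ y 1 3)
      + (P.θ y 0 3 * pd ν (fun z => P.θ z 1 2) y + pd ν (fun z => P.θ z 0 3) y * P.θ y 1 2) := by
    intro ν
    rw [← pd_mul (hd 0 1) (hd 2 3), ← pd_mul (hd 0 2) (hd 1 3), ← pd_mul (hd 0 3) (hd 1 2),
      ← pd_sub ((hd 0 1).fun_mul (hd 2 3)) ((hd 0 2).fun_mul (hd 1 3)),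
      ← pd_add (((hd 0 1).fun_mul (hd 2 3)).fun_sub ((hd 0 2).fun_mul (hd 1 3)))
        ((hd 0 3).fun_mul (hd 1 2))]
    rfl
  have hs : ∀ m n, P.θ y m n = -P.θ y n m := fun m n =>
    congrFun (congrFun (P.θ_skew y hy) n) m
  have hz : ∀ m, P.θ y m m = 0 := fun m => self_eq_neg.1 (hs m m)
  have hdz : ∀ j m, pd j (fun z => P.θ z m m) y = 0 := fun j m => self_eq_neg.1 (θ_pd_skew hy j m m)
  have h012 := P.jacobi y hy 0 1 2
  have h013 := P.jacobi y hy 0 1 3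
  have h023 := P.jacobi y hy 0 2 3
  have h123 := P.jacobi y hy 1 2 3
  simp only [Fin.sum_univ_four, hz, hs 1 0, hs 2 0, hs 3 0, hs 2 1, hs 3 1, hs 3 2,
    θ_pd_skew hy _ 2 0, θ_pd_skew hy _ 3 0, θ_pd_skew hy _ 3 1] at h012 h013 h023 h123
  simp only [h1, Fin.sum_univ_four]
  rw [pfaffian]
  fin_cases i <;>
    simp only [Fin.zero_eta, Fin.mk_one, Fin.reduceFinMk, hz, hdz, hs 1 0, hs 2 0, hs 3 0, hs 2 1,
      hs 3 1, hs 3 2, θ_pd_skew hy _ 1 0, θ_pd_skew hy _ 2 0, θ_pd_skew hy _ 3 0,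
      θ_pd_skew hy _ 2 1, θ_pd_skew hy _ 3 1, θ_pd_skew hy _ 3 2]
  -- For index i only the three Jacobi identities whose index triple contains i are needed; the
  -- coefficient is ± θ^{ij}, where j is the other index shared with the missing direction pairing
  -- in the Pfaffian.
  · linear_combination -P.θ y 0 3 * h012 + P.θ y 0 2 * h013 - P.θ y 0 1 * h023
  · linear_combination -P.θ y 1 3 * h012 + P.θ y 1 2 * h013 - P.θ y 0 1 * h123
  · linear_combination -P.θ y 2 3 * h012 + P.θ y 1 2 * h023 - P.θ y 0 2 * h123
  · linear_combination -P.θ y 2 3 * h013 + P.θ y 1 3 * h023 - P.θ y 0 3 * h123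

end PatchBrane

end

/-! ### The Liouville measure; sums of brackets with the embedding functions -/

section

open Patch

/-- The Hamiltonian vector field `{f, ·}` in a coordinate patch. -/
def Patch.hamVec (θ : E4 → Mat4) (f : E4 → ℂ) (y : E4) (ν : Fin 4) : ℂ :=
  ∑ μ, θ y μ ν * pd μ f y

namespace PatchBrane

variable {D : ℕ} {P : PatchBrane D} {y : E4} {f k : E4 → ℂ}

/-- The density `e^{-σ} √|det G|` of the Liouville measure. -/
def ρ (P : PatchBrane D) (y : E4) : ℂ := P.w y * (P.l y)⁻¹

theorem ρ_smooth : SmoothOn P.Ω P.ρ := w_smooth.mul (l_smooth.inv fun _ _ => l_ne_zero)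

theorem ρ_ne_zero (hy : y ∈ P.Ω) : P.ρ y ≠ 0 := mul_ne_zero (w_ne_zero hy) (inv_ne_zero l_ne_zero)

/-- Logarithmic derivative of l² = pf(θ)² det G, multiplied by the Pfaffian to avoid division. -/
theorem pd_l (hy : y ∈ P.Ω) (j : Fin 4) :
    pfaffian (P.θ y) * pd j P.l y = P.l y * (pd j (fun z => pfaffian (P.θ z)) y
      + pfaffian (P.θ y) * ∑ m, christoffel P.G y m m j) := by
  have hl := l_smooth.differentiableAt P.isOpen hy
  have hp := pfaffian_smooth.differentiableAt P.isOpen hy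
  have hG : SmoothOn P.Ω fun z => (P.G z).det := SmoothOn.det G_smooth
  have hGd := hG.differentiableAt P.isOpen hy
  have hsq : ∀ z ∈ P.Ω, P.l z * P.l z
      = pfaffian (P.θ z) * pfaffian (P.θ z) * (P.G z).det := fun z hz => by
    rw [← pow_two, l_sq hz, det_eq_pfaffian_sq (P.θ_skew z hz), G_det hz]; ring
  have h1 := pd_congr_on P.isOpen hy hsq j
  have h0 : (P.G y).det ≠ 0 := by rw [G_det hy]; exact g_det_ne_zero hy
  rw [pd_mul (hp.fun_mul hp) hGd, pd_mul hp hp, pd_mul hl hl,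
    pd_det (A := P.G) (fun m n => (G_smooth m n).differentiableAt P.isOpen hy) h0,
    P.metricOn.inv_eq hy] at h1
  rw [P.metricOn.christoffel_trace hy]
  have h2 := hsq y hy
  set S := ∑ m, ∑ n, P.U y m n * pd j (fun z => P.G z n m) y
  have hl0 : P.l y ≠ 0 := l_ne_zero
  refine mul_left_cancel₀ (mul_ne_zero (two_ne_zero (α := ℂ)) hl0) ?_
  linear_combination pfaffian (P.θ y) * h1 - (2 * pd j (fun z => pfaffian (P.θ z)) y
    + pfaffian (P.θ y) * S) * h2

/-- In ρ = w/l the Christoffel traces of `pd_w` and `pd_l` cancel: logarithmically ρ behaves as 1/pf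
θ. Working with derivatives only avoids choosing a sign or phase between them. -/
theorem pd_ρ (hy : y ∈ P.Ω) (j : Fin 4) :
    pfaffian (P.θ y) * pd j P.ρ y = -P.ρ y * pd j (fun z => pfaffian (P.θ z)) y := by
  have hl := l_smooth.differentiableAt P.isOpen hy
  have hρ := ρ_smooth.differentiableAt P.isOpen hy
  have h0 : ∀ z ∈ P.Ω, P.ρ z * P.l z = P.w z := fun z _ => by
    rw [ρ, mul_assoc, inv_mul_cancel₀ l_ne_zero, mul_one]
  have h1 := pd_congr_on P.isOpen hy h0 j
  rw [pd_mul hρ hl, pd_w hy, ← h0 y hy] at h1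
  have h2 := pd_l hy j
  have hl0 : P.l y ≠ 0 := l_ne_zero
  refine mul_left_cancel₀ hl0 ?_
  linear_combination pfaffian (P.θ y) * h1 - P.ρ y * h2

theorem hamVec_smooth (hf : SmoothOn P.Ω f) (ν : Fin 4) :
    SmoothOn P.Ω fun z => hamVec P.θ f z ν :=
  .sum fun μ _ => (P.θ_smooth μ ν).mul (hf.pd P.isOpen μ)

theorem brk_smooth (hf : SmoothOn P.Ω f) (hk : SmoothOn P.Ω k) : SmoothOn P.Ω (brk P.θ f k) :=
  SmoothOn.sum (s := Finset.univ) (F := fun ν z => hamVec P.θ f z ν * pd ν k z)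
    fun ν _ => (hamVec_smooth hf ν).mul (hk.pd P.isOpen ν)

/-- Hamiltonian vector fields preserve the Liouville measure. -/
theorem hamVec_divergence (hy : y ∈ P.Ω) (hf : SmoothOn P.Ω f) :
    ∑ ν, pd ν (fun z => P.ρ z * hamVec P.θ f z ν) y = 0 := by
  have hρ := ρ_smooth.differentiableAt P.isOpen hy
  have hθ := fun m n => (P.θ_smooth m n).differentiableAt P.isOpen hy
  have hH := fun ν => (hamVec_smooth hf ν).differentiableAt P.isOpen hy
  have h1 : ∀ ν, pd ν (fun z => hamVec P.θ f z ν) y = ∑ μ, (P.θ y μ ν * pd ν (fun z => pd μ f z) y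
      + pd ν (fun z => P.θ z μ ν) y * pd μ f y) := fun ν =>
    pd_sum_mul (fun μ => hθ μ ν) (fun μ => (hf.pd P.isOpen μ).differentiableAt P.isOpen hy) ν
  have hs : ∀ m n, P.θ y m n = -P.θ y n m := fun m n =>
    congrFun (congrFun (P.θ_skew y hy) n) m
  -- A skew tensor contracted with the symmetric second derivatives.
  have hsym : ∑ ν, ∑ μ, P.θ y μ ν * pd ν (fun z => pd μ f z) y = 0 := by
    refine self_eq_neg.1 ?_
    conv_lhs => rw [Finset.sum_comm]
    rw [← Finset.sum_neg_distrib]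
    refine Finset.sum_congr rfl fun μ _ => ?_
    rw [← Finset.sum_neg_distrib]
    refine Finset.sum_congr rfl fun ν _ => ?_
    rw [hs ν μ, pd_comm hf P.isOpen hy μ ν]; ring
  have hdiv : ∀ μ, pfaffian (P.θ y) * ∑ ν, pd ν (fun z => P.θ z μ ν) y
      = ∑ ν, P.θ y μ ν * pd ν (fun z => pfaffian (P.θ z)) y := pfaffian_divergence hy
  have hpf := pfaffian_ne_zero hy
  simp only [pd_mul hρ (hH _), h1]
  -- After multiplication by the Pfaffian, the divergence of θ and the derivative of ρ are both
  -- expressed by the derivative of the Pfaffian (`pfaffian_divergence`, `pd_ρ`) and cancel.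
  refine mul_left_cancel₀ hpf ?_
  have e1 : ∑ ν, (P.ρ y * ∑ μ, (P.θ y μ ν * pd ν (fun z => pd μ f z) y
      + pd ν (fun z => P.θ z μ ν) y * pd μ f y) + pd ν P.ρ y * hamVec P.θ f y ν)
      = P.ρ y * (∑ ν, ∑ μ, P.θ y μ ν * pd ν (fun z => pd μ f z) y)
        + P.ρ y * (∑ μ, (∑ ν, pd ν (fun z => P.θ z μ ν) y) * pd μ f y)
        + ∑ ν, pd ν P.ρ y * hamVec P.θ f y ν := by
    rw [Finset.sum_add_distrib, ← Finset.mul_sum]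
    simp only [Finset.sum_add_distrib, mul_add, Finset.sum_mul]
    rw [Finset.sum_comm (f := fun ν μ => pd ν (fun z => P.θ z μ ν) y * pd μ f y)]
  have e2 : pfaffian (P.θ y) * ∑ μ, (∑ ν, pd ν (fun z => P.θ z μ ν) y) * pd μ f y
      = ∑ μ, (∑ ν, P.θ y μ ν * pd ν (fun z => pfaffian (P.θ z)) y) * pd μ f y := by
    rw [Finset.mul_sum]
    refine Finset.sum_congr rfl fun μ _ => ?_
    rw [← hdiv]; ring
  have e3 : pfaffian (P.θ y) * ∑ ν, pd ν P.ρ y * hamVec P.θ f y ν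
      = -P.ρ y * ∑ μ, (∑ ν, P.θ y μ ν * pd ν (fun z => pfaffian (P.θ z)) y) * pd μ f y := by
    simp only [hamVec, Finset.mul_sum, Finset.sum_mul]
    rw [Finset.sum_comm]
    refine Finset.sum_congr rfl fun μ _ => Finset.sum_congr rfl fun ν _ => ?_
    linear_combination P.θ y μ ν * pd μ f y * pd_ρ hy ν
  rw [e1, hsym]
  linear_combination P.ρ y * e2 + e3

/-- A Poisson bracket is a divergence with respect to the Liouville measure. -/
theorem brk_divergence (hy : y ∈ P.Ω) (hf : SmoothOn P.Ω f) (hk : SmoothOn P.Ω k) :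
    P.ρ y * brk P.θ f k y = ∑ ν, pd ν (fun z => P.ρ z * hamVec P.θ f z ν * k z) y := by
  have h1 : ∀ ν, pd ν (fun z => P.ρ z * hamVec P.θ f z ν * k z) y
      = P.ρ y * hamVec P.θ f y ν * pd ν k y
        + pd ν (fun z => P.ρ z * hamVec P.θ f z ν) y * k y := fun ν =>
    pd_mul (SmoothOn.differentiableAt (ρ_smooth.mul (hamVec_smooth hf ν)) P.isOpen hy)
      (hk.differentiableAt P.isOpen hy) ν
  simp only [h1, Finset.sum_add_distrib, ← Finset.sum_mul, hamVec_divergence hy hf]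
  rw [zero_mul, add_zero, brk, Finset.mul_sum]
  exact Finset.sum_congr rfl fun ν _ => by rw [hamVec]; ring

/-- The matrix of the partial derivatives `∂_μ ξ^a`. -/
def jac (P : PatchBrane D) (y : E4) : Matrix (Fin D) (Fin 4) ℂ :=
  Matrix.of fun a μ => pd μ (P.ξ a) y

/-- The metric of the target space. -/
def ηM (P : PatchBrane D) : Matrix (Fin D) (Fin D) ℂ := Matrix.diagonal fun a => (P.η a : ℂ)

theorem g_eq (y : E4) : P.g y = (P.jac y).transpose * P.ηM * P.jac y := by
  ext m n
  rw [ηM, Matrix.mul_apply]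
  simp only [Matrix.mul_diagonal, Matrix.transpose_apply, jac, Matrix.of_apply, g, inducedMetric]
  exact Finset.sum_congr rfl fun a _ => by ring

theorem hamVec_ξ (a : Fin D) (y : E4) (ν : Fin 4) :
    hamVec P.θ (P.ξ a) y ν = ((P.θ y).transpose * (P.jac y).transpose) ν a := by
  rw [Matrix.mul_apply]; rfl

theorem brk_ξ (a : Fin D) (f : E4 → ℂ) (y : E4) :
    brk P.θ (P.ξ a) f y = ((P.jac y * P.θ y).mulVec fun ν => pd ν f y) a := by
  simp only [brk, Matrix.mulVec, dotProduct, Matrix.mul_apply, jac, Matrix.of_apply,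
    mul_comm (P.θ y _ _)]

/-- `η_{ab} {ξ^a, ·} {ξ^b, f} = e^σ grad f` -/
theorem sum_hamVec_brk (hy : y ∈ P.Ω) (f : E4 → ℂ) (ν : Fin 4) :
    ∑ a, (P.η a : ℂ) * (hamVec P.θ (P.ξ a) y ν * brk P.θ (P.ξ a) f y)
      = P.l y * gradient P.U f y ν := by
  -- The sum over a contracts the two factors ∂ξ with η to g, so that θᵀgθ appears; this is where
  -- the effective metric originates.
  have h := theta_transpose_g_theta (P.θ_skew y hy) l_ne_zero (P.U_eq y)
  have h1 : (((P.θ y).transpose * P.g y * P.θ y).mulVec fun β => pd β f y) ν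
      = P.l y * gradient P.U f y ν := by
    rw [h, Matrix.smul_mulVec]; rfl
  have h2 : (P.θ y).transpose * P.g y * P.θ y
      = (P.θ y).transpose * (P.jac y).transpose * (P.ηM * (P.jac y * P.θ y)) := by
    rw [g_eq]; simp only [Matrix.mul_assoc]
  rw [← h1, h2, ← Matrix.mulVec_mulVec]
  rw [← Matrix.mulVec_mulVec _ P.ηM]
  simp only [hamVec_ξ, brk_ξ]
  change _ = ∑ a, ((P.θ y).transpose * (P.jac y).transpose) ν a
    * P.ηM.mulVec ((P.jac y * P.θ y).mulVec fun β => pd β f y) a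
  refine Finset.sum_congr rfl fun a _ => ?_
  rw [ηM, Matrix.mulVec_diagonal]; ring

theorem sum_brk_brk (hy : y ∈ P.Ω) (f k : E4 → ℂ) :
    ∑ a, (P.η a : ℂ) * (brk P.θ (P.ξ a) f y * brk P.θ (P.ξ a) k y)
      = P.l y * gradInner P.U f k y := by
  rw [gradInner, Finset.mul_sum]
  simp only [← mul_assoc, ← sum_hamVec_brk hy k]
  simp only [Finset.sum_mul]
  rw [Finset.sum_comm]
  refine Finset.sum_congr rfl fun a _ => ?_
  rw [brk, Finset.mul_sum, Finset.sum_mul]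
  exact Finset.sum_congr rfl fun ν _ => by rw [hamVec]; ring

/-- `η_{ab} {ξ^a, {ξ^b, f}} = e^σ □_G f` -/
theorem sum_brk_brk_comp (hy : y ∈ P.Ω) (hf : SmoothOn P.Ω f) :
    ∑ a, (P.η a : ℂ) * brk P.θ (P.ξ a) (brk P.θ (P.ξ a) f) y
      = P.l y * divergence P.G (gradient P.U f) y := by
  have hb := fun a => brk_smooth (P.ξ_smooth a) hf
  have hs : ∀ ν a, DifferentiableAt ℝ
      (fun z => P.ρ z * hamVec P.θ (P.ξ a) z ν * brk P.θ (P.ξ a) f z) y := fun ν a =>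
    SmoothOn.differentiableAt ((ρ_smooth.mul (hamVec_smooth (P.ξ_smooth a) ν)).mul (hb a))
      P.isOpen hy
  refine mul_left_cancel₀ (ρ_ne_zero hy) ?_
  have h1 : P.ρ y * (P.l y * divergence P.G (gradient P.U f) y)
      = P.w y * divergence P.G (gradient P.U f) y := by
    rw [ρ, mul_assoc, inv_mul_cancel_left₀ l_ne_zero]
  -- Both sides are coordinate divergences: the outer brackets with density ρ, the Laplacian with
  -- density w. The fields agree because the inner sum is e^σ grad f and ρ e^σ = w.
  rw [h1, ← P.metricOn.divergence_density hy (fun m => P.metricOn.gradient_smooth hf m) w_smooth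
    (pd_w hy), Finset.mul_sum]
  simp only [mul_left_comm (P.ρ y), brk_divergence hy (P.ξ_smooth _) (hb _), Finset.mul_sum]
  rw [Finset.sum_comm]
  refine Finset.sum_congr rfl fun ν _ => ?_
  simp only [← pd_const_mul (hs ν _)]
  rw [← pd_sum fun a _ => (hs ν a).const_mul _]
  refine pd_congr_on P.isOpen hy (fun z hz => ?_) ν
  have h2 : P.w z = P.ρ z * P.l z := by rw [ρ, mul_assoc, inv_mul_cancel₀ l_ne_zero, mul_one]
  rw [h2, mul_assoc, ← sum_hamVec_brk hz f ν, Finset.mul_sum]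
  exact Finset.sum_congr rfl fun a _ => by ring

/-- The functions `u^{ab} = G^{μν} ∂_μ ξ^a ∂_ν ξ^b`. -/
def u (P : PatchBrane D) (a b : Fin D) : E4 → ℂ := gradInner P.U (P.ξ a) (P.ξ b)

theorem u_eq (y : E4) : (Matrix.of fun a b => P.u a b y)
    = P.jac y * P.U y * (P.jac y).transpose := by
  rw [Matrix.mul_assoc]
  ext a b
  rw [Matrix.mul_apply, Matrix.of_apply, u, gradInner]
  refine Finset.sum_congr rfl fun m _ => ?_
  rw [Matrix.mul_apply, mul_comm]; rfl

theorem sum_u_diag (y : E4) : ∑ a, (P.η a : ℂ) * P.u a a y = P.τ y := by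
  have h : (P.ηM * (Matrix.of fun a b => P.u a b y)).trace = P.τ y := by
    rw [u_eq, τ, g_eq, show P.ηM * (P.jac y * P.U y * (P.jac y).transpose)
      = (P.ηM * P.jac y) * (P.U y * (P.jac y).transpose) by simp only [Matrix.mul_assoc],
      Matrix.trace_mul_comm]
    simp only [Matrix.mul_assoc]
  rw [← h]
  simp [Matrix.trace, ηM, Matrix.diagonal_mul]

/-- Cyclicity of the trace turns the contraction over embedding indices into tr (Ug)², which `τ_sq`
evaluates in dimension four. -/
theorem sum_u_sq (hy : y ∈ P.Ω) :
    ∑ a, ∑ b, (P.η a : ℂ) * P.η b * (P.u a b y * P.u a b y) = (1 / 2 : ℂ) * P.τ y ^ 2 - 4 := by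
  have h : (P.ηM * (Matrix.of fun a b => P.u a b y) * (P.ηM * (Matrix.of fun a b => P.u a b y))).trace
      = (1 / 2 : ℂ) * P.τ y ^ 2 - 4 := by
    rw [← τ_sq hy, u_eq, g_eq]
    rw [show P.ηM * (P.jac y * P.U y * (P.jac y).transpose) * (P.ηM * (P.jac y * P.U y
      * (P.jac y).transpose)) = (P.ηM * P.jac y) * (P.U y * ((P.jac y).transpose * P.ηM * P.jac y)
      * P.U y * (P.jac y).transpose) by simp only [Matrix.mul_assoc], Matrix.trace_mul_comm]
    simp only [Matrix.mul_assoc]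
  rw [← h]
  refine Finset.sum_congr rfl fun a _ => ?_
  rw [Matrix.diag_apply, Matrix.mul_apply]
  refine Finset.sum_congr rfl fun b _ => ?_
  rw [ηM, Matrix.diagonal_mul, Matrix.diagonal_mul, Matrix.of_apply, Matrix.of_apply,
    show P.u b a y = P.u a b y from P.metricOn.gradInner_comm hy _ _]
  ring

end PatchBrane

end

/-! ### Curvature contractions and the divergence of g⁻¹ through the embedding functions -/

section

open Patch

namespace Patch

theorem ricciContract_smul (G : E4 → Mat4) (c : ℂ) (A : Mat4) (y : E4) :
    ricciContract G (c • A) y = c * ricciContract G A y := by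
  simp only [ricciContract, Matrix.smul_apply, smul_eq_mul, Finset.mul_sum, mul_left_comm]

theorem ricciContract_sub (G : E4 → Mat4) (A B : Mat4) (y : E4) :
    ricciContract G (A - B) y = ricciContract G A y - ricciContract G B y := by
  simp only [ricciContract, Matrix.sub_apply, mul_sub, Finset.sum_sub_distrib]

end Patch

namespace PatchBrane

variable {D : ℕ} {P : PatchBrane D} {y : E4} {f k : E4 → ℂ}

/-- The Laplacian `□_G f`. -/
def lap (P : PatchBrane D) (f : E4 → ℂ) : E4 → ℂ := divergence P.G (gradient P.U f)

theorem u_smooth (a b : Fin D) : SmoothOn P.Ω (P.u a b) :=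
  P.metricOn.gradInner_smooth (P.ξ_smooth a) (P.ξ_smooth b)

theorem u_comm (hy : y ∈ P.Ω) (a b : Fin D) : P.u a b y = P.u b a y :=
  P.metricOn.gradInner_comm hy _ _

theorem bochner_ξ (hy : y ∈ P.Ω) (a b : Fin D) :
    P.lap (P.u a b) y = 2 * hessInner P.G P.U (P.ξ a) (P.ξ b) y
      + gradInner P.U (P.lap (P.ξ b)) (P.ξ a) y + gradInner P.U (P.lap (P.ξ a)) (P.ξ b) y
      + ricciGrad P.G P.U (P.ξ a) (P.ξ b) y + ricciGrad P.G P.U (P.ξ b) (P.ξ a) y :=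
  P.metricOn.bochner hy (P.ξ_smooth a) (P.ξ_smooth b)

/-- The gradients of the functions `ξ^a` as a matrix. -/
def gradM (P : PatchBrane D) (y : E4) : Matrix (Fin 4) (Fin D) ℂ := P.U y * (P.jac y).transpose

theorem gradient_ξ (a : Fin D) (y : E4) (m : Fin 4) : gradient P.U (P.ξ a) y m = P.gradM y m a := rfl

/-- The gradients carry a tensor in embedding indices to a tangent tensor. Taking W to be η yields
GgG; taking ηuη yields UgUgU, hence the scalar curvature. -/
theorem sum_ricciGrad (W : Matrix (Fin D) (Fin D) ℂ) (y : E4) :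
    ∑ a, ∑ b, W a b * ricciGrad P.G P.U (P.ξ a) (P.ξ b) y
      = ricciContract P.G (P.gradM y * W.transpose * (P.gradM y).transpose) y := by
  simp only [ricciGrad, ricciContract, gradient_ξ, Matrix.mul_apply, Matrix.transpose_apply,
    Finset.mul_sum, Finset.sum_mul]
  have : ∀ F : Fin D → Fin D → Fin 4 → Fin 4 → ℂ, ∑ a, ∑ b, ∑ m, ∑ j, F a b m j
      = ∑ j, ∑ m, ∑ a, ∑ b, F a b m j := by
    intro F
    rw [Finset.sum_congr rfl fun a _ => Finset.sum_congr rfl fun b _ => Finset.sum_comm,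
      Finset.sum_congr rfl fun a _ => Finset.sum_comm, Finset.sum_comm]
    refine Finset.sum_congr rfl fun j _ => ?_
    rw [Finset.sum_congr rfl fun a _ => Finset.sum_comm, Finset.sum_comm]
  rw [this]
  refine Finset.sum_congr rfl fun j _ => Finset.sum_congr rfl fun m _ => ?_
  refine Finset.sum_congr rfl fun a _ => Finset.sum_congr rfl fun b _ => ?_
  ring

theorem g_transpose_eq (y : E4) : (P.jac y).transpose * P.ηM * P.jac y = P.g y := (g_eq y).symm

theorem gradM_transpose (y : E4) : (P.gradM y).transpose = P.jac y * P.U y := by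
  rw [gradM, Matrix.transpose_mul, Matrix.transpose_transpose, U_symm]

theorem ηM_transpose : P.ηM.transpose = P.ηM := Matrix.diagonal_transpose _

/-- `R_{μν} (GgG)^{μν}` in terms of the gradients of the embedding functions -/
theorem ricci_GgG (y : E4) : ∑ a, (P.η a : ℂ) * ricciGrad P.G P.U (P.ξ a) (P.ξ a) y
    = ricciContract P.G (P.U y * P.g y * P.U y) y := by
  have h := sum_ricciGrad (P := P) P.ηM y
  rw [ηM_transpose, gradM_transpose, gradM, show P.U y * (P.jac y).transpose * P.ηM *
    (P.jac y * P.U y) = P.U y * ((P.jac y).transpose * P.ηM * P.jac y) * P.U y by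
      simp only [Matrix.mul_assoc], g_transpose_eq] at h
  rw [← h]
  refine Finset.sum_congr rfl fun a _ => ?_
  simp [ηM, Matrix.diagonal_apply]

/-- The quadratic formula for g⁻¹ multiplied by Ug; it reduces longer alternating words in U and g.
-/
theorem U_g_cubic (hy : y ∈ P.Ω) : P.U y * P.g y * P.U y * P.g y * P.U y
    = ((1 / 2 : ℂ) * P.τ y) • (P.U y * P.g y * P.U y) - P.U y := by
  have h := congrArg (fun A => P.U y * P.g y * A) (gInv_eq hy)
  simp only [mul_sub, Matrix.mul_smul] at h
  rw [Matrix.mul_nonsing_inv_cancel_right _ _ (isUnit_iff_ne_zero.2 (g_det_ne_zero hy))] at h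
  simp only [← Matrix.mul_assoc] at h
  rw [eq_sub_iff_add_eq] at h ⊢
  rw [add_comm]; exact h

/-- The scalar curvature in terms of the gradients of the embedding functions. -/
theorem ricci_u (hy : y ∈ P.Ω) :
    ∑ a, ∑ b, (P.η a : ℂ) * P.η b * P.u a b y * ricciGrad P.G P.U (P.ξ a) (P.ξ b) y
      = (1 / 2 : ℂ) * P.τ y * ricciContract P.G (P.U y * P.g y * P.U y) y
        - scalarCurvature P.G y := by
  have h := sum_ricciGrad (P := P) (P.ηM * (Matrix.of fun a b => P.u a b y) * P.ηM) y
  have hu : (Matrix.of fun a b => P.u a b y).transpose = Matrix.of fun a b => P.u a b y := by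
    ext a b; exact u_comm hy b a
  rw [Matrix.transpose_mul, Matrix.transpose_mul, hu, ηM_transpose, gradM_transpose, gradM, u_eq,
    show P.U y * (P.jac y).transpose * (P.ηM * (P.jac y * P.U y * (P.jac y).transpose * P.ηM)) *
      (P.jac y * P.U y) = P.U y * ((P.jac y).transpose * P.ηM * P.jac y) * P.U y *
      ((P.jac y).transpose * P.ηM * P.jac y) * P.U y by simp only [Matrix.mul_assoc],
    g_transpose_eq, U_g_cubic hy, ricciContract_sub, ricciContract_smul] at h
  rw [scalarCurvature, P.metricOn.inv_eq hy, ← h, ← u_eq]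
  refine Finset.sum_congr rfl fun a _ => Finset.sum_congr rfl fun b _ => ?_
  rw [ηM, Matrix.mul_diagonal, Matrix.diagonal_mul, Matrix.of_apply]; ring

theorem ricci_gInv (hy : y ∈ P.Ω) : ricciContract P.G (P.g y)⁻¹ y
    = (1 / 2 : ℂ) * P.τ y * scalarCurvature P.G y
      - ricciContract P.G (P.U y * P.g y * P.U y) y := by
  rw [gInv_eq hy, ricciContract_sub, ricciContract_smul, scalarCurvature, P.metricOn.inv_eq hy]

theorem UgU_apply (y : E4) (m n : Fin 4) : (P.U y * P.g y * P.U y) m n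
    = ∑ a, (P.η a : ℂ) * (gradient P.U (P.ξ a) y m * gradient P.U (P.ξ a) y n) := by
  rw [← g_transpose_eq, show P.U y * ((P.jac y).transpose * P.ηM * P.jac y) * P.U y
    = P.gradM y * P.ηM * (P.jac y * P.U y) by rw [gradM]; simp only [Matrix.mul_assoc],
    ← gradM_transpose, Matrix.mul_apply]
  refine Finset.sum_congr rfl fun a _ => ?_
  rw [ηM, Matrix.mul_diagonal, gradient_ξ, gradient_ξ, Matrix.transpose_apply]; ring

theorem gradient_τ (hy : y ∈ P.Ω) (m : Fin 4) : gradient P.U P.τ y m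
    = 2 * ∑ a, (P.η a : ℂ) * ∑ n, gradient P.U (P.ξ a) y n
      * covDerivVec P.G (gradient P.U (P.ξ a)) y n m := by
  have h1 : ∀ j, pd j P.τ y = ∑ a, (P.η a : ℂ) * pd j (P.u a a) y := by
    intro j
    have hd := fun a => (u_smooth (P := P) a a).differentiableAt P.isOpen hy
    simp only [← pd_const_mul (hd _)]
    rw [← pd_sum fun a _ => (hd a).const_mul _]
    exact pd_congr_on P.isOpen hy (fun z _ => (sum_u_diag z).symm) j
  have h2 : gradient P.U P.τ y m = ∑ a, (P.η a : ℂ) * gradient P.U (P.u a a) y m := by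
    simp only [Patch.gradient, h1, Finset.mul_sum]
    rw [Finset.sum_comm]
    exact Finset.sum_congr rfl fun a _ => Finset.sum_congr rfl fun n _ => by ring
  rw [h2, Finset.mul_sum]
  refine Finset.sum_congr rfl fun a _ => ?_
  rw [u, P.metricOn.gradient_gradInner hy (P.ξ_smooth a) (P.ξ_smooth a)]
  ring

/-- `∇_β g^{αβ} = - (grad ξ_a)^α □_G ξ^a` -/
theorem covDiv_gInv (hy : y ∈ P.Ω) (m : Fin 4) :
    covDiv P.G (fun z => (P.g z)⁻¹) y m
      = -∑ a, (P.η a : ℂ) * (gradient P.U (P.ξ a) y m * P.lap (P.ξ a) y) := by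
  have hX := fun a m => (P.metricOn.gradient_smooth (P.ξ_smooth a) m)
  have hXd := fun a m => (hX a m).differentiableAt P.isOpen hy
  have hτ := τ_smooth.differentiableAt P.isOpen hy
  have hU := fun m n => (U_smooth (P := P) m n).differentiableAt P.isOpen hy
  -- The quadratic equation writes g⁻¹ as a multiple of the parallel tensor U minus the sum of grad
  -- ξ_a ⊗ grad ξ^a.
  have hg : ∀ z ∈ P.Ω, ∀ m n, (P.g z)⁻¹ m n = (1 / 2 : ℂ) * (P.τ z * P.U z m n)
      - ∑ a, (P.η a : ℂ) * (gradient P.U (P.ξ a) z m * gradient P.U (P.ξ a) z n) := by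
    intro z hz m n
    rw [gInv_eq hz, Matrix.sub_apply, UgU_apply, Matrix.smul_apply, smul_eq_mul, mul_assoc]
  have h1 : ∀ b, pd b (fun z => (P.g z)⁻¹ m b) y
      = (1 / 2 : ℂ) * (P.τ y * pd b (fun z => P.U z m b) y + pd b P.τ y * P.U y m b)
      - ∑ a, (P.η a : ℂ) * (gradient P.U (P.ξ a) y m * pd b (fun z => gradient P.U (P.ξ a) z b) y
        + pd b (fun z => gradient P.U (P.ξ a) z m) y * gradient P.U (P.ξ a) y b) := by
    intro b
    rw [pd_congr_on P.isOpen hy (fun z hz => hg z hz m b) b,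
      pd_sub ((hτ.fun_mul (hU m b)).const_mul _)
        (.fun_sum fun a _ => ((hXd a m).fun_mul (hXd a b)).const_mul _),
      pd_const_mul (hτ.fun_mul (hU m b)), pd_mul hτ (hU m b),
      pd_sum fun a _ => ((hXd a m).fun_mul (hXd a b)).const_mul _]
    congr 1
    refine Finset.sum_congr rfl fun a _ => ?_
    rw [pd_const_mul ((hXd a m).fun_mul (hXd a b)), pd_mul (hXd a m) (hXd a b)]
  simp only [covDiv, h1, hg y hy, P.metricOn.compat_inv hy]
  -- As U is parallel, the first part contributes only ½ grad τ.
  have h2 : ∑ b, ((1 / 2 : ℂ) * (P.τ y * -((∑ k, christoffel P.G y m b k * P.U y k b)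
      + ∑ k, christoffel P.G y b b k * P.U y m k) + pd b P.τ y * P.U y m b)
      + (∑ k, christoffel P.G y m b k * ((1 / 2 : ℂ) * (P.τ y * P.U y k b)))
      + ∑ k, christoffel P.G y b b k * ((1 / 2 : ℂ) * (P.τ y * P.U y m k)))
      = (1 / 2 : ℂ) * gradient P.U P.τ y m := by
    rw [Patch.gradient]
    simp only [Fin.sum_univ_four]; ring
  have h3 : ∀ a, ∑ b, (gradient P.U (P.ξ a) y m * pd b (fun z => gradient P.U (P.ξ a) z b) y
        + pd b (fun z => gradient P.U (P.ξ a) z m) y * gradient P.U (P.ξ a) y b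
        + (∑ k, christoffel P.G y m b k * (gradient P.U (P.ξ a) y k * gradient P.U (P.ξ a) y b))
        + ∑ k, christoffel P.G y b b k * (gradient P.U (P.ξ a) y m * gradient P.U (P.ξ a) y k))
      = (∑ n, gradient P.U (P.ξ a) y n * covDerivVec P.G (gradient P.U (P.ξ a)) y n m)
        + gradient P.U (P.ξ a) y m * P.lap (P.ξ a) y := by
    intro a
    simp only [lap, divergence, covDerivVec, Fin.sum_univ_four]; ring
  -- The transport terms of grad ξ_a ⊗ grad ξ^a also add up to ½ grad τ, since τ is the sum of the
  -- ⟨dξ_a, dξ^a⟩. The two cancel, and only the Laplacian term survives.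
  have h4 : (∑ a, (P.η a : ℂ) * ∑ n, gradient P.U (P.ξ a) y n
      * covDerivVec P.G (gradient P.U (P.ξ a)) y n m) = (1 / 2 : ℂ) * gradient P.U P.τ y m := by
    rw [gradient_τ hy]; ring
  have h5 : ∀ a, gradient P.U (P.ξ a) y m * P.lap (P.ξ a) y = (∑ b, (gradient P.U (P.ξ a) y m
        * pd b (fun z => gradient P.U (P.ξ a) z b) y
        + pd b (fun z => gradient P.U (P.ξ a) z m) y * gradient P.U (P.ξ a) y b
        + (∑ k, christoffel P.G y m b k * (gradient P.U (P.ξ a) y k * gradient P.U (P.ξ a) y b))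
        + ∑ k, christoffel P.G y b b k * (gradient P.U (P.ξ a) y m * gradient P.U (P.ξ a) y k)))
      - ∑ n, gradient P.U (P.ξ a) y n * covDerivVec P.G (gradient P.U (P.ξ a)) y n m := fun a => by
    rw [h3]; ring
  simp only [h5, mul_sub, Finset.sum_sub_distrib, h4]
  rw [neg_sub, ← h2, ← sub_eq_zero]
  have h6 : ∀ F : Fin D → Fin 4 → ℂ, ∑ a, (P.η a : ℂ) * ∑ b, F a b
      = ∑ b, ∑ a, (P.η a : ℂ) * F a b := fun F => by
    simp only [Finset.mul_sum]; exact Finset.sum_comm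
  rw [h6, ← Finset.sum_sub_distrib, ← Finset.sum_sub_distrib]
  refine Finset.sum_eq_zero fun b _ => ?_
  have h7 : ∀ F : Fin D → Fin 4 → ℂ, ∑ k, christoffel P.G y m b k * ∑ a, (P.η a : ℂ) * F a k
      = ∑ a, (P.η a : ℂ) * ∑ k, christoffel P.G y m b k * F a k := fun F => by
    rw [h6]
    simp only [Finset.mul_sum]
    exact Finset.sum_congr rfl fun _ _ => Finset.sum_congr rfl fun _ _ => by ring
  have h8 : ∀ F : Fin D → Fin 4 → ℂ, ∑ k, christoffel P.G y b b k * ∑ a, (P.η a : ℂ) * F a k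
      = ∑ a, (P.η a : ℂ) * ∑ k, christoffel P.G y b b k * F a k := fun F => by
    rw [h6]
    simp only [Finset.mul_sum]
    exact Finset.sum_congr rfl fun _ _ => Finset.sum_congr rfl fun _ _ => by ring
  simp only [h7, h8]
  simp only [mul_add, mul_neg, Finset.sum_add_distrib]
  ring

end PatchBrane

end

/-! ### Hessians expressed through u^{ab}, and their tangential components -/

section

open Patch

namespace PatchBrane

variable {D : ℕ} {P : PatchBrane D} {y : E4} {f k : E4 → ℂ}

theorem sum_hessian_gradient (hy : y ∈ P.Ω) (hf : SmoothOn P.Ω f) (a d : Fin D) :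
    ((P.gradM y).transpose * (Matrix.of fun l m => covDerivVec P.G (gradient P.U f) y l m)
      * (P.jac y).transpose) a d
      = ∑ l, ∑ m, gradient P.U (P.ξ a) y l * hessian P.G f y l m * gradient P.U (P.ξ d) y m := by
  rw [Matrix.mul_assoc, Matrix.mul_apply]
  refine Finset.sum_congr rfl fun l _ => ?_
  simp only [mul_assoc, ← Finset.mul_sum]
  rw [Matrix.transpose_apply, ← gradient_ξ, Matrix.mul_apply]
  congr 1
  simp only [Matrix.of_apply, P.metricOn.covDerivVec_gradient hy hf, Matrix.transpose_apply, jac,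
    Patch.gradient, Finset.sum_mul, Finset.mul_sum]
  rw [Finset.sum_comm]
  refine Finset.sum_congr rfl fun n _ => Finset.sum_congr rfl fun m _ => ?_
  rw [P.metricOn.symm_inv y hy n m]; ring

/-- The Hessian of `ξ^a` on the gradients of `ξ^c` and `ξ^d`. -/
def hessU (P : PatchBrane D) (a c d : Fin D) (y : E4) : ℂ :=
  (1 / 2 : ℂ) * (gradInner P.U (P.u a d) (P.ξ c) y + gradInner P.U (P.u a c) (P.ξ d) y
    - gradInner P.U (P.u c d) (P.ξ a) y)

theorem gradInner_u (hy : y ∈ P.Ω) (a b c : Fin D) : gradInner P.U (P.u a b) (P.ξ c) y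
    = (∑ l, ∑ m, gradient P.U (P.ξ c) y l * hessian P.G (P.ξ a) y l m * gradient P.U (P.ξ b) y m)
      + ∑ l, ∑ m, gradient P.U (P.ξ c) y l * hessian P.G (P.ξ b) y l m
        * gradient P.U (P.ξ a) y m := by
  rw [gradInner, ← Finset.sum_add_distrib]
  refine Finset.sum_congr rfl fun l _ => ?_
  rw [u, P.metricOn.pd_gradInner hy (P.ξ_smooth a) (P.ξ_smooth b), ← Finset.sum_add_distrib,
    Finset.mul_sum]
  exact Finset.sum_congr rfl fun m _ => by ring

/-- Koszul's argument: each derivative of a u along a gradient is a sum of two Hessians, and the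
symmetry of Hessians leaves a single one in the alternating combination. -/
theorem hessU_eq (hy : y ∈ P.Ω) (a c d : Fin D) : P.hessU a c d y
    = ∑ l, ∑ m, gradient P.U (P.ξ c) y l * hessian P.G (P.ξ a) y l m
      * gradient P.U (P.ξ d) y m := by
  have hs : ∀ a c d : Fin D, ∑ l, ∑ m, gradient P.U (P.ξ c) y l * hessian P.G (P.ξ a) y l m
      * gradient P.U (P.ξ d) y m = ∑ l, ∑ m, gradient P.U (P.ξ d) y l * hessian P.G (P.ξ a) y l m
      * gradient P.U (P.ξ c) y m := by
    intro a c d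
    rw [Finset.sum_comm]
    refine Finset.sum_congr rfl fun l _ => Finset.sum_congr rfl fun m _ => ?_
    rw [P.metricOn.hessian_symm hy (P.ξ_smooth a) m l]; ring
  rw [hessU, gradInner_u hy, gradInner_u hy, gradInner_u hy, hs a d c, hs d a c, hs c a d]
  ring

/-- The dual metric for the overcomplete system of gradients of the `ξ^a`. -/
def dualM (P : PatchBrane D) (c d : Fin D) (y : E4) : ℂ :=
  P.η c * P.η d * (((1 / 4 : ℂ) * P.τ y ^ 2 - 1) * P.u c d y
    - (1 / 2 : ℂ) * P.τ y * ∑ e, (P.η e : ℂ) * (P.u c e y * P.u e d y))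

/-- Put A = Ug. The gradients of the ξ^a are overcomplete and the unweighted sum does not give the
identity; the weights in `dualM` are those of A⁻² = (¼τ² - 1) - ½τA, which follows from A² = ½τA -
1, and they multiply A². -/
theorem dualM_resolution (hy : y ∈ P.Ω) :
    P.gradM y * (Matrix.of fun c d => P.dualM c d y) * P.jac y = 1 := by
  have hq : (Matrix.of fun c d => P.dualM c d y)
      = ((1 / 4 : ℂ) * P.τ y ^ 2 - 1) • (P.ηM * (Matrix.of fun a b => P.u a b y) * P.ηM)
        - ((1 / 2 : ℂ) * P.τ y) • (P.ηM * ((Matrix.of fun a b => P.u a b y) * P.ηM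
          * (Matrix.of fun a b => P.u a b y)) * P.ηM) := by
    ext c d
    have e1 : (P.ηM * (Matrix.of fun a b => P.u a b y) * P.ηM) c d = P.η c * P.u c d y * P.η d := by
      rw [ηM, Matrix.mul_diagonal, Matrix.diagonal_mul, Matrix.of_apply]
    have e2 : (P.ηM * ((Matrix.of fun a b => P.u a b y) * P.ηM * (Matrix.of fun a b => P.u a b y))
        * P.ηM) c d = P.η c * (∑ e, P.u c e y * P.η e * P.u e d y) * P.η d := by
      rw [ηM, Matrix.mul_diagonal, Matrix.diagonal_mul, Matrix.mul_apply]
      simp only [Matrix.mul_diagonal, Matrix.of_apply]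
    rw [Matrix.sub_apply, Matrix.smul_apply, Matrix.smul_apply, e1, e2, Matrix.of_apply, dualM]
    simp only [smul_eq_mul, mul_comm (P.η _ : ℂ) (P.u _ _ y * P.u _ _ y), mul_right_comm (P.u _ _ y) (P.η _ : ℂ)]
    ring
  rw [hq, u_eq, gradM, Matrix.mul_sub, Matrix.sub_mul, Matrix.mul_smul, Matrix.smul_mul,
    Matrix.mul_smul, Matrix.smul_mul]
  have e1 : P.U y * (P.jac y).transpose * (P.ηM * (P.jac y * P.U y * (P.jac y).transpose) * P.ηM)
      * P.jac y = P.U y * P.g y * P.U y * P.g y := by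
    rw [g_eq]; simp only [Matrix.mul_assoc]
  have e2 : P.U y * (P.jac y).transpose * (P.ηM * (P.jac y * P.U y * (P.jac y).transpose * P.ηM *
      (P.jac y * P.U y * (P.jac y).transpose)) * P.ηM) * P.jac y
      = P.U y * P.g y * P.U y * P.g y * P.U y * P.g y := by
    rw [g_eq]; simp only [Matrix.mul_assoc]
  have h2 : P.U y * P.g y * P.U y * P.g y = ((1 / 2 : ℂ) * P.τ y) • (P.U y * P.g y) - 1 := by
    have h := congrArg (· * P.g y) (gInv_eq hy)
    simp only [sub_mul, Matrix.smul_mul,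
      Matrix.nonsing_inv_mul _ (isUnit_iff_ne_zero.2 (g_det_ne_zero hy))] at h
    rw [h]; abel
  rw [e1, e2, U_g_cubic hy, sub_mul, Matrix.smul_mul, h2]
  ext i j
  simp only [Matrix.sub_apply, Matrix.smul_apply, smul_eq_mul]
  ring

/-- The contraction of two Hessians in terms of the functions `u^{ab}`. -/
theorem hessInner_ξ (hy : y ∈ P.Ω) (a b : Fin D) : hessInner P.G P.U (P.ξ a) (P.ξ b) y
    = ∑ c, ∑ d, ∑ e, ∑ k, P.hessU a c d y * P.dualM e d y * P.hessU b e k y * P.dualM c k y := by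
  set A : Fin D → Mat4 := fun a =>
    Matrix.of fun l m => covDerivVec P.G (gradient P.U (P.ξ a)) y l m with hA
  set q : Matrix (Fin D) (Fin D) ℂ := Matrix.of fun c d => P.dualM c d y with hq
  have h1 : (P.jac y).transpose * q.transpose * (P.gradM y).transpose = 1 := by
    have := congrArg Matrix.transpose (dualM_resolution hy)
    rwa [Matrix.transpose_mul, Matrix.transpose_mul, Matrix.transpose_one, ← Matrix.mul_assoc]
      at this
  set Y : Fin D → Matrix (Fin D) (Fin D) ℂ := fun a =>
    (P.gradM y).transpose * A a * (P.jac y).transpose with hY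
  have hYe : ∀ a c d, Y a c d = P.hessU a c d y := fun a c d => by
    rw [hessU_eq hy, ← sum_hessian_gradient hy (P.ξ_smooth a)]
  have h2 : hessInner P.G P.U (P.ξ a) (P.ξ b) y = (A a * A b).trace := by
    simp only [hessInner, Matrix.trace, Matrix.diag_apply, Matrix.mul_apply, hA, Matrix.of_apply]
  -- The resolution of the identity is inserted after each Hessian; then only Hessians evaluated on
  -- gradients occur, and these are expressions in the u^{ab}.
  have h3 : (A a * A b).trace = (Y a * q.transpose * Y b * q.transpose).trace := by
    have : A a * A b = A a * ((P.jac y).transpose * q.transpose * (P.gradM y).transpose) * A b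
        * ((P.jac y).transpose * q.transpose * (P.gradM y).transpose) := by
      rw [h1, Matrix.mul_one, Matrix.mul_one]
    rw [this, hY, ← Matrix.mul_assoc _ _ (P.gradM y).transpose, Matrix.trace_mul_comm]
    simp only [Matrix.mul_assoc]
  rw [h2, h3, Matrix.trace]
  simp only [Matrix.diag_apply, Matrix.mul_apply, Matrix.transpose_apply, Finset.sum_mul, hYe, hq,
    Matrix.of_apply]
  refine Finset.sum_congr rfl fun c _ => ?_
  rw [Finset.sum_congr rfl fun d _ => Finset.sum_comm, Finset.sum_comm]
  refine Finset.sum_congr rfl fun d _ => Finset.sum_comm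

/-- The tangential components of the second covariant derivatives of the embedding. -/
def tang (P : PatchBrane D) (y : E4) (i l n : Fin 4) : ℂ :=
  ∑ a, (P.η a : ℂ) * (pd i (P.ξ a) y * hessian P.G (P.ξ a) y l n)

theorem tang_symm (hy : y ∈ P.Ω) (i l n : Fin 4) : P.tang y i l n = P.tang y i n l := by
  simp only [tang, P.metricOn.hessian_symm hy (P.ξ_smooth _) l n]

/-- `∇_l h_{mn}` in terms of the tangential components of the second derivatives -/
theorem covDeriv_h (hy : y ∈ P.Ω) (l m n : Fin 4) :
    covDeriv P.G (fun z => P.G z - P.g z) y l m n = -(P.tang y n l m + P.tang y m l n) := by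
  have hd := fun (a : Fin D) i => ((P.ξ_smooth a).pd P.isOpen i).differentiableAt P.isOpen hy
  have h1 : pd l (fun z => (P.G z - P.g z) m n) y
      = pd l (fun z => P.G z m n) y - pd l (fun z => P.g z m n) y :=
    pd_sub ((G_smooth m n).differentiableAt P.isOpen hy)
      ((g_smooth m n).differentiableAt P.isOpen hy) l
  have h2 : pd l (fun z => P.g z m n) y = ∑ a, (P.η a : ℂ) * (pd m (P.ξ a) y
      * pd l (fun z => pd n (P.ξ a) z) y + pd l (fun z => pd m (P.ξ a) z) y * pd n (P.ξ a) y) := by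
    have : pd l (fun z => P.g z m n) y
        = pd l (fun z => ∑ a, (P.η a : ℂ) * (pd m (P.ξ a) z * pd n (P.ξ a) z)) y := by
      refine pd_congr_on P.isOpen hy (fun z _ => ?_) l
      simp only [g, inducedMetric, Matrix.of_apply, mul_assoc]
    rw [this, pd_sum fun a _ => ((hd a m).fun_mul (hd a n)).const_mul _]
    refine Finset.sum_congr rfl fun a _ => ?_
    rw [pd_const_mul ((hd a m).fun_mul (hd a n)), pd_mul (hd a m) (hd a n)]
  have h3 : ∀ k n, P.g y k n = ∑ a, (P.η a : ℂ) * (pd k (P.ξ a) y * pd n (P.ξ a) y) := fun k n => by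
    simp only [g, inducedMetric, Matrix.of_apply, mul_assoc]
  -- The part with G vanishes because G is parallel; only ∇g is left, and differentiating ∂ξ_a ∂ξ^a
  -- covariantly produces the Hessians.
  rw [covDeriv, h1, h2, P.metricOn.compat hy]
  simp only [Matrix.sub_apply, mul_sub, Finset.sum_sub_distrib, tang, hessian]
  have h4 : ∀ n, ∑ k, christoffel P.G y k l m * P.g y k n
      = ∑ a, (P.η a : ℂ) * (pd n (P.ξ a) y * ∑ k, christoffel P.G y k l m * pd k (P.ξ a) y) := by
    intro n
    simp only [h3, Finset.mul_sum]
    rw [Finset.sum_comm]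
    exact Finset.sum_congr rfl fun _ _ => Finset.sum_congr rfl fun _ _ => by ring
  have h5 : ∀ m, ∑ k, christoffel P.G y k l n * P.g y m k
      = ∑ a, (P.η a : ℂ) * (pd m (P.ξ a) y * ∑ k, christoffel P.G y k l n * pd k (P.ξ a) y) := by
    intro n
    simp only [h3, Finset.mul_sum]
    rw [Finset.sum_comm]
    exact Finset.sum_congr rfl fun _ _ => Finset.sum_congr rfl fun _ _ => by ring
  rw [h4, h5]
  simp only [mul_add, Finset.sum_add_distrib]
  simp only [mul_comm (pd l _ y)]
  ring

/-- The tangential components of the second derivatives in terms of `∇h` -/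
theorem tang_eq (hy : y ∈ P.Ω) (i m n : Fin 4) :
    P.tang y i m n = -(1 / 2 : ℂ) * (covDeriv P.G (fun z => P.G z - P.g z) y m n i
      + covDeriv P.G (fun z => P.G z - P.g z) y n m i
      - covDeriv P.G (fun z => P.G z - P.g z) y i m n) := by
  -- As for Christoffel symbols: the tangential components are symmetric in two indices, so the
  -- cyclic combination of their sums can be solved for one of them.
  simp only [covDeriv_h hy, tang_symm hy i n m, tang_symm hy m n i, tang_symm hy n m i]
  ring

theorem lap_eq (hy : y ∈ P.Ω) (hf : SmoothOn P.Ω f) :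
    P.lap f y = ∑ l, ∑ n, P.U y l n * hessian P.G f y l n := by
  simp only [lap, divergence, P.metricOn.covDerivVec_gradient hy hf]

/-- `∂_i ξ_a □_G ξ^a` -/
theorem sum_pd_lap (hy : y ∈ P.Ω) (i : Fin 4) :
    ∑ a, (P.η a : ℂ) * (pd i (P.ξ a) y * P.lap (P.ξ a) y)
      = ∑ l, ∑ n, P.U y l n * P.tang y i l n := by
  simp only [lap_eq hy (P.ξ_smooth _), tang, Finset.mul_sum]
  rw [Finset.sum_comm]
  refine Finset.sum_congr rfl fun l _ => ?_
  rw [Finset.sum_comm]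
  exact Finset.sum_congr rfl fun n _ => Finset.sum_congr rfl fun a _ => by ring

theorem gradInner_eq (f k : E4 → ℂ) (y : E4) :
    gradInner P.U f k y = ∑ m, ∑ n, P.U y m n * pd m f y * pd n k y := by
  simp only [gradInner, Patch.gradient, Finset.sum_mul]
  exact Finset.sum_congr rfl fun m _ => Finset.sum_congr rfl fun n _ => by ring

end PatchBrane

end

/-! ### Charts of the manifold and the chain rule -/

section

open Patch

section Chart

variable {M : Type*} [TopologicalSpace M] [ChartedSpace E4 M]

/-- A function in the coordinates of the preferred chart at `p`. -/
def hat (p : M) (f : M → ℂ) (z : E4) : ℂ := f ((chartAt E4 p).symm z)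

/-- The coordinate vector field `∂_α` of the preferred chart at `p`, at the point `q`. -/
def coordVec (p q : M) (α : Fin 4) : TangentSpace (𝓡 4) q :=
  mfderiv (𝓡 4) (𝓡 4) (chartAt E4 p).symm (chartAt E4 p q) (EuclideanSpace.single α (1 : ℝ))

/-- The Jacobian matrix of the change of coordinates between two charts. -/
def transition (p p' : M) (y : E4) : Mat4 := Matrix.of fun μ α => pd α (hat p' (coordFn p μ)) y

theorem hat_coordFn {p : M} {z : E4} (hz : z ∈ (chartAt E4 p).target) (μ : Fin 4) :
    hat p (coordFn p μ) z = ((z μ : ℝ) : ℂ) := by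
  rw [hat, coordFn, (chartAt E4 p).right_inv hz]

theorem pd_coord (α μ : Fin 4) (y : E4) :
    pd α (fun z : E4 => ((z μ : ℝ) : ℂ)) y = if μ = α then 1 else 0 := by
  have h1 : HasFDerivAt (fun z : E4 => ((z μ : ℝ) : ℂ))
      (Complex.ofRealCLM.comp (EuclideanSpace.proj (𝕜 := ℝ) μ)) y :=
    (Complex.ofRealCLM.comp (EuclideanSpace.proj (𝕜 := ℝ) μ)).hasFDerivAt
  rw [pd, h1.fderiv]
  simp [apply_ite]

theorem pd_hat_coordFn {p : M} {y : E4} (hy : y ∈ (chartAt E4 p).target) (α μ : Fin 4) :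
    pd α (hat p (coordFn p μ)) y = if μ = α then 1 else 0 := by
  rw [pd_congr_on (chartAt E4 p).open_target hy (fun z hz => hat_coordFn hz μ), pd_coord]

variable [IsManifold (𝓡 4) ∞ M]

theorem hat_smooth {f : M → ℂ} (hf : IsSmooth f) (p : M) :
    SmoothOn (chartAt E4 p).target (hat p f) := by
  have h := ContMDiff.comp_contMDiffOn hf (contMDiffOn_chart_symm (I := 𝓡 4) (n := ∞) (x := p))
  exact contMDiffOn_iff_contDiffOn.1 h

theorem hat_smooth_of_contMDiffOn {f : M → ℂ} {p : M}
    (hf : ContMDiffOn (𝓡 4) 𝓘(ℝ, ℂ) ∞ f (chartAt E4 p).source) :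
    SmoothOn (chartAt E4 p).target (hat p f) := by
  have h := hf.comp (contMDiffOn_chart_symm (I := 𝓡 4) (n := ∞) (x := p))
    fun z hz => (chartAt E4 p).map_target hz
  exact contMDiffOn_iff_contDiffOn.1 h

theorem contMDiffOn_coordFn (p : M) (μ : Fin 4) :
    ContMDiffOn (𝓡 4) 𝓘(ℝ, ℂ) ∞ (coordFn p μ) (chartAt E4 p).source := by
  have h1 : ContDiff ℝ ∞ fun z : E4 => ((z μ : ℝ) : ℂ) :=
    Complex.ofRealCLM.contDiff.comp (EuclideanSpace.proj (𝕜 := ℝ) μ).contDiff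
  exact h1.contMDiff.comp_contMDiffOn (contMDiffOn_chart (I := 𝓡 4) (n := ∞) (x := p))

theorem mdifferentiableAt_coordFn {p q : M} (hq : q ∈ (chartAt E4 p).source) (μ : Fin 4) :
    MDifferentiableAt (𝓡 4) 𝓘(ℝ, ℂ) (coordFn p μ) q :=
  ((contMDiffOn_coordFn p μ).contMDiffAt ((chartAt E4 p).open_source.mem_nhds hq)).mdifferentiableAt
    (by simp)

theorem fderiv_eq_sum_pd (f : E4 → ℂ) (y v : E4) :
    fderiv ℝ f y v = ∑ μ, ((v μ : ℝ) : ℂ) * pd μ f y := by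
  have hv : v = ∑ μ, v μ • EuclideanSpace.single μ (1 : ℝ) := by
    ext i; simp [Finset.sum_apply, Pi.single_apply]
  conv_lhs => rw [hv, map_sum]
  simp [pd]

theorem mdifferentiableAt_chart_symm {p q : M} (hq : q ∈ (chartAt E4 p).source) :
    MDifferentiableAt (𝓡 4) (𝓡 4) (chartAt E4 p).symm (chartAt E4 p q) :=
  haveI : IsManifold (𝓡 4) 1 M := IsManifold.of_le (n := ∞) (by simp)
  mdifferentiableAt_atlas_symm (chart_mem_atlas E4 p) ((chartAt E4 p).map_source hq)

theorem mdifferentiableAt_chart {p q : M} (hq : q ∈ (chartAt E4 p).source) :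
    MDifferentiableAt (𝓡 4) (𝓡 4) (chartAt E4 p) q :=
  haveI : IsManifold (𝓡 4) 1 M := IsManifold.of_le (n := ∞) (by simp)
  mdifferentiableAt_atlas (chart_mem_atlas E4 p) hq

variable {p q : M} {f : M → ℂ}

theorem differentiableAt_hat (hq : q ∈ (chartAt E4 p).source)
    (hf : MDifferentiableAt (𝓡 4) 𝓘(ℝ, ℂ) f q) :
    DifferentiableAt ℝ (hat p f) (chartAt E4 p q) := by
  rw [← mdifferentiableAt_iff_differentiableAt]
  refine MDifferentiableAt.comp (I' := 𝓡 4) _ ?_ (mdifferentiableAt_chart_symm hq)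
  rwa [(chartAt E4 p).left_inv hq]

theorem pd_hat (hq : q ∈ (chartAt E4 p).source) (hf : MDifferentiableAt (𝓡 4) 𝓘(ℝ, ℂ) f q)
    (α : Fin 4) : pd α (hat p f) (chartAt E4 p q) = differential f q (coordVec p q α) := by
  have hf' : MDifferentiableAt (𝓡 4) 𝓘(ℝ, ℂ) f ((chartAt E4 p).symm (chartAt E4 p q)) := by
    rwa [(chartAt E4 p).left_inv hq]
  have h := mfderiv_comp (chartAt E4 p q) hf' (mdifferentiableAt_chart_symm hq)
  have h2 : fderiv ℝ (hat p f) (chartAt E4 p q) = mfderiv (𝓡 4) 𝓘(ℝ, ℂ)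
    (f ∘ (chartAt E4 p).symm) (chartAt E4 p q) := (mfderiv_eq_fderiv).symm
  rw [pd, h2, h, differential, coordVec]
  have h3 : ∀ (q' : M), q' = q → ∀ v : E4,
      mfderiv (𝓡 4) 𝓘(ℝ, ℂ) f q' v = mfderiv (𝓡 4) 𝓘(ℝ, ℂ) f q v := by
    rintro _ rfl v; rfl
  exact h3 _ ((chartAt E4 p).left_inv hq) _

/-- `df = ∂_μ f dy^μ` -/
theorem differential_eq (hq : q ∈ (chartAt E4 p).source)
    (hf : MDifferentiableAt (𝓡 4) 𝓘(ℝ, ℂ) f q) :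
    differential f q = ∑ μ, pd μ (hat p f) (chartAt E4 p q) • differential (coordFn p μ) q := by
  have key : ∀ k : M → ℂ, MDifferentiableAt (𝓡 4) 𝓘(ℝ, ℂ) k q → ∀ v : TangentSpace (𝓡 4) q,
      differential k q v = fderiv ℝ (hat p k) (chartAt E4 p q)
        (mfderiv (𝓡 4) (𝓡 4) (chartAt E4 p) q v) := by
    intro k hk v
    have h1 : k =ᶠ[nhds q] (hat p k) ∘ (chartAt E4 p) :=
      Filter.eventuallyEq_of_mem ((chartAt E4 p).open_source.mem_nhds hq) fun x hx => by
        simp only [Function.comp, hat, (chartAt E4 p).left_inv hx]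
    have h2 : MDifferentiableAt (𝓡 4) 𝓘(ℝ, ℂ) (hat p k) (chartAt E4 p q) :=
      (differentiableAt_hat hq hk).mdifferentiableAt
    rw [differential, h1.mfderiv_eq, mfderiv_comp q h2 (mdifferentiableAt_chart hq),
      mfderiv_eq_fderiv]
    rfl
  ext v
  -- One coordinate vector w represents v for every function at once, so f and the coordinate
  -- functions are compared on the same vector.
  obtain ⟨w, hw⟩ : ∃ w : E4, ∀ k : M → ℂ, MDifferentiableAt (𝓡 4) 𝓘(ℝ, ℂ) k q →
      differential k q v = fderiv ℝ (hat p k) (chartAt E4 p q) w := ⟨_, fun k hk => key k hk v⟩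
  rw [hw f hf, fderiv_eq_sum_pd, sum_apply]
  refine Finset.sum_congr rfl fun μ _ => ?_
  rw [smul_apply, hw _ (mdifferentiableAt_coordFn hq μ), fderiv_eq_sum_pd]
  simp only [pd_hat_coordFn ((chartAt E4 p).map_source hq)]
  simp [mul_comm]

/-- The chain rule for a change of charts. -/
theorem pd_hat_transition {p' : M} (hq : q ∈ (chartAt E4 p).source)
    (hq' : q ∈ (chartAt E4 p').source) (hf : MDifferentiableAt (𝓡 4) 𝓘(ℝ, ℂ) f q) (α : Fin 4) :
    pd α (hat p' f) (chartAt E4 p' q) = ∑ μ, pd μ (hat p f) (chartAt E4 p q)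
      * transition p p' (chartAt E4 p' q) μ α := by
  rw [pd_hat hq' hf, differential_eq hq hf, sum_apply]
  refine Finset.sum_congr rfl fun μ _ => ?_
  rw [smul_apply, transition, Matrix.of_apply,
    pd_hat hq' (mdifferentiableAt_coordFn hq μ), smul_eq_mul]

/-- Every chart coordinate agrees near a given point with a globally defined smooth function. -/
theorem exists_smooth_coordFn [T2Space M] (hq : q ∈ (chartAt E4 p).source) (μ : Fin 4) :
    ∃ k : M → ℂ, IsSmooth k ∧ k =ᶠ[nhds q] coordFn p μ := by
  -- A cutoff inside the chart domain. The axioms of the Poisson structure concern global functions,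
  -- and this carries them over to coordinates.
  obtain ⟨b, -, hb⟩ := (SmoothBumpFunction.nhds_basis_tsupport (I := 𝓡 4) q).mem_iff.1
    ((chartAt E4 p).open_source.mem_nhds hq)
  refine ⟨fun x => b x • coordFn p μ x, contMDiff_of_tsupport fun x hx => ?_, ?_⟩
  · have hx' : x ∈ (chartAt E4 p).source := hb (tsupport_smul_subset_left b (coordFn p μ) hx)
    exact (b.contMDiff.contMDiffAt).smul
      ((contMDiffOn_coordFn p μ).contMDiffAt ((chartAt E4 p).open_source.mem_nhds hx'))
  · filter_upwards [b.eventuallyEq_one] with x hx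
    simp [hx]

end Chart

end

/-! ### The Poisson structure in a chart; restricting a brane to a patch -/

section

open Patch

theorem brk_congr {θ : E4 → Mat4} {f f' k k' : E4 → ℂ} {y : E4} (hf : f =ᶠ[nhds y] f')
    (hk : k =ᶠ[nhds y] k') : brk θ f k y = brk θ f' k' y := by
  simp only [brk, pd_congr hf, pd_congr hk]

theorem brk_coord_left (θ : E4 → Mat4) (i : Fin 4) (k : E4 → ℂ) (y : E4) :
    brk θ (fun z : E4 => ((z i : ℝ) : ℂ)) k y = ∑ ν, θ y i ν * pd ν k y := by
  simp [brk, pd_coord]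

section

variable {M : Type*} [TopologicalSpace M] [ChartedSpace E4 M]

/-- The bivector acts on differentials, so a bracket depends on germs only; global functions may
thus stand in for chart coordinates. -/
theorem bracketOf_congr
    {θ : ∀ p : M, (TangentSpace (𝓡 4) p →L[ℝ] ℂ) →ₗ[ℂ] (TangentSpace (𝓡 4) p →L[ℝ] ℂ) →ₗ[ℂ] ℂ}
    {f f' k k' : M → ℂ} {q : M} (hf : f =ᶠ[nhds q] f') (hk : k =ᶠ[nhds q] k') :
    bracketOf θ f k =ᶠ[nhds q] bracketOf θ f' k' := by
  filter_upwards [hf.eventuallyEq_nhds, hk.eventuallyEq_nhds] with x h1 h2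
  rw [bracketOf, bracketOf, differential, differential, h1.mfderiv_eq, h2.mfderiv_eq]
  rfl

theorem IsSmooth.mdifferentiableAt {f : M → ℂ} (hf : IsSmooth f) (q : M) :
    MDifferentiableAt (𝓡 4) 𝓘(ℝ, ℂ) f q :=
  (ContMDiff.mdifferentiable hf (by simp)) q

theorem tendsto_chart_symm {p q : M} (hq : q ∈ (chartAt E4 p).source) :
    Filter.Tendsto (chartAt E4 p).symm (nhds (chartAt E4 p q)) (nhds q) := by
  have h := (chartAt E4 p).symm.continuousAt ((chartAt E4 p).map_source hq)
  rwa [ContinuousAt, (chartAt E4 p).left_inv hq] at h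

theorem hat_congr {p q : M} (hq : q ∈ (chartAt E4 p).source) {f k : M → ℂ}
    (h : f =ᶠ[nhds q] k) : hat p f =ᶠ[nhds (chartAt E4 p q)] hat p k :=
  (tendsto_chart_symm hq).eventually h

namespace Brane

variable {D : ℕ} [IsManifold (𝓡 4) ∞ M] (B : Brane D M) {p p' q : M} {f k : M → ℂ}

omit [IsManifold (𝓡 4) ∞ M] in
theorem emb_smooth (a : Fin D) : IsSmooth (B.emb a) :=
  (Complex.ofRealCLM.contDiff (n := ∞)).contMDiff.comp (B.x_smooth a)

/-- The Poisson bracket in a chart. -/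
theorem bracket_chart (hq : q ∈ (chartAt E4 p).source)
    (hf : MDifferentiableAt (𝓡 4) 𝓘(ℝ, ℂ) f q) (hk : MDifferentiableAt (𝓡 4) 𝓘(ℝ, ℂ) k q) :
    B.bracket f k q = brk (B.θc p) (hat p f) (hat p k) (chartAt E4 p q) := by
  have hθ : ∀ μ ν, B.θc p (chartAt E4 p q) μ ν
      = B.θ q (differential (coordFn p μ) q) (differential (coordFn p ν) q) := by
    intro μ ν
    rw [θc, bivectorCoord, Matrix.of_apply, (chartAt E4 p).left_inv hq, bracketOf]
  rw [bracket, bracketOf, differential_eq hq hf, differential_eq hq hk, brk]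
  simp only [map_sum, map_smul, LinearMap.sum_apply, LinearMap.smul_apply, smul_eq_mul, hθ,
    Finset.sum_mul, Finset.mul_sum]
  exact Finset.sum_congr rfl fun ν _ => Finset.sum_congr rfl fun μ _ => by ring

theorem hat_bracket (hf : IsSmooth f) (hk : IsSmooth k) {z : E4}
    (hz : z ∈ (chartAt E4 p).target) :
    hat p (B.bracket f k) z = brk (B.θc p) (hat p f) (hat p k) z := by
  rw [hat, B.bracket_chart ((chartAt E4 p).map_target hz) (hf.mdifferentiableAt _)
    (hk.mdifferentiableAt _), (chartAt E4 p).right_inv hz]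

omit [IsManifold (𝓡 4) ∞ M] in
theorem θ_neg (q : M) (α β : TangentSpace (𝓡 4) q →L[ℝ] ℂ) : B.θ q α β = -B.θ q β α :=
  (LinearMap.IsAlt.neg (B := B.θ q) (B.θ_alt q) β α).symm

/-- Components are brackets of the coordinates of one chart; computing the same brackets in the
other chart gives the tensor law. -/
theorem θc_transition (hq : q ∈ (chartAt E4 p).source) (hq' : q ∈ (chartAt E4 p').source) :
    B.θc p (chartAt E4 p q) = transition p p' (chartAt E4 p' q) * B.θc p' (chartAt E4 p' q)
      * (transition p p' (chartAt E4 p' q)).transpose := by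
  ext μ ν
  have h : B.θc p (chartAt E4 p q) μ ν = B.bracket (coordFn p μ) (coordFn p ν) q := by
    rw [θc, bivectorCoord, Matrix.of_apply, (chartAt E4 p).left_inv hq, bracket]
  rw [h, B.bracket_chart hq' (mdifferentiableAt_coordFn hq μ) (mdifferentiableAt_coordFn hq ν),
    Matrix.mul_apply, brk]
  simp only [Matrix.mul_apply, Matrix.transpose_apply, transition, Matrix.of_apply]
  refine Finset.sum_congr rfl fun ν _ => ?_
  congr 1
  exact Finset.sum_congr rfl fun ν _ => mul_comm _ _

theorem g_transition (hq : q ∈ (chartAt E4 p).source) (hq' : q ∈ (chartAt E4 p').source) :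
    B.g p' (chartAt E4 p' q) = (transition p p' (chartAt E4 p' q)).transpose
      * B.g p (chartAt E4 p q) * transition p p' (chartAt E4 p' q) := by
  have h : ∀ p : M, B.g p (chartAt E4 p q) =
      (Matrix.of fun a μ => pd μ (hat p (B.emb a)) (chartAt E4 p q)).transpose *
      Matrix.diagonal (fun a => (B.η a : ℂ)) *
      (Matrix.of fun a μ => pd μ (hat p (B.emb a)) (chartAt E4 p q)) := by
    intro p
    ext m n
    rw [Matrix.mul_apply]
    simp only [Matrix.mul_diagonal, Matrix.transpose_apply, Matrix.of_apply, g, inducedCoord]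
    exact Finset.sum_congr rfl fun a _ => by rw [mul_comm (B.η a : ℂ)]; rfl
  have h2 : (Matrix.of fun a μ => pd μ (hat p' (B.emb a)) (chartAt E4 p' q))
      = (Matrix.of fun a μ => pd μ (hat p (B.emb a)) (chartAt E4 p q))
        * transition p p' (chartAt E4 p' q) := by
    ext a μ
    rw [Matrix.mul_apply]
    exact pd_hat_transition hq hq' ((B.emb_smooth a).mdifferentiableAt q) μ
  rw [h, h, h2, Matrix.transpose_mul]
  simp only [Matrix.mul_assoc]

/-- The squared Jacobian determinants from θ and from g cancel. Hence σ is a scalar, and positivity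
may be checked in any chart. -/
theorem det_mul_det (hq : q ∈ (chartAt E4 p).source) (hq' : q ∈ (chartAt E4 p').source) :
    (B.θc p' (chartAt E4 p' q)).det * (B.g p' (chartAt E4 p' q)).det
      = (B.θc p (chartAt E4 p q)).det * (B.g p (chartAt E4 p q)).det := by
  rw [B.θc_transition hq hq', B.g_transition hq hq']
  simp only [Matrix.det_mul, Matrix.det_transpose]
  ring

/-- `σ` does not depend on the chart. -/
theorem σc_eq (hq : q ∈ (chartAt E4 p).source) : B.σc p (chartAt E4 p q) = B.σ q := by
  rw [σ, σc, σc, sigma, sigma, B.det_mul_det (mem_chart_source E4 q) hq]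

/-- The embedding functions are real, hence so are the entries of g, although θ may be complex.
`w_pow` depends on this. -/
theorem g_det_real (p : M) (y : E4) (hy : y ∈ (chartAt E4 p).target) :
    ∃ r : ℝ, (B.g p y).det = (r : ℂ) := by
  have h : ∀ a μ, ∃ r : ℝ, pd μ (hat p (B.emb a)) y = (r : ℂ) := by
    intro a μ
    have h1 : ContMDiffOn 𝓘(ℝ, E4) 𝓘(ℝ, ℝ) ∞ (B.x a ∘ (chartAt E4 p).symm)
        (chartAt E4 p).target :=
      (B.x_smooth a).comp_contMDiffOn (contMDiffOn_chart_symm (I := 𝓡 4) (n := ∞) (x := p))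
    have h2 : DifferentiableAt ℝ (B.x a ∘ (chartAt E4 p).symm) y :=
      ((contMDiffOn_iff_contDiffOn.1 h1).contDiffAt
        ((chartAt E4 p).open_target.mem_nhds hy)).differentiableAt (by simp)
    have h3 : HasFDerivAt (hat p (B.emb a)) (Complex.ofRealCLM.comp (fderiv ℝ _ y)) y :=
      Complex.ofRealCLM.hasFDerivAt.comp y h2.hasFDerivAt
    exact ⟨_, by rw [pd, h3.fderiv]; rfl⟩
  choose r hr using h
  refine ⟨(Matrix.of fun m n => ∑ a, B.η a * r a m * r a n : Matrix (Fin 4) (Fin 4) ℝ).det, ?_⟩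
  have := (Complex.ofRealHom.map_det
    (Matrix.of fun m n => ∑ a, B.η a * r a m * r a n : Matrix (Fin 4) (Fin 4) ℝ)).symm
  refine Eq.trans (congrArg Matrix.det ?_) this
  ext m n
  have hr' : ∀ a μ, pd μ (fun z => (B.x a ((chartAt E4 p).symm z) : ℂ)) y = (r a μ : ℂ) := hr
  simp [g, inducedCoord, hr']

variable [T2Space M]

theorem bracketOf_coordFn_smooth (μ ν : Fin 4) : ContMDiffOn (𝓡 4) 𝓘(ℝ, ℂ) ∞
    (bracketOf B.θ (coordFn p μ) (coordFn p ν)) (chartAt E4 p).source := by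
  intro q hq
  obtain ⟨k, hk, hk'⟩ := exists_smooth_coordFn hq μ
  obtain ⟨m, hm, hm'⟩ := exists_smooth_coordFn hq ν
  exact (((B.θ_smooth k m hk hm).contMDiffAt).congr_of_eventuallyEq
    (bracketOf_congr hk'.symm hm'.symm)).contMDiffWithinAt

/-- The part of the brane in the domain of a chart. -/
def patch (p : M) : PatchBrane D where
  η := B.η
  ξ a := hat p (B.emb a)
  θ := B.θc p
  Ω := (chartAt E4 p).target
  isOpen := (chartAt E4 p).open_target
  ξ_smooth a := hat_smooth (B.emb_smooth a) p
  θ_smooth m n := hat_smooth_of_contMDiffOn (B.bracketOf_coordFn_smooth m n)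
  θ_skew y hy := by
    ext m n
    exact B.θ_neg _ _ _
  jacobi y hy i j k := by
    obtain ⟨q, hq, rfl⟩ : ∃ q ∈ (chartAt E4 p).source, chartAt E4 p q = y :=
      ⟨_, (chartAt E4 p).map_target hy, (chartAt E4 p).right_inv hy⟩
    -- Global functions with the germs of the coordinates: the abstract Jacobi identity for them is
    -- the component identity at q.
    have hc : ∀ i, ∃ k : M → ℂ, IsSmooth k ∧ k =ᶠ[nhds q] coordFn p i :=
      exists_smooth_coordFn hq
    choose c hc hc' using hc
    have h1 : ∀ i, hat p (c i) =ᶠ[nhds (chartAt E4 p q)] fun z : E4 => ((z i : ℝ) : ℂ) := by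
      intro i
      refine (hat_congr hq (hc' i)).trans ?_
      filter_upwards [(chartAt E4 p).open_target.mem_nhds hy] with z hz using hat_coordFn hz i
    have h2 : ∀ i j, hat p (B.bracket (c i) (c j)) =ᶠ[nhds (chartAt E4 p q)]
        fun z => B.θc p z i j :=
      fun i j => hat_congr hq (bracketOf_congr (hc' i) (hc' j))
    have h3 : ∀ i j k, B.bracket (c i) (B.bracket (c j) (c k)) q
        = ∑ ν, B.θc p (chartAt E4 p q) i ν * pd ν (fun z => B.θc p z j k) (chartAt E4 p q) := by
      intro i j k
      rw [B.bracket_chart hq ((hc i).mdifferentiableAt q)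
        (IsSmooth.mdifferentiableAt (f := B.bracket (c j) (c k))
          (B.θ_smooth _ _ (hc j) (hc k)) q), brk_congr (h1 i) (h2 j k),
        brk_coord_left]
    have h4 := B.jacobi (c i) (c j) (c k) (hc i) (hc j) (hc k) q
    change B.bracket (c i) (B.bracket (c j) (c k)) q + B.bracket (c j) (B.bracket (c k) (c i)) q
      + B.bracket (c k) (B.bracket (c i) (c j)) q = 0 at h4
    rw [Finset.sum_add_distrib, Finset.sum_add_distrib, ← h3, ← h3, ← h3, h4]
  unimodular y hy := by
    obtain ⟨q, hq, rfl⟩ : ∃ q ∈ (chartAt E4 p).source, chartAt E4 p q = y :=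
      ⟨_, (chartAt E4 p).map_target hy, (chartAt E4 p).right_inv hy⟩
    obtain ⟨r, hr, h⟩ := B.unimodular q
    -- Positivity is assumed only in the preferred chart of each point; the scalar product of
    -- determinants carries it to the chart at p.
    exact ⟨r, hr, (B.det_mul_det (mem_chart_source E4 q) hq).trans h⟩
  det_real y hy := B.g_det_real p y hy

end Brane

end

end

/-! ### Identities in an abstract Poisson algebra -/

section

/-- A commutative Poisson algebra with distinguished elements `x^a`, signs `η_a` and an invertible
element `l`. -/
structure PoissonEmbedding (A : Type*) [CommRing A] (D : ℕ) where
  br : A → A → A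
  br_add : ∀ f k k', br f (k + k') = br f k + br f k'
  br_mul : ∀ f k k', br f (k * k') = k * br f k' + br f k * k'
  br_skew : ∀ f k, br f k = -br k f
  jacobi : ∀ f k k', br f (br k k') + br k (br k' f) + br k' (br f k) = 0
  x : Fin D → A
  e : Fin D → A
  br_e : ∀ f a, br f (e a) = 0
  e_sq : ∀ a, e a * e a = 1
  l : A
  m : A
  l_mul_m : l * m = 1

namespace PoissonEmbedding

variable {A : Type*} [CommRing A] {D : ℕ} (P : PoissonEmbedding A D)

/-- The gradient pairing `l⁻¹ η_a {x^a, f} {x^a, k}`. -/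
def inn (f k : A) : A := P.m * ∑ a, P.e a * (P.br (P.x a) f * P.br (P.x a) k)

/-- The matrix Laplacian `η_a {x^a, {x^a, f}}`. -/
def box (f : A) : A := ∑ a, P.e a * P.br (P.x a) (P.br (P.x a) f)

/-- The Laplacian `l⁻¹ η_a {x^a, {x^a, f}}`. -/
def lap (f : A) : A := P.m * P.box f

/-- `H^{ab} = η_c {x^a, x^c} {x^b, x^c}` -/
def H (a b : Fin D) : A := ∑ c, P.e c * (P.br (P.x a) (P.x c) * P.br (P.x b) (P.x c))

/-- The trace of `H^{ab}`. -/
def trH : A := ∑ a, P.e a * P.H a a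

/-- `G^{μν} ∂_μ x^a ∂_ν x^b` -/
def u (a b : Fin D) : A := P.inn (P.x a) (P.x b)

/-- The trace of `u^{ab}`. -/
def τ : A := ∑ a, P.e a * P.u a a

/-- The contraction `u^{ab} u_{ab}`. -/
def uSq : A := ∑ a, ∑ b, P.e a * P.e b * (P.u a b * P.u a b)

/-- `H^{ab} {x_a, {x_b, x^c}}` -/
def Z (c : Fin D) : A := ∑ a, ∑ b, P.e a * P.e b * (P.H a b * P.br (P.x a) (P.br (P.x b) (P.x c)))

/-- The divergence `f □ k + ⟨df, dk⟩` of `f dk`. -/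
def dv (f k : A) : A := f * P.lap k + P.inn f k

theorem br_zero (f : A) : P.br f 0 = 0 := by
  have h := P.br_add f 0 0
  rw [add_zero] at h
  exact left_eq_add.1 h

theorem br_neg (f k : A) : P.br f (-k) = -P.br f k := by
  have h := P.br_add f k (-k)
  rw [add_neg_cancel, br_zero] at h
  exact (neg_eq_of_add_eq_zero_right h.symm).symm

theorem br_sum {ι : Type*} (s : Finset ι) (f : A) (k : ι → A) :
    P.br f (∑ i ∈ s, k i) = ∑ i ∈ s, P.br f (k i) :=
  map_sum ({ toFun := P.br f, map_zero' := P.br_zero f, map_add' := P.br_add f } : A →+ A) k s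

theorem br_e_mul (f : A) (a : Fin D) (k : A) : P.br f (P.e a * k) = P.e a * P.br f k := by
  rw [br_mul, br_e, zero_mul, add_zero]

theorem br_one (f : A) : P.br f 1 = 0 := by
  have h := P.br_mul f 1 1
  simp only [mul_one, one_mul] at h
  exact left_eq_add.1 h

theorem inn_comm (f k : A) : P.inn f k = P.inn k f := by
  simp only [inn, mul_comm (P.br _ f)]

theorem inn_add (f k k' : A) : P.inn f (k + k') = P.inn f k + P.inn f k' := by
  simp only [inn, br_add, mul_add, Finset.sum_add_distrib]

theorem inn_mul (f k k' : A) : P.inn f (k * k') = k * P.inn f k' + k' * P.inn f k := by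
  simp only [inn, br_mul, Finset.mul_sum, ← Finset.sum_add_distrib]
  exact Finset.sum_congr rfl fun _ _ => by ring

theorem inn_zero (f : A) : P.inn f 0 = 0 := by simp [inn, br_zero]

theorem inn_sum {ι : Type*} (s : Finset ι) (f : A) (k : ι → A) :
    P.inn f (∑ i ∈ s, k i) = ∑ i ∈ s, P.inn f (k i) :=
  map_sum ({ toFun := P.inn f, map_zero' := P.inn_zero f, map_add' := P.inn_add f } : A →+ A) k s

theorem inn_e (f : A) (a : Fin D) : P.inn f (P.e a) = 0 := by simp [inn, br_e]

theorem inn_e_mul (f : A) (a : Fin D) (k : A) : P.inn f (P.e a * k) = P.e a * P.inn f k := by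
  rw [inn_mul, inn_e, mul_zero, add_zero]

theorem inn_mul_left (f k k' : A) : P.inn (f * k) k' = f * P.inn k k' + k * P.inn f k' := by
  rw [inn_comm, inn_mul, inn_comm P k', inn_comm P k']

theorem lap_mul (f k : A) :
    P.lap (f * k) = f * P.lap k + k * P.lap f + 2 * P.inn f k := by
  simp only [lap, box, inn, br_mul, br_add, Finset.mul_sum, ← Finset.sum_add_distrib]
  exact Finset.sum_congr rfl fun _ _ => by ring

/-- Turning both brackets around costs two signs, which cancel; this links the matrix H to the
gradient pairing. -/
theorem H_eq (a b : Fin D) : P.H a b = P.l * P.u a b := by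
  rw [u, inn, ← mul_assoc, P.l_mul_m, one_mul, H]
  exact Finset.sum_congr rfl fun c _ => by rw [P.br_skew (P.x a), P.br_skew (P.x b)]; ring

theorem trH_eq : P.trH = P.l * P.τ := by
  simp only [trH, τ, H_eq, Finset.mul_sum]
  exact Finset.sum_congr rfl fun c _ => by ring

theorem u_comm (a b : Fin D) : P.u a b = P.u b a := P.inn_comm _ _

theorem box_eq (f : A) : P.box f = P.l * P.lap f := by
  rw [lap, ← mul_assoc, P.l_mul_m, one_mul]

theorem l_mul_inn (f k : A) :
    P.l * P.inn f k = ∑ a, P.e a * (P.br (P.x a) f * P.br (P.x a) k) := by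
  rw [inn, ← mul_assoc, P.l_mul_m, one_mul]

theorem jacobi' (a d : Fin D) (f : A) : P.br (P.x a) (P.br (P.x d) f)
    - P.br (P.x d) (P.br (P.x a) f) = -P.br f (P.br (P.x a) (P.x d)) := by
  have h := P.jacobi (P.x a) (P.x d) f
  rw [P.br_skew f (P.x a), br_neg] at h
  linear_combination h

/-- The antisymmetric part of a contraction with `{x^a, x^d}`, by the Jacobi identity. -/
theorem four_sum_br_br (f : A) :
    4 * ∑ a, ∑ d, P.e a * P.e d * (P.br (P.x a) (P.x d) * P.br (P.x a) (P.br (P.x d) f))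
      = -P.br f P.trH := by
  have h1 : ∑ a, ∑ d, P.e a * P.e d * (P.br (P.x a) (P.x d) * P.br (P.x a) (P.br (P.x d) f))
      = -∑ a, ∑ d, P.e a * P.e d * (P.br (P.x a) (P.x d) * P.br (P.x d) (P.br (P.x a) f)) := by
    rw [Finset.sum_comm, ← Finset.sum_neg_distrib]
    refine Finset.sum_congr rfl fun a _ => ?_
    rw [← Finset.sum_neg_distrib]
    exact Finset.sum_congr rfl fun d _ => by rw [P.br_skew (P.x d) (P.x a)]; ring
  have h2 : 2 * ∑ a, ∑ d, P.e a * P.e d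
        * (P.br (P.x a) (P.x d) * P.br (P.x a) (P.br (P.x d) f))
      = -∑ a, ∑ d, P.e a * P.e d * (P.br (P.x a) (P.x d) * P.br f (P.br (P.x a) (P.x d))) := by
    rw [two_mul]
    nth_rw 2 [h1]
    rw [← sub_eq_add_neg, ← Finset.sum_sub_distrib, ← Finset.sum_neg_distrib]
    refine Finset.sum_congr rfl fun a _ => ?_
    rw [← Finset.sum_sub_distrib, ← Finset.sum_neg_distrib]
    exact Finset.sum_congr rfl fun d _ => by
      linear_combination P.e a * P.e d * P.br (P.x a) (P.x d) * P.jacobi' a d f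
  have h3 : P.br f P.trH = 2 * ∑ a, ∑ d, P.e a * P.e d
      * (P.br (P.x a) (P.x d) * P.br f (P.br (P.x a) (P.x d))) := by
    simp only [trH, H, br_sum, br_e, br_mul, Finset.mul_sum]
    exact Finset.sum_congr rfl fun a _ => Finset.sum_congr rfl fun d _ => by ring
  linear_combination 2 * h2 + h3

/-- In the divergence of H the derivative can act on either bracket. One case is Z itself; the other
is skew in two indices, and `four_sum_br_br` makes it a derivative of the trace. The factor 4 avoids
division in a general commutative ring. -/
theorem four_Z (c : Fin D) : 4 * P.Z c
    = 4 * (∑ d, P.e d * (P.l * P.inn (P.x d) (P.H d c))) - P.l * P.inn (P.x c) P.trH := by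
  have h1 : ∑ d, P.e d * (P.l * P.inn (P.x d) (P.H d c))
      = (∑ b, P.e b * P.br (P.x c) (P.x b) * ∑ a, ∑ d, P.e a * P.e d *
          (P.br (P.x a) (P.x d) * P.br (P.x a) (P.br (P.x d) (P.x b)))) + P.Z c := by
    have e1 : ∑ d, P.e d * (P.l * P.inn (P.x d) (P.H d c)) = ∑ a, ∑ d, ∑ b,
        (P.e b * P.br (P.x c) (P.x b) * (P.e a * P.e d *
            (P.br (P.x a) (P.x d) * P.br (P.x a) (P.br (P.x d) (P.x b))))
          + P.e a * P.e b * (P.e d * (P.br (P.x a) (P.x d) * P.br (P.x b) (P.x d))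
            * P.br (P.x a) (P.br (P.x b) (P.x c)))) := by
      simp only [l_mul_inn, H, br_sum, br_mul, br_e, Finset.mul_sum]
      rw [Finset.sum_comm]
      refine Finset.sum_congr rfl fun a _ => Finset.sum_congr rfl fun d _ =>
        Finset.sum_congr rfl fun b _ => ?_
      rw [P.br_skew (P.x b) (P.x c), P.br_skew (P.x b) (P.x d), br_neg]
      ring
    have e2 : P.Z c = ∑ a, ∑ d, ∑ b, P.e a * P.e b *
        (P.e d * (P.br (P.x a) (P.x d) * P.br (P.x b) (P.x d))
          * P.br (P.x a) (P.br (P.x b) (P.x c))) := by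
      simp only [Z, H, Finset.mul_sum, Finset.sum_mul]
      exact Finset.sum_congr rfl fun a _ => Finset.sum_comm
    rw [e1, e2]
    simp only [Finset.mul_sum, Finset.sum_add_distrib]
    congr 1
    exact (Finset.sum_congr rfl fun a _ => Finset.sum_comm).trans Finset.sum_comm
  have h2 : ∀ b, 4 * ∑ a, ∑ d, P.e a * P.e d *
          (P.br (P.x a) (P.x d) * P.br (P.x a) (P.br (P.x d) (P.x b))) = -P.br (P.x b) P.trH :=
    fun b => P.four_sum_br_br (P.x b)
  have h3 : P.l * P.inn (P.x c) P.trH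
      = -∑ b, P.e b * P.br (P.x c) (P.x b) * P.br (P.x b) P.trH := by
    rw [l_mul_inn, ← Finset.sum_neg_distrib]
    exact Finset.sum_congr rfl fun b _ => by rw [P.br_skew (P.x c) (P.x b)]; ring
  have h4 : 4 * ∑ b, P.e b * P.br (P.x c) (P.x b) * ∑ a, ∑ d, P.e a * P.e d *
          (P.br (P.x a) (P.x d) * P.br (P.x a) (P.br (P.x d) (P.x b)))
      = P.l * P.inn (P.x c) P.trH := by
    rw [h3, Finset.mul_sum, ← Finset.sum_neg_distrib]
    exact Finset.sum_congr rfl fun b _ => by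
      linear_combination P.e b * P.br (P.x c) (P.x b) * h2 b
  linear_combination -4 * h1 - h4

/-- The symbol of `[X_a, H^{ab}] [X_b, H]`, up to sign. -/
def W : A := ∑ a, ∑ b, P.e a * P.e b * (P.br (P.x a) (P.H a b) * P.br (P.x b) P.trH)

/-- Conservation of the energy-momentum tensor: the divergence of H - ¼ηH consists of terms
proportional to □x, by the Leibniz rule and the Jacobi identity. -/
theorem four_div_H (b : Fin D) : 4 * ∑ a, P.e a * P.br (P.x a) (P.H a b)
    = 4 * (∑ c, P.e c * P.box (P.x c) * P.br (P.x b) (P.x c)) + P.br (P.x b) P.trH := by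
  have h1 : ∑ a, P.e a * P.br (P.x a) (P.H a b)
      = (∑ c, P.e c * P.box (P.x c) * P.br (P.x b) (P.x c))
        - ∑ a, ∑ d, P.e a * P.e d *
          (P.br (P.x a) (P.x d) * P.br (P.x a) (P.br (P.x d) (P.x b))) := by
    have e1 : ∑ c, P.e c * P.box (P.x c) * P.br (P.x b) (P.x c) = ∑ a, ∑ c, P.e c
        * (P.e a * P.br (P.x a) (P.br (P.x a) (P.x c))) * P.br (P.x b) (P.x c) := by
      rw [Finset.sum_comm]
      simp only [box, Finset.mul_sum, Finset.sum_mul]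
    rw [e1, ← Finset.sum_sub_distrib]
    refine Finset.sum_congr rfl fun a _ => ?_
    rw [← Finset.sum_sub_distrib, H, br_sum, Finset.mul_sum]
    refine Finset.sum_congr rfl fun c _ => ?_
    rw [br_e_mul, br_mul, P.br_skew (P.x c) (P.x b), br_neg]
    ring
  linear_combination 4 * h1 - P.four_sum_br_br (P.x b)

/-- The conservation law `four_div_H`, paired with the brackets of the trace; the sum over b turns
products of brackets into gradient pairings. -/
theorem four_W : 4 * P.W = 4 * P.l * P.l * (∑ c, P.e c * (P.lap (P.x c) * P.inn (P.x c) P.trH))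
    + P.l * P.inn P.trH P.trH := by
  have h1 : 4 * P.W = ∑ b, P.e b * P.br (P.x b) P.trH
      * (4 * ∑ a, P.e a * P.br (P.x a) (P.H a b)) := by
    rw [W, Finset.sum_comm, Finset.mul_sum]
    refine Finset.sum_congr rfl fun b _ => ?_
    simp only [Finset.mul_sum]
    exact Finset.sum_congr rfl fun a _ => by ring
  have h2 : 4 * P.l * P.l * (∑ c, P.e c * (P.lap (P.x c) * P.inn (P.x c) P.trH))
      = ∑ b, ∑ c, 4 * (P.e b * P.br (P.x b) P.trH) * (P.e c * P.box (P.x c)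
        * P.br (P.x b) (P.x c)) := by
    rw [Finset.sum_comm, Finset.mul_sum]
    refine Finset.sum_congr rfl fun c _ => ?_
    have := P.l_mul_inn (P.x c) P.trH
    rw [show 4 * P.l * P.l * (P.e c * (P.lap (P.x c) * P.inn (P.x c) P.trH))
      = 4 * (P.e c * P.box (P.x c)) * (P.l * P.inn (P.x c) P.trH) by rw [box_eq]; ring, this,
      Finset.mul_sum]
    exact Finset.sum_congr rfl fun b _ => by ring
  rw [h1, h2, l_mul_inn, ← Finset.sum_add_distrib]
  refine Finset.sum_congr rfl fun b _ => ?_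
  rw [four_div_H, ← Finset.mul_sum]
  ring

/-- Minus the symbol of the first matrix action. -/
def bare : A := (∑ a, ∑ b, P.e a * P.e b * (P.H a b * P.box (P.H a b)))
  + 2 * ∑ c, P.e c * (P.box (P.x c) * P.Z c)

/-- The divergence terms in the first matrix action. -/
def bareDv : A := (∑ a, ∑ b, P.e a * P.e b
    * P.dv (2 * (P.l * P.l * P.u a b * P.lap (P.x b))) (P.x a)) + P.dv (P.l * (P.uSq - 4)) P.l

/-- `u^{ab} □ x_a □ x_b` -/
def uLapLap : A := ∑ a, ∑ b, P.e a * P.e b * (P.u a b * (P.lap (P.x a) * P.lap (P.x b)))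

/-- `⟨df, dx_a⟩ □ x^a` -/
def innLap (f : A) : A := ∑ a, P.e a * (P.lap (P.x a) * P.inn (P.x a) f)

/-- `u^{ab} ⟨df, dx_a⟩ □ x_b` -/
def uInnLap (f : A) : A := ∑ a, ∑ b, P.e a * P.e b * (P.u a b * (P.lap (P.x b) * P.inn (P.x a) f))

/-- The algebraic core. The subtracted divergences remove the pairings of dx_a with du^{ab} and move
derivatives off uSq; what remains multiplied by u^{ab} is exactly the combination in Bochner's
formula. In the second divergence uSq is shifted by -4, so that 8 l □l survives and the coefficient
of ⟨dl, dl⟩ is uSq - 4 = ½(τ - 4)(τ + 4) on a brane, which is small. The doubling makes `four_Z`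
applicable. -/
theorem two_bare : 2 * (P.m * P.bare - P.bareDv)
    = P.l * P.l * (∑ a, ∑ b, P.e a * P.e b * (P.u a b * (2 * P.lap (P.u a b)
        - 2 * P.inn (P.x a) (P.lap (P.x b)) - 2 * P.inn (P.x b) (P.lap (P.x a)))))
      + 8 * P.l * P.lap P.l - 4 * P.l * P.uInnLap P.l - P.l * P.l * P.innLap P.τ
      - P.l * P.τ * P.innLap P.l - 4 * P.l * P.l * P.uLapLap
      - 2 * (P.uSq - 4) * P.inn P.l P.l := by
  set S1 := ∑ a, ∑ b, P.e a * P.e b * (P.u a b * P.lap (P.u a b)) with hS1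
  set S2 := ∑ a, ∑ b, P.e a * P.e b * (P.u a b * P.inn (P.x a) (P.lap (P.x b))) with hS2
  set S4 := ∑ a, ∑ b, P.e a * P.e b * (P.lap (P.x b) * P.inn (P.x a) (P.u a b)) with hS4
  have e0 : ∑ a, ∑ b, P.e a * P.e b * (P.u a b * (2 * P.lap (P.u a b)
        - 2 * P.inn (P.x a) (P.lap (P.x b)) - 2 * P.inn (P.x b) (P.lap (P.x a))))
      = 2 * S1 - 4 * S2 := by
    have h : S2 = ∑ a, ∑ b, P.e a * P.e b * (P.u a b * P.inn (P.x b) (P.lap (P.x a))) := by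
      rw [hS2, Finset.sum_comm]
      exact Finset.sum_congr rfl fun a _ => Finset.sum_congr rfl fun b _ => by
        rw [P.u_comm b a]; ring
    rw [show 2 * S1 - 4 * S2 = 2 * S1 - 2 * S2 - 2 * S2 by ring]
    nth_rw 2 [h]
    simp only [hS1, hS2, Finset.mul_sum, ← Finset.sum_sub_distrib]
    exact Finset.sum_congr rfl fun a _ => Finset.sum_congr rfl fun b _ => by ring
  -- With H = l u, the product rule for the Laplacian separates □u from □l, and the cross terms
  -- combine to the differential of uSq.
  have e1 : P.m * ∑ a, ∑ b, P.e a * P.e b * (P.H a b * P.box (P.H a b))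
      = P.l * P.l * S1 + P.l * P.uSq * P.lap P.l + P.l * P.inn P.l P.uSq := by
    have h : P.inn P.l P.uSq
        = ∑ a, ∑ b, P.e a * P.e b * (2 * P.u a b * P.inn P.l (P.u a b)) := by
      simp only [uSq, inn_sum, inn_e, inn_mul]
      exact Finset.sum_congr rfl fun a _ => Finset.sum_congr rfl fun b _ => by ring
    rw [h, uSq, hS1]
    simp only [Finset.mul_sum, Finset.sum_mul, ← Finset.sum_add_distrib]
    refine Finset.sum_congr rfl fun a _ => Finset.sum_congr rfl fun b _ => ?_
    rw [H_eq, show P.m * (P.e a * P.e b * (P.l * P.u a b * P.box (P.l * P.u a b)))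
      = P.e a * P.e b * (P.l * P.u a b * (P.m * P.box (P.l * P.u a b))) by ring, ← lap, lap_mul]
    ring
  have e2 : P.m * (2 * (2 * ∑ c, P.e c * (P.box (P.x c) * P.Z c)))
      = 4 * P.l * P.l * S4 + 4 * P.l * P.uInnLap P.l - P.l * P.l * P.innLap P.τ
        - P.l * P.τ * P.innLap P.l := by
    have h1 : ∀ c, P.m * (2 * (2 * (P.e c * (P.box (P.x c) * P.Z c))))
        = P.e c * (P.lap (P.x c) * (4 * P.Z c)) := fun c => by rw [lap]; ring
    have h2 : 4 * P.l * P.l * S4 + 4 * P.l * P.uInnLap P.l = ∑ c, P.e c * (P.lap (P.x c)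
        * (4 * ∑ d, P.e d * (P.l * P.inn (P.x d) (P.H d c)))) := by
      rw [hS4, uInnLap, Finset.sum_comm]
      nth_rw 2 [Finset.sum_comm]
      simp only [Finset.mul_sum, ← Finset.sum_add_distrib, H_eq, inn_mul]
      exact Finset.sum_congr rfl fun a _ => Finset.sum_congr rfl fun b _ => by ring
    simp only [Finset.mul_sum] at h2 ⊢
    simp only [h1, four_Z, mul_sub, Finset.sum_sub_distrib, Finset.mul_sum]
    rw [← h2, trH_eq, innLap, innLap]
    simp only [Finset.mul_sum, inn_mul]
    rw [sub_sub, ← Finset.sum_add_distrib]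
    congr 1
    exact Finset.sum_congr rfl fun a _ => by ring
  -- This divergence contains the sum `S4` in the amount that cancels the one in `e2`, and supplies
  -- the `S2` that Bochner's formula requires.
  have e3 : ∑ a, ∑ b, P.e a * P.e b * P.dv (2 * (P.l * P.l * P.u a b * P.lap (P.x b))) (P.x a)
      = 2 * (P.l * P.l * P.uLapLap + P.l * P.l * S2 + P.l * P.l * S4
        + 2 * P.l * P.uInnLap P.l) := by
    rw [uLapLap, hS2, hS4, uInnLap]
    simp only [Finset.mul_sum, ← Finset.sum_add_distrib]
    refine Finset.sum_congr rfl fun a _ => Finset.sum_congr rfl fun b _ => ?_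
    rw [dv, two_mul, P.inn_comm _ (P.x a)]
    simp only [inn_mul, inn_add]
    ring
  rw [bare, bareDv, e3, dv, e0, P.inn_comm _ P.l]
  have h4 : P.inn P.l (P.l * (P.uSq - 4)) = P.l * P.inn P.l P.uSq + (P.uSq - 4) * P.inn P.l P.l := by
    have h5 : P.inn P.l (-4) = 0 := by
      have h6 : ∀ a, P.br (P.x a) (-4) = 0 := fun a => by
        rw [show (-4 : A) = -(1 + 1 + 1 + 1) by norm_num, br_neg, br_add, br_add, br_add, br_one]
        simp
      simp [inn, h6]
    rw [inn_mul, sub_eq_add_neg, inn_add, h5]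
    ring
  rw [h4]
  linear_combination 2 * e1 + e2

/-- `H^{ab} {x_a, {x_b, H}}` -/
def HH : A := ∑ a, ∑ b, P.e a * P.e b * (P.H a b * P.br (P.x a) (P.br (P.x b) P.trH))

/-- The divergence `{x_a, H^{ab} {x_b, H}}` -/
def HHdv : A := ∑ a, ∑ b, P.e a * P.e b * P.br (P.x a) (P.H a b * P.br (P.x b) P.trH)

theorem HH_eq : P.HH = P.HHdv - P.W := by
  rw [HH, HHdv, W, ← Finset.sum_sub_distrib]
  refine Finset.sum_congr rfl fun a _ => ?_
  rw [← Finset.sum_sub_distrib]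
  exact Finset.sum_congr rfl fun b _ => by rw [br_mul]; ring

/-- Moving the outer bracket onto H^{ab} leaves a divergence minus `W`, and the conservation law
evaluates `W`. -/
theorem four_HH : 4 * (P.m * (P.HHdv - P.HH))
    = 4 * P.l * P.innLap P.trH + P.inn P.trH P.trH := by
  rw [HH_eq, innLap]
  linear_combination P.m * P.four_W + (4 * P.l * (∑ c, P.e c * (P.lap (P.x c)
    * P.inn (P.x c) P.trH)) + P.inn P.trH P.trH) * P.l_mul_m

end PoissonEmbedding

end

/-! ### Smooth functions on the brane as a Poisson algebra -/

section

open Patch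

section

variable {M : Type*} [TopologicalSpace M] [ChartedSpace E4 M] {f k : M → ℂ}

theorem IsSmooth.const (c : ℂ) : IsSmooth fun _ : M => c := contMDiff_const

theorem IsSmooth.add (hf : IsSmooth f) (hk : IsSmooth k) : IsSmooth (f + k) :=
  (contDiff_add (𝕜 := ℝ) (F := ℂ) (n := ∞)).contMDiff.comp (ContMDiff.prodMk_space hf hk)

theorem IsSmooth.mul (hf : IsSmooth f) (hk : IsSmooth k) : IsSmooth (f * k) :=
  (contDiff_mul (𝕜 := ℝ) (𝔸 := ℂ) (n := ∞)).contMDiff.comp (ContMDiff.prodMk_space hf hk)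

/-- A function that is smooth in every chart is smooth. -/
theorem isSmooth_of_chart [IsManifold (𝓡 4) ∞ M] (F : M → E4 → ℂ)
    (hF : ∀ p, SmoothOn (chartAt E4 p).target (F p))
    (h : ∀ p, ∀ q ∈ (chartAt E4 p).source, f q = F p (chartAt E4 p q)) : IsSmooth f := by
  intro p
  have h1 : ContMDiffOn (𝓡 4) 𝓘(ℝ, ℂ) ∞ (F p ∘ chartAt E4 p) (chartAt E4 p).source :=
    (contMDiffOn_iff_contDiffOn.2 (hF p)).comp (contMDiffOn_chart (I := 𝓡 4) (n := ∞) (x := p))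
      fun z hz => (chartAt E4 p).map_source hz
  have hn := (chartAt E4 p).open_source.mem_nhds (mem_chart_source E4 p)
  exact (h1.contMDiffAt hn).congr_of_eventuallyEq
    (Filter.eventuallyEq_of_mem hn fun q hq => h p q hq)

/-- The algebra of smooth complex functions. -/
def smoothFunctions (M : Type*) [TopologicalSpace M] [ChartedSpace E4 M] :
    Subalgebra ℂ (M → ℂ) where
  carrier := {f | IsSmooth f}
  mul_mem' hf hk := IsSmooth.mul hf hk
  add_mem' hf hk := IsSmooth.add hf hk
  algebraMap_mem' c := IsSmooth.const c

namespace Brane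

variable {D : ℕ} [T2Space M] [IsManifold (𝓡 4) ∞ M] (B : Brane D M) {p q : M}

omit [T2Space M] in
theorem bracket_add (hf : IsSmooth f) {k k' : M → ℂ} (hk : IsSmooth k) (hk' : IsSmooth k') :
    B.bracket f (k + k') = B.bracket f k + B.bracket f k' := by
  ext q
  have hq := mem_chart_source E4 q
  have h1 := hk.mdifferentiableAt q
  have h2 := hk'.mdifferentiableAt q
  rw [Pi.add_apply, B.bracket_chart hq (hf.mdifferentiableAt q) h1,
    B.bracket_chart hq (hf.mdifferentiableAt q) h2,
    B.bracket_chart hq (hf.mdifferentiableAt q) ((hk.add hk').mdifferentiableAt q)]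
  simp only [brk, ← Finset.sum_add_distrib, ← mul_add]
  refine Finset.sum_congr rfl fun ν _ => ?_
  rw [← pd_add (differentiableAt_hat hq h1) (differentiableAt_hat hq h2)]
  rfl

omit [T2Space M] in
theorem bracket_mul (hf : IsSmooth f) {k k' : M → ℂ} (hk : IsSmooth k) (hk' : IsSmooth k') :
    B.bracket f (k * k') = k * B.bracket f k' + B.bracket f k * k' := by
  ext q
  have hq := mem_chart_source E4 q
  have h1 := hk.mdifferentiableAt q
  have h2 := hk'.mdifferentiableAt q
  rw [Pi.add_apply, Pi.mul_apply, Pi.mul_apply, B.bracket_chart hq (hf.mdifferentiableAt q) h1,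
    B.bracket_chart hq (hf.mdifferentiableAt q) h2,
    B.bracket_chart hq (hf.mdifferentiableAt q) ((hk.mul hk').mdifferentiableAt q)]
  simp only [brk, Finset.mul_sum, Finset.sum_mul, ← Finset.sum_add_distrib]
  refine Finset.sum_congr rfl fun ν _ => Finset.sum_congr rfl fun μ _ => ?_
  have h3 : pd ν (hat q (k * k')) (chartAt E4 q q) = _ :=
    pd_mul (differentiableAt_hat hq h1) (differentiableAt_hat hq h2) ν
  have h4 : ∀ k, hat q k (chartAt E4 q q) = k q := fun k => by
    rw [hat, (chartAt E4 q).left_inv hq]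
  rw [h3, h4, h4]
  ring

omit [T2Space M] in
theorem bracket_const (hf : IsSmooth f) (c : ℂ) : B.bracket f (fun _ => c) = 0 := by
  ext q
  rw [B.bracket_chart (mem_chart_source E4 q) (hf.mdifferentiableAt q)
    ((IsSmooth.const c).mdifferentiableAt q)]
  have : ∀ ν, pd ν (hat q fun _ => c) (chartAt E4 q q) = 0 := fun ν => pd_const c ν
  simp [brk, this]

/-- The function `e^σ`. -/
def ell (q : M) : ℂ := (Real.exp (B.σ q) : ℂ)

theorem ell_eq (hq : q ∈ (chartAt E4 p).source) : B.ell q = (B.patch p).l (chartAt E4 p q) := by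
  rw [ell, ← B.σc_eq hq]; rfl

theorem ell_smooth : IsSmooth B.ell :=
  isSmooth_of_chart (fun p => (B.patch p).l) (fun _ => PatchBrane.l_smooth) fun _ _ hq => B.ell_eq hq

theorem ell_inv_smooth : IsSmooth fun q => (B.ell q)⁻¹ :=
  isSmooth_of_chart (fun p z => ((B.patch p).l z)⁻¹)
    (fun _ => PatchBrane.l_smooth.inv fun _ _ => PatchBrane.l_ne_zero)
    fun _ _ hq => by rw [B.ell_eq hq]

omit [T2Space M] [IsManifold (𝓡 4) ∞ M] in
theorem ell_ne_zero (q : M) : B.ell q ≠ 0 := by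
  rw [ell]; exact_mod_cast (Real.exp_pos _).ne'

/-- The Poisson algebra of smooth functions on the brane. -/
def poisson : PoissonEmbedding (smoothFunctions M) D where
  br f k := ⟨B.bracket f k, B.θ_smooth _ _ f.2 k.2⟩
  br_add f k k' := Subtype.ext (B.bracket_add f.2 k.2 k'.2)
  br_mul f k k' := Subtype.ext (B.bracket_mul f.2 k.2 k'.2)
  br_skew f k := Subtype.ext (funext fun q => B.θ_neg q _ _)
  jacobi f k k' := Subtype.ext (funext fun q => B.jacobi f k k' f.2 k.2 k'.2 q)
  x a := ⟨B.emb a, B.emb_smooth a⟩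
  e a := algebraMap ℂ _ (B.η a : ℂ)
  br_e f a := Subtype.ext (B.bracket_const f.2 _)
  e_sq a := by
    rw [← map_mul, ← Complex.ofReal_mul]
    rcases B.η_sign a with h | h <;> simp [h]
  l := ⟨B.ell, B.ell_smooth⟩
  m := ⟨fun q => (B.ell q)⁻¹, B.ell_inv_smooth⟩
  l_mul_m := Subtype.ext (funext fun q => mul_inv_cancel₀ (B.ell_ne_zero q))

end Brane

end

end

/-! ### Dictionary between the Poisson algebra and the effective geometry -/

section

open Patch

variable {M : Type*} [TopologicalSpace M] [ChartedSpace E4 M]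

/-- Evaluation of a smooth function at a point. -/
def ev (q : M) : smoothFunctions M →ₐ[ℂ] ℂ := (Pi.evalAlgHom ℂ (fun _ : M => ℂ) q).comp
  (smoothFunctions M).val

theorem hat_eq_ev (p : M) (f : smoothFunctions M) (z : E4) :
    hat p f z = ev ((chartAt E4 p).symm z) f := rfl

namespace Brane

variable {D : ℕ} [T2Space M] [IsManifold (𝓡 4) ∞ M] (B : Brane D M) {p q : M} {z : E4}

theorem ev_e (q : M) (a : Fin D) : ev q (B.poisson.e a) = (B.η a : ℂ) := rfl

theorem ev_m (q : M) : ev q B.poisson.m = (B.ell q)⁻¹ := rfl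

theorem ev_l (q : M) : ev q B.poisson.l = B.ell q := rfl

theorem ell_symm (hz : z ∈ (chartAt E4 p).target) :
    B.ell ((chartAt E4 p).symm z) = (B.patch p).l z := by
  rw [B.ell_eq ((chartAt E4 p).map_target hz), (chartAt E4 p).right_inv hz]

theorem hat_br (hz : z ∈ (chartAt E4 p).target) (f k : smoothFunctions M) :
    hat p (B.poisson.br f k) z = brk (B.patch p).θ (hat p f) (hat p k) z :=
  B.hat_bracket f.2 k.2 hz

/-- Equality of germs, not only of values: in an iterated bracket the inner one gets differentiated.
-/
theorem hat_br_congr (hz : z ∈ (chartAt E4 p).target) (f k : smoothFunctions M) :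
    hat p (B.poisson.br f k) =ᶠ[nhds z] brk (B.patch p).θ (hat p f) (hat p k) :=
  Filter.eventuallyEq_of_mem ((chartAt E4 p).open_target.mem_nhds hz) fun _ hw => B.hat_br hw f k

/-- `sum_brk_brk` with the factor e^σ divided out: the algebraic pairing is the inner product of
differentials for G. -/
theorem hat_inn (hz : z ∈ (chartAt E4 p).target) (f k : smoothFunctions M) :
    hat p (B.poisson.inn f k) z = gradInner (B.patch p).U (hat p f) (hat p k) z := by
  rw [hat_eq_ev, PoissonEmbedding.inn]
  simp only [map_mul, map_sum, ev_e, ev_m, ← hat_eq_ev, B.hat_br hz]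
  rw [B.ell_symm hz, inv_mul_eq_iff_eq_mul₀ PatchBrane.l_ne_zero]
  exact PatchBrane.sum_brk_brk (P := B.patch p) hz (hat p f) (hat p k)

theorem hat_lap (hz : z ∈ (chartAt E4 p).target) (f : smoothFunctions M) :
    hat p (B.poisson.lap f) z = (B.patch p).lap (hat p f) z := by
  rw [hat_eq_ev, PoissonEmbedding.lap, PoissonEmbedding.box]
  simp only [map_mul, map_sum, ev_e, ev_m, ← hat_eq_ev, B.hat_br hz,
    brk_congr (Filter.EventuallyEq.refl _ _) (B.hat_br_congr hz _ _)]
  rw [B.ell_symm hz, inv_mul_eq_iff_eq_mul₀ PatchBrane.l_ne_zero]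
  exact PatchBrane.sum_brk_brk_comp (P := B.patch p) hz (hat_smooth f.2 p)

theorem hat_u (hz : z ∈ (chartAt E4 p).target) (a b : Fin D) :
    hat p (B.poisson.u a b) z = (B.patch p).u a b z := B.hat_inn hz _ _

theorem hat_τ (hz : z ∈ (chartAt E4 p).target) : hat p B.poisson.τ z = (B.patch p).τ z := by
  rw [hat_eq_ev, PoissonEmbedding.τ]
  simp only [map_mul, map_sum, ev_e, ← hat_eq_ev, B.hat_u hz]
  exact PatchBrane.sum_u_diag (P := B.patch p) z

theorem hat_uSq (hz : z ∈ (chartAt E4 p).target) :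
    hat p B.poisson.uSq z = (1 / 2 : ℂ) * (B.patch p).τ z ^ 2 - 4 := by
  rw [hat_eq_ev, PoissonEmbedding.uSq]
  simp only [map_mul, map_sum, ev_e, ← hat_eq_ev, B.hat_u hz]
  exact PatchBrane.sum_u_sq (P := B.patch p) hz

omit [T2Space M] [IsManifold (𝓡 4) ∞ M] in
/-- A smooth function in terms of its values in a chart. -/
theorem eq_hat (hq : q ∈ (chartAt E4 p).source) (f : M → ℂ) : f q = hat p f (chartAt E4 p q) := by
  rw [hat, (chartAt E4 p).left_inv hq]

omit [T2Space M] [IsManifold (𝓡 4) ∞ M] in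
theorem ev_eq_hat (q : M) (f : smoothFunctions M) : ev q f = hat q f (chartAt E4 q q) :=
  eq_hat (mem_chart_source E4 q) f

omit [T2Space M] [IsManifold (𝓡 4) ∞ M] in
theorem chart_mem (q : M) : chartAt E4 q q ∈ (chartAt E4 q).target :=
  (chartAt E4 q).map_source (mem_chart_source E4 q)

end Brane

end

/-! ### Curvature densities as global smooth functions -/

section

open Patch

variable {M : Type*} [TopologicalSpace M] [ChartedSpace E4 M]

namespace Brane

variable {D : ℕ} [T2Space M] [IsManifold (𝓡 4) ∞ M] (B : Brane D M) {p q : M} {z : E4}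

/-- The Hessian of `x^a` on the gradients of `x^c` and `x^d`. -/
def hessF (a c d : Fin D) : smoothFunctions M := (1 / 2 : ℂ) •
  (B.poisson.inn (B.poisson.u a d) (B.poisson.x c) + B.poisson.inn (B.poisson.u a c) (B.poisson.x d)
    - B.poisson.inn (B.poisson.u c d) (B.poisson.x a))

/-- The tensor that is dual to the gradients of the embedding functions. -/
def dualF (c d : Fin D) : smoothFunctions M := B.poisson.e c * B.poisson.e d *
  (((1 / 4 : ℂ) • (B.poisson.τ * B.poisson.τ) - 1) * B.poisson.u c d - (1 / 2 : ℂ) • (B.poisson.τ *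
    ∑ e, B.poisson.e e * (B.poisson.u c e * B.poisson.u e d)))

/-- The inner product of the Hessians of `x^a` and `x^b`. -/
def hessInnerF (a b : Fin D) : smoothFunctions M := ∑ c, ∑ d, ∑ e, ∑ k,
  B.hessF a c d * B.dualF e d * (B.hessF b e k * B.dualF c k)

/-- The symmetrized Ricci tensor on the gradients of `x^a` and `x^b`. -/
def ricF (a b : Fin D) : smoothFunctions M := (1 / 2 : ℂ) • (B.poisson.lap (B.poisson.u a b)
  - B.poisson.inn (B.poisson.x a) (B.poisson.lap (B.poisson.x b))
  - B.poisson.inn (B.poisson.x b) (B.poisson.lap (B.poisson.x a))) - B.hessInnerF a b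

/-- `R_{μν}[G] (GgG)^{μν}` as a smooth function. -/
def ricGgGF : smoothFunctions M := ∑ a, B.poisson.e a * B.ricF a a

/-- `R[G]` as a smooth function. -/
def scalGF : smoothFunctions M := (1 / 2 : ℂ) • (B.poisson.τ * B.ricGgGF)
  - ∑ a, ∑ b, B.poisson.e a * B.poisson.e b * (B.poisson.u a b * B.ricF a b)

/-- `R_{μν}[G] g^{μν}` as a smooth function. -/
def ricgF : smoothFunctions M := (1 / 2 : ℂ) • (B.poisson.τ * B.scalGF) - B.ricGgGF

omit [T2Space M] [IsManifold (𝓡 4) ∞ M] in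
theorem hat_congr_on {f k : E4 → ℂ} (h : ∀ z ∈ (chartAt E4 p).target, f z = k z)
    (hz : z ∈ (chartAt E4 p).target) (U : E4 → Mat4) (g : E4 → ℂ) :
    gradInner U f g z = gradInner U k g z := by
  simp only [gradInner, pd_congr_on (chartAt E4 p).open_target hz h]

theorem hat_hessF (hz : z ∈ (chartAt E4 p).target) (a c d : Fin D) :
    hat p (B.hessF a c d) z = (B.patch p).hessU a c d z := by
  rw [hat_eq_ev, hessF, PatchBrane.hessU]
  simp only [map_smul, map_add, map_sub, ← hat_eq_ev, B.hat_inn hz, smul_eq_mul]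
  simp only [hat_congr_on (fun w hw => B.hat_u hw _ _) hz]
  rfl

theorem hat_dualF (hz : z ∈ (chartAt E4 p).target) (c d : Fin D) :
    hat p (B.dualF c d) z = (B.patch p).dualM c d z := by
  rw [hat_eq_ev, dualF, PatchBrane.dualM]
  simp only [map_smul, map_sub, map_mul, map_sum, map_one, ev_e, ← hat_eq_ev, B.hat_u hz,
    B.hat_τ hz, smul_eq_mul]
  simp only [mul_assoc, sq]
  rfl

theorem hat_hessInnerF (hz : z ∈ (chartAt E4 p).target) (a b : Fin D) :
    hat p (B.hessInnerF a b) z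
      = hessInner (B.patch p).G (B.patch p).U ((B.patch p).ξ a) ((B.patch p).ξ b) z := by
  rw [PatchBrane.hessInner_ξ (P := B.patch p) hz, hat_eq_ev, hessInnerF]
  simp only [map_mul, map_sum, ← hat_eq_ev, B.hat_hessF hz, B.hat_dualF hz, mul_assoc]

theorem hat_ricF (hz : z ∈ (chartAt E4 p).target) (a b : Fin D) : hat p (B.ricF a b) z
    = (1 / 2 : ℂ) * (ricciGrad (B.patch p).G (B.patch p).U ((B.patch p).ξ a) ((B.patch p).ξ b) z
      + ricciGrad (B.patch p).G (B.patch p).U ((B.patch p).ξ b) ((B.patch p).ξ a) z) := by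
  -- Bochner's formula is solved for the Ricci terms; all its other terms are bracket expressions.
  have h := PatchBrane.bochner_ξ (P := B.patch p) hz a b
  have hu : (B.patch p).lap (hat p (B.poisson.u a b)) z = (B.patch p).lap ((B.patch p).u a b) z := by
    refine (B.patch p).metricOn.divergence_congr hz fun w hw m => ?_
    simp only [Patch.gradient, pd_congr_on (chartAt E4 p).open_target hw (fun v hv => B.hat_u hv a b)]
  rw [hat_eq_ev, ricF]
  simp only [map_smul, map_sub, smul_eq_mul, ← hat_eq_ev, B.hat_inn hz, B.hat_lap hz,
    B.hat_hessInnerF hz, hu]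
  rw [(B.patch p).metricOn.gradInner_comm hz (hat p (B.poisson.x a)),
    (B.patch p).metricOn.gradInner_comm hz (hat p (B.poisson.x b)),
    hat_congr_on (fun w hw => B.hat_lap hw _) hz, hat_congr_on (fun w hw => B.hat_lap hw _) hz]
  change (1 / 2 : ℂ) * (_ - gradInner _ ((B.patch p).lap ((B.patch p).ξ b)) ((B.patch p).ξ a) z
    - gradInner _ ((B.patch p).lap ((B.patch p).ξ a)) ((B.patch p).ξ b) z) - _ = _
  rw [h]
  ring

theorem G_inv (hz : z ∈ (chartAt E4 p).target) : ((B.patch p).G z)⁻¹ = (B.patch p).U z :=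
  (B.patch p).metricOn.inv_eq hz

theorem hat_ricGgGF (hz : z ∈ (chartAt E4 p).target) : hat p B.ricGgGF z
    = ricciContract (B.patch p).G ((B.patch p).U z * (B.patch p).g z * (B.patch p).U z) z := by
  rw [← PatchBrane.ricci_GgG (P := B.patch p), hat_eq_ev, ricGgGF]
  simp only [map_mul, map_sum, ev_e, ← hat_eq_ev, B.hat_ricF hz]
  refine Finset.sum_congr rfl fun a _ => ?_
  change ((B.patch p).η a : ℂ) * _ = _
  ring

theorem hat_scalGF (hz : z ∈ (chartAt E4 p).target) :
    hat p B.scalGF z = scalarCurvature (B.patch p).G z := by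
  have h := PatchBrane.ricci_u (P := B.patch p) hz
  have h2 : ∑ a, ∑ b, (B.η a : ℂ) * B.η b * ((B.patch p).u a b z * ((1 / 2 : ℂ) *
        (ricciGrad (B.patch p).G (B.patch p).U ((B.patch p).ξ a) ((B.patch p).ξ b) z
        + ricciGrad (B.patch p).G (B.patch p).U ((B.patch p).ξ b) ((B.patch p).ξ a) z)))
      = ∑ a, ∑ b, (B.η a : ℂ) * B.η b * (B.patch p).u a b z
        * ricciGrad (B.patch p).G (B.patch p).U ((B.patch p).ξ a) ((B.patch p).ξ b) z := by
    -- Only the symmetrized Ricci pairing is available, which suffices because it is contracted with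
    -- the symmetric u^{ab}.
    set F : Fin D → Fin D → ℂ := fun a b => (B.η a : ℂ) * B.η b * (B.patch p).u a b z
        * ricciGrad (B.patch p).G (B.patch p).U ((B.patch p).ξ a) ((B.patch p).ξ b) z with hF
    have h3 : ∑ a, ∑ b, F a b = (1 / 2 : ℂ) * (∑ a, ∑ b, F a b + ∑ a, ∑ b, F b a) := by
      rw [Finset.sum_comm (f := fun a b => F b a)]; ring
    rw [h3, ← Finset.sum_add_distrib, Finset.mul_sum]
    refine Finset.sum_congr rfl fun a _ => ?_
    rw [← Finset.sum_add_distrib, Finset.mul_sum]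
    refine Finset.sum_congr rfl fun b _ => ?_
    simp only [hF, PatchBrane.u_comm (P := B.patch p) hz b a]
    ring
  rw [hat_eq_ev, scalGF]
  simp only [map_smul, map_sub, map_mul, map_sum, smul_eq_mul, ev_e, ← hat_eq_ev, B.hat_ricF hz,
    B.hat_u hz, B.hat_τ hz, B.hat_ricGgGF hz, h2]
  change _ - ∑ a, ∑ b, ((B.patch p).η a : ℂ) * (B.patch p).η b * _ * _ = _
  rw [h]
  ring

/-- The density at q is computed in the preferred chart of q, which varies with q without any
continuity; identifying it with one global function is what makes it smooth. -/
theorem ricGgG_eq (q : M) : B.ricGgG q = ev q B.ricGgGF := by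
  rw [ev_eq_hat, B.hat_ricGgGF (chart_mem q), ← B.G_inv (chart_mem q)]; rfl

theorem scalG_eq (q : M) : B.scalG q = ev q B.scalGF := by
  rw [ev_eq_hat, B.hat_scalGF (chart_mem q)]; rfl

theorem ricg_eq (q : M) : B.ricg q = ev q B.ricgF := by
  have h := PatchBrane.ricci_gInv (P := B.patch q) (chart_mem q)
  rw [ricgF, map_sub, map_smul, map_mul, ← B.ricGgG_eq, ← B.scalG_eq, ev_eq_hat,
    B.hat_τ (chart_mem q), smul_eq_mul, ← mul_assoc, ricGgG]
  rw [← B.G_inv (chart_mem q)] at h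
  exact h

theorem pd_l (hz : z ∈ (chartAt E4 p).target) (m : Fin 4) : pd m (B.patch p).l z
    = (B.patch p).l z * pd m (fun y => (B.σc p y : ℂ)) z := by
  have hσ : DifferentiableAt ℝ (B.σc p) z :=
    ((PatchBrane.σ_smooth (P := B.patch p)).contDiffAt
      ((chartAt E4 p).open_target.mem_nhds hz)).differentiableAt (by simp)
  have := pd_exp (f := fun y => (B.σc p y : ℂ)) (y := z)
    (Complex.ofRealCLM.differentiableAt.comp z hσ) m
  rw [show (B.patch p).l = fun y => Complex.exp (B.σc p y : ℂ) from
    funext fun y => Complex.ofReal_exp _, this]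

theorem hat_l {p : M} : ∀ z ∈ (chartAt E4 p).target, hat p B.poisson.l z = (B.patch p).l z :=
  fun _ hz => B.ell_symm hz

theorem hat_inn_l (hz : z ∈ (chartAt E4 p).target) (f : smoothFunctions M) :
    hat p (B.poisson.inn f B.poisson.l) z = (B.patch p).l z
      * ∑ m, Patch.gradient (B.patch p).U (hat p f) z m * pd m (fun y => (B.σc p y : ℂ)) z := by
  rw [B.hat_inn hz, (B.patch p).metricOn.gradInner_comm hz, hat_congr_on B.hat_l hz, gradInner,
    Finset.mul_sum]
  refine Finset.sum_congr rfl fun m _ => ?_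
  rw [B.pd_l hz]
  ring

/-- `covDiv_gInv` turns the divergence of g⁻¹ into □x^a grad x_a, and the factor e^σ turns ∂σ into
∂e^σ, which belongs to the Poisson algebra. -/
theorem divgdσ_eq (q : M) : B.ell q * B.divgdσ q = -ev q (B.poisson.innLap B.poisson.l) := by
  have hz := chart_mem q
  have h := fun m => PatchBrane.covDiv_gInv (P := B.patch q) hz m
  have h1 : B.divgdσ q = ∑ m, covDiv (B.patch q).G (fun z => ((B.patch q).g z)⁻¹)
    (chartAt E4 q q) m * B.dσ q m := rfl
  have h2 : ∀ a, ev q (B.poisson.lap (B.poisson.x a))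
      = (B.patch q).lap ((B.patch q).ξ a) (chartAt E4 q q) :=
    fun a => (ev_eq_hat q _).trans (B.hat_lap hz _)
  have h3 : ∀ a, ev q (B.poisson.inn (B.poisson.x a) B.poisson.l)
      = (B.patch q).l (chartAt E4 q q) * ∑ m, Patch.gradient (B.patch q).U ((B.patch q).ξ a)
        (chartAt E4 q q) m * B.dσ q m :=
    fun a => (ev_eq_hat q _).trans (B.hat_inn_l hz _)
  have h4 : ∀ a, ((B.patch q).η a : ℂ) = B.η a := fun _ => rfl
  rw [h1, PoissonEmbedding.innLap, B.ell_eq (mem_chart_source E4 q)]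
  simp only [map_mul, map_sum, ev_e, h, h2, h3, h4]
  generalize (B.patch q).l (chartAt E4 q q) = l
  simp only [Finset.mul_sum, Finset.sum_mul, ← Finset.sum_neg_distrib]
  rw [Finset.sum_comm]
  exact Finset.sum_congr rfl fun a _ => Finset.sum_congr rfl fun m _ => by ring

theorem boxExp_eq (q : M) : B.ell q * B.boxExp q = ev q (B.poisson.lap B.poisson.l) := by
  have hz := chart_mem q
  have h1 : (B.patch q).lap (hat q B.poisson.l) (chartAt E4 q q)
      = (B.patch q).lap (B.patch q).l (chartAt E4 q q) := by
    refine (B.patch q).metricOn.divergence_congr hz fun w hw m => ?_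
    simp only [Patch.gradient, pd_congr_on (chartAt E4 q).open_target hw B.hat_l]
  rw [ev_eq_hat, B.hat_lap hz, h1, PatchBrane.lap,
    ← (B.patch q).metricOn.laplacian_eq hz PatchBrane.l_smooth, boxExp, ell, ← mul_assoc,
    ← Complex.ofReal_mul, ← Real.exp_add, add_neg_cancel, Real.exp_zero, Complex.ofReal_one, one_mul]
  rfl

end Brane

end

/-! ### Contractions through tangential components; the trace of h -/

section

open Patch

namespace PatchBrane

variable {D : ℕ} {P : PatchBrane D} {y : E4} {f k : E4 → ℂ}

/-- The tangential components of the second derivatives as symmetric matrices. -/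
def tangM (P : PatchBrane D) (y : E4) (i : Fin 4) : Mat4 := Matrix.of (P.tang y i)

/-- `∂_i ξ_a □_G ξ^a` -/
def trLap (P : PatchBrane D) (y : E4) (i : Fin 4) : ℂ := (P.U y * P.tangM y i).trace

/-- `∇_l h_{mn}` as a matrix in `m`, `n` -/
def nablah (P : PatchBrane D) (y : E4) (l : Fin 4) : Mat4 :=
  Matrix.of (covDeriv P.G (fun z => P.G z - P.g z) y l)

/-- The differential of a function, as a vector of components. -/
def dvec (f : E4 → ℂ) (y : E4) (i : Fin 4) : ℂ := pd i f y

/-- The matrix u is built from tangent vectors, so contracting with it sees only the tangential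
parts of X and Y. This keeps the extrinsic curvature, which is not small, out of the remainders. -/
theorem sum_u_mul (X Y : Fin D → ℂ) (y : E4) :
    ∑ a, ∑ b, (P.η a : ℂ) * P.η b * (P.u a b y * (X a * Y b))
      = ∑ k, ∑ l, P.U y k l * ((∑ a, (P.η a : ℂ) * (pd k (P.ξ a) y * X a))
        * ∑ b, (P.η b : ℂ) * (pd l (P.ξ b) y * Y b)) := by
  simp only [u, gradInner_eq, Finset.mul_sum, Finset.sum_mul]
  have : ∀ F : Fin D → Fin D → Fin 4 → Fin 4 → ℂ, ∑ a, ∑ b, ∑ m, ∑ j, F a b m j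
      = ∑ m, ∑ j, ∑ a, ∑ b, F a b m j := by
    intro F
    rw [Finset.sum_congr rfl fun a _ => Finset.sum_comm, Finset.sum_comm]
    refine Finset.sum_congr rfl fun m _ => ?_
    rw [Finset.sum_congr rfl fun a _ => Finset.sum_comm, Finset.sum_comm]
  rw [this]
  refine Finset.sum_congr rfl fun k _ => Finset.sum_congr rfl fun l _ => ?_
  rw [Finset.sum_comm]
  exact Finset.sum_congr rfl fun b _ => Finset.sum_congr rfl fun a _ => by ring

theorem trLap_eq (hy : y ∈ P.Ω) (i : Fin 4) :
    ∑ a, (P.η a : ℂ) * (pd i (P.ξ a) y * P.lap (P.ξ a) y) = P.trLap y i := by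
  rw [sum_pd_lap hy, trLap, Matrix.trace]
  simp only [Matrix.diag_apply, Matrix.mul_apply, tangM, Matrix.of_apply]
  exact Finset.sum_congr rfl fun l _ => Finset.sum_congr rfl fun n _ => by rw [tang_symm hy]

theorem gradInner_dvec (f k : E4 → ℂ) (y : E4) :
    gradInner P.U f k y = dvec f y ⬝ᵥ (P.U y).mulVec (dvec k y) := by
  simp only [gradInner_eq, dotProduct, Matrix.mulVec, Finset.mul_sum, dvec]
  exact Finset.sum_congr rfl fun m _ => Finset.sum_congr rfl fun n _ => by ring

/-- `u^{ab} □ξ_a □ξ_b` -/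
theorem sum_u_lap_lap (hy : y ∈ P.Ω) :
    ∑ a, ∑ b, (P.η a : ℂ) * P.η b * (P.u a b y * (P.lap (P.ξ a) y * P.lap (P.ξ b) y))
      = P.trLap y ⬝ᵥ (P.U y).mulVec (P.trLap y) := by
  rw [sum_u_mul]
  simp only [trLap_eq hy, dotProduct, Matrix.mulVec, Finset.mul_sum]
  exact Finset.sum_congr rfl fun m _ => Finset.sum_congr rfl fun n _ => by ring

theorem sum_lap_gradInner (hy : y ∈ P.Ω) (f : E4 → ℂ) :
    ∑ a, (P.η a : ℂ) * (P.lap (P.ξ a) y * gradInner P.U (P.ξ a) f y)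
      = dvec f y ⬝ᵥ (P.U y).mulVec (P.trLap y) := by
  simp only [← trLap_eq hy, dotProduct, Matrix.mulVec, Finset.mul_sum, gradInner_eq, dvec]
  rw [Finset.sum_comm]
  refine (Finset.sum_congr rfl fun m _ => Finset.sum_comm).trans ?_
  rw [Finset.sum_comm]
  refine Finset.sum_congr rfl fun m _ => Finset.sum_congr rfl fun n _ =>
    Finset.sum_congr rfl fun a _ => ?_
  rw [P.metricOn.symm_inv y hy n m]
  ring

theorem sum_u_lap_gradInner (hy : y ∈ P.Ω) (f : E4 → ℂ) :
    ∑ a, ∑ b, (P.η a : ℂ) * P.η b * (P.u a b y * (P.lap (P.ξ b) y * gradInner P.U (P.ξ a) f y))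
      = dvec f y ⬝ᵥ (P.U y * P.g y * P.U y).mulVec (P.trLap y) := by
  have h1 := sum_u_mul (P := P) (fun a => gradInner P.U (P.ξ a) f y) (fun b => P.lap (P.ξ b) y) y
  simp only [mul_comm (gradInner _ _ _ _) (P.lap _ _)] at h1
  have h2 : ∀ k, ∑ a, (P.η a : ℂ) * (pd k (P.ξ a) y * gradInner P.U (P.ξ a) f y)
      = (P.g y * P.U y).mulVec (dvec f y) k := by
    intro k
    simp only [gradInner_eq, Matrix.mulVec, dotProduct, Matrix.mul_apply, g, inducedMetric,
      Matrix.of_apply, Finset.mul_sum, Finset.sum_mul, dvec]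
    rw [Finset.sum_comm]
    refine (Finset.sum_congr rfl fun m _ => Finset.sum_comm).trans ?_
    rw [Finset.sum_comm]
    exact Finset.sum_congr rfl fun m _ => Finset.sum_congr rfl fun n _ =>
      Finset.sum_congr rfl fun a _ => by ring
  rw [h1]
  simp only [trLap_eq hy, h2]
  have h3 : ∑ k, ∑ l, P.U y k l * ((P.g y * P.U y).mulVec (dvec f y) k * P.trLap y l)
      = (P.g y * P.U y).mulVec (dvec f y) ⬝ᵥ (P.U y).mulVec (P.trLap y) := by
    generalize (P.g y * P.U y).mulVec (dvec f y) = v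
    simp only [dotProduct, Matrix.mulVec, Finset.mul_sum]
    exact Finset.sum_congr rfl fun m _ => Finset.sum_congr rfl fun n _ => by ring
  rw [h3, ← Matrix.vecMul_transpose, Matrix.transpose_mul, U_symm, g_symm, ← Matrix.dotProduct_mulVec,
    Matrix.mulVec_mulVec]

/-- `sum_u_mul` entry by entry: the squared Hessians left over from Bochner's formula become
quadratic in the tangential components, hence in ∇h. -/
theorem sum_u_hessInner (hy : y ∈ P.Ω) :
    ∑ a, ∑ b, (P.η a : ℂ) * P.η b * (P.u a b y * hessInner P.G P.U (P.ξ a) (P.ξ b) y)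
      = ∑ k, ∑ l, P.U y k l * (P.tangM y k * P.U y * (P.tangM y l * P.U y)).trace := by
  have h1 : ∀ a b, hessInner P.G P.U (P.ξ a) (P.ξ b) y = ∑ i, ∑ j,
      (Matrix.of (hessian P.G (P.ξ a) y) * P.U y) i j
        * (Matrix.of (hessian P.G (P.ξ b) y) * P.U y) j i := by
    intro a b
    have h : ∀ a l m, covDerivVec P.G (gradient P.U (P.ξ a)) y l m
        = (Matrix.of (hessian P.G (P.ξ a) y) * P.U y) l m := by
      intro a l m
      rw [P.metricOn.covDerivVec_gradient hy (P.ξ_smooth a), Matrix.mul_apply]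
      exact Finset.sum_congr rfl fun n _ => by
        rw [Matrix.of_apply, P.metricOn.symm_inv y hy m n, mul_comm]
    simp only [hessInner, h]
  have h2 : ∀ k i j, ∑ a, (P.η a : ℂ) * (pd k (P.ξ a) y
      * (Matrix.of (hessian P.G (P.ξ a) y) * P.U y) i j) = (P.tangM y k * P.U y) i j := by
    intro k i j
    simp only [Matrix.mul_apply, tangM, tang, Matrix.of_apply, Finset.mul_sum, Finset.sum_mul]
    rw [Finset.sum_comm]
    exact Finset.sum_congr rfl fun a _ => Finset.sum_congr rfl fun n _ => by ring
  have h3 : ∀ i j, _ := fun i j => sum_u_mul (P := P)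
    (fun a => (Matrix.of (hessian P.G (P.ξ a) y) * P.U y) i j)
    (fun a => (Matrix.of (hessian P.G (P.ξ a) y) * P.U y) j i) y
  simp only [h2] at h3
  have h4 : ∀ {α β : Type} [Fintype α] [Fintype β] (F : α → α → β → β → ℂ),
      ∑ a, ∑ b, ∑ m, ∑ j, F a b m j = ∑ m, ∑ j, ∑ a, ∑ b, F a b m j := by
    intro α β _ _ F
    rw [Finset.sum_congr rfl fun a _ => Finset.sum_comm, Finset.sum_comm]
    refine Finset.sum_congr rfl fun m _ => ?_
    rw [Finset.sum_congr rfl fun a _ => Finset.sum_comm, Finset.sum_comm]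
  simp only [h1, Finset.mul_sum]
  rw [h4]
  simp only [h3]
  rw [h4]
  refine Finset.sum_congr rfl fun k _ => Finset.sum_congr rfl fun l _ => ?_
  rw [Matrix.trace]
  simp only [Matrix.diag_apply, Matrix.mul_apply (M := P.tangM y k * P.U y), Finset.mul_sum]

/-! ### The trace of `h` -/

/-- The matrix of partial derivatives of the entries. -/
def dMat (j : Fin 4) (A : E4 → Mat4) (y : E4) : Mat4 := Matrix.of fun m n => pd j (fun z => A z m n) y

theorem dMat_mul {A B : E4 → Mat4} (hA : ∀ m n, DifferentiableAt ℝ (fun z => A z m n) y)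
    (hB : ∀ m n, DifferentiableAt ℝ (fun z => B z m n) y) (j : Fin 4) :
    dMat j (fun z => A z * B z) y = A y * dMat j B y + dMat j A y * B y := by
  ext m n
  simp only [dMat, Matrix.of_apply, Matrix.mul_apply, Matrix.add_apply]
  rw [pd_sum fun k _ => (hA m k).fun_mul (hB k n), ← Finset.sum_add_distrib]
  exact Finset.sum_congr rfl fun k _ => pd_mul (hA m k) (hB k n) j

theorem pd_trace {A : E4 → Mat4} (hA : ∀ m n, DifferentiableAt ℝ (fun z => A z m n) y) (j : Fin 4) :
    pd j (fun z => (A z).trace) y = (dMat j A y).trace := by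
  simp only [Matrix.trace, Matrix.diag_apply, dMat, Matrix.of_apply]
  exact pd_sum (fun k _ => hA k k) j

/-- The deviation `h = G - g`. -/
def h (P : PatchBrane D) (y : E4) : Mat4 := P.G y - P.g y

theorem U_mul_G (hy : y ∈ P.Ω) : P.U y * P.G y = 1 :=
  mul_eq_one_comm.1 (G_mul_U hy)

theorem g_eq_sub (y : E4) : P.g y = P.G y - P.h y := by rw [h, sub_sub_cancel]

theorem trace_h (hy : y ∈ P.Ω) : (P.U y * P.h y).trace = 4 - P.τ y := by
  rw [h, Matrix.mul_sub, U_mul_G hy, Matrix.trace_sub, Matrix.trace_one]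
  rfl

/-- Expanding (Uh)² = (1 - Ug)² and inserting `τ_sq`. By `trace_h` the factor 4 - τ is the trace of
Uh, which is thereby of second order in h as long as τ stays away from 0. -/
theorem trace_h_sq (hy : y ∈ P.Ω) :
    2 * (P.U y * P.h y * (P.U y * P.h y)).trace = -(P.τ y * (4 - P.τ y)) := by
  have h1 := τ_sq hy
  rw [h, Matrix.mul_sub, U_mul_G hy]
  simp only [Matrix.mul_sub, Matrix.sub_mul, Matrix.trace_sub, Matrix.mul_one, Matrix.one_mul,
    Matrix.trace_one, h1]
  rw [show (P.U y * P.g y).trace = P.τ y from rfl]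
  simp
  ring

/-- Two expressions for dτ are compared: from τ = tr Ug it is -tr(U∇h), from `τ_sq` τ dτ is -2
tr(U∇hUg). With Ug = 1 - Uh the difference leaves a product of h and ∇h. -/
theorem pd_τ (hy : y ∈ P.Ω) (j : Fin 4) :
    (P.τ y - 2) * pd j P.τ y = 2 * (P.U y * P.nablah y j * (P.U y * P.h y)).trace := by
  set Γ : Mat4 := Matrix.of fun k m => christoffel P.G y k j m with hΓ
  have hU := fun m n => (U_smooth (P := P) m n).differentiableAt P.isOpen hy
  have hg := fun m n => (g_smooth (P := P) m n).differentiableAt P.isOpen hy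
  have hUg := fun m n =>
    (mul_smooth (U_smooth (P := P)) (g_smooth (P := P)) m n).differentiableAt P.isOpen hy
  have e1 : dMat j P.U y = -(Γ * P.U y + P.U y * Γ.transpose) := by
    ext m n
    rw [dMat, Matrix.of_apply, P.metricOn.compat_inv hy]
    simp only [Matrix.neg_apply, Matrix.add_apply, Matrix.mul_apply, Matrix.transpose_apply, hΓ,
      Matrix.of_apply, mul_comm (P.U y m _)]
  have e2 : dMat j P.g y = -P.nablah y j + Γ.transpose * P.g y + P.g y * Γ := by
    ext m n
    have h1 : pd j (fun z => P.G z m n - P.g z m n) y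
        = pd j (fun z => P.G z m n) y - pd j (fun z => P.g z m n) y :=
      pd_sub ((G_smooth m n).differentiableAt P.isOpen hy) (hg m n) j
    simp only [dMat, Matrix.neg_apply, Matrix.add_apply, Matrix.mul_apply, Matrix.transpose_apply,
      hΓ, Matrix.of_apply, nablah, covDeriv, Matrix.sub_apply, mul_sub,
      Finset.sum_sub_distrib, mul_comm (P.g y m _)]
    rw [h1, P.metricOn.compat hy]
    ring
  -- The Christoffel symbols enter through a commutator, which drops out of the traces below.
  have e3 : dMat j (fun z => P.U z * P.g z) y
      = -(P.U y * P.nablah y j) + (P.U y * P.g y * Γ - Γ * (P.U y * P.g y)) := by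
    rw [dMat_mul hU hg, e1, e2]
    noncomm_ring
  have t1 : pd j P.τ y = -(P.U y * P.nablah y j).trace := by
    refine (pd_trace hUg j).trans ?_
    rw [e3, Matrix.trace_add, Matrix.trace_sub, Matrix.trace_mul_comm _ Γ, sub_self, add_zero,
      Matrix.trace_neg]
  have t2 : P.τ y * pd j P.τ y = -2 * (P.U y * P.nablah y j * (P.U y * P.g y)).trace := by
    have h0 : ∀ z ∈ P.Ω, (P.U z * P.g z * (P.U z * P.g z)).trace = (1 / 2 : ℂ) * (P.τ z * P.τ z) - 4 :=
      fun z hz => by rw [τ_sq hz, sq]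
    have h1 := pd_congr_on P.isOpen hy h0 j
    have hτ := τ_smooth.differentiableAt P.isOpen hy
    have hUgUg := fun m n => (mul_smooth (mul_smooth (U_smooth (P := P)) (g_smooth (P := P)))
      (mul_smooth (U_smooth (P := P)) (g_smooth (P := P))) m n).differentiableAt P.isOpen hy
    rw [pd_trace hUgUg, dMat_mul hUg hUg, e3,
      pd_sub ((hτ.fun_mul hτ).const_mul _) (differentiableAt_const _), pd_const,
      pd_const_mul (hτ.fun_mul hτ), pd_mul hτ hτ, Matrix.trace_add, Matrix.trace_mul_comm,
      Matrix.add_mul, Matrix.sub_mul, Matrix.trace_add, Matrix.trace_sub,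
      Matrix.trace_mul_comm (P.U y * P.g y * Γ), ← Matrix.mul_assoc (P.U y * P.g y),
      Matrix.trace_mul_comm _ Γ, ← Matrix.mul_assoc Γ, sub_self, Matrix.neg_mul,
      Matrix.trace_neg] at h1
    linear_combination -h1
  have t3 : (P.U y * P.nablah y j * (P.U y * P.g y)).trace
      = (P.U y * P.nablah y j).trace - (P.U y * P.nablah y j * (P.U y * P.h y)).trace := by
    rw [g_eq_sub, Matrix.mul_sub, U_mul_G hy, Matrix.mul_sub, Matrix.mul_one, Matrix.trace_sub]
  linear_combination t2 - 2 * t1 - 2 * t3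

end PatchBrane

end

/-! ### Bounds in frames that are orthonormal for g -/

section

open Patch Matrix

/-! ### Entrywise bounds -/

/-- All entries of a matrix are bounded by `a`. -/
def EntryLE (A : Mat4) (a : ℝ) : Prop := ∀ i j, ‖A i j‖ ≤ a

theorem EntryLE.nonneg {A : Mat4} {a : ℝ} (h : EntryLE A a) : 0 ≤ a := (norm_nonneg _).trans (h 0 0)

theorem norm_sum_le_four {x : Fin 4 → ℂ} {a : ℝ} (h : ∀ i, ‖x i‖ ≤ a) : ‖∑ i, x i‖ ≤ 4 * a := by
  have := norm_sum_le_of_le Finset.univ (f := x) (n := fun _ => a) fun i _ => h i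
  simpa using this

theorem EntryLE.mul {A B : Mat4} {a b : ℝ} (hA : EntryLE A a) (hB : EntryLE B b) :
    EntryLE (A * B) (4 * (a * b)) := fun i j => by
  rw [mul_apply]
  exact norm_sum_le_four fun k => (norm_mul_le _ _).trans
    (mul_le_mul (hA i k) (hB k j) (norm_nonneg _) hA.nonneg)

theorem EntryLE.trace {A : Mat4} {a : ℝ} (hA : EntryLE A a) : ‖A.trace‖ ≤ 4 * a :=
  norm_sum_le_four fun i => hA i i

theorem EntryLE.dot {A : Mat4} {a b c : ℝ} {v w : Fin 4 → ℂ} (hA : EntryLE A a)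
    (hv : ∀ i, ‖v i‖ ≤ b) (hw : ∀ i, ‖w i‖ ≤ c) : ‖v ⬝ᵥ A.mulVec w‖ ≤ 16 * (b * a * c) := by
  have hb : 0 ≤ b := (norm_nonneg _).trans (hv 0)
  have hA' : ∀ i, ‖A.mulVec w i‖ ≤ 4 * (a * c) := fun i => norm_sum_le_four fun j =>
    (norm_mul_le _ _).trans (mul_le_mul (hA i j) (hw j) (norm_nonneg _) hA.nonneg)
  have := norm_sum_le_four (x := fun i => v i * A.mulVec w i) fun i =>
    (norm_mul_le _ _).trans (mul_le_mul (hv i) (hA' i) (norm_nonneg _) hb)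
  calc _ ≤ _ := this
    _ = _ := by ring

theorem EntryLE.sum_mul {A B : Mat4} {a b : ℝ} (hA : EntryLE A a) (hB : EntryLE B b) :
    ‖∑ i, ∑ j, A i j * B i j‖ ≤ 16 * (a * b) := by
  have := norm_sum_le_four (x := fun i => ∑ j, A i j * B i j) fun i => norm_sum_le_four fun j =>
    (norm_mul_le _ _).trans (mul_le_mul (hA i j) (hB i j) (norm_nonneg _) hA.nonneg)
  calc _ ≤ _ := this
    _ = _ := by ring

/-! ### Components in a frame -/

/-- The components of a covector in a frame. -/
def frame1 (F : Mat4) (v : Fin 4 → ℂ) (i : Fin 4) : ℂ := ∑ m, v m * F m i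

/-- The components of a covariant tensor of rank two in a frame. -/
def frame2 (F A : Mat4) : Mat4 :=
  Matrix.of fun i j => ∑ m, ∑ n, A m n * F m i * F n j

/-- The components of a covariant tensor of rank three in a frame. -/
def frame3 (F : Mat4) (X : Fin 4 → Mat4) (k : Fin 4) : Mat4 :=
  Matrix.of fun i j => ∑ l, ∑ m, ∑ n, X l m n * F l k * F m i * F n j

theorem frame1_eq (F : Mat4) (v : Fin 4 → ℂ) : frame1 F v = F.transpose.mulVec v := by
  ext i; exact Finset.sum_congr rfl fun m _ => mul_comm _ _

theorem frame2_eq (F A : Mat4) : frame2 F A = F.transpose * A * F := by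
  ext i j
  simp only [frame2, of_apply, mul_apply, transpose_apply, Finset.sum_mul]
  rw [Finset.sum_comm]
  exact Finset.sum_congr rfl fun m _ => Finset.sum_congr rfl fun n _ => by ring

theorem frame3_eq (F : Mat4) (X : Fin 4 → Mat4) (k : Fin 4) :
    frame3 F X k = ∑ l, F l k • (F.transpose * X l * F) := by
  ext i j
  simp only [← frame2_eq, Matrix.sum_apply, Matrix.smul_apply, smul_eq_mul, frame2, frame3,
    of_apply, Finset.mul_sum]
  exact Finset.sum_congr rfl fun _ _ => Finset.sum_congr rfl fun _ _ =>
    Finset.sum_congr rfl fun _ _ => by ring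

/-- Once U is written as F V Fᵀ, contractions with U become contractions of frame components with
the bounded matrix V; the next lemmas do the same for other tensor types. -/
theorem dot_frame (F A : Mat4) (v w : Fin 4 → ℂ) :
    v ⬝ᵥ (F * A * F.transpose).mulVec w = frame1 F v ⬝ᵥ A.mulVec (frame1 F w) := by
  rw [frame1_eq, frame1_eq, Matrix.mulVec_transpose F v, ← Matrix.dotProduct_mulVec,
    mulVec_mulVec, mulVec_mulVec, Matrix.mul_assoc]

theorem sum_mul_frame (F A : Mat4) (R : Mat4) :
    ∑ m, ∑ n, R m n * (F * A * F.transpose) m n = ∑ i, ∑ j, frame2 F R i j * A i j := by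
  simp only [frame2, of_apply, mul_apply, transpose_apply, Finset.sum_mul, Finset.mul_sum]
  have : ∀ X : Fin 4 → Fin 4 → Fin 4 → Fin 4 → ℂ, ∑ a, ∑ b, ∑ m, ∑ j, X a b m j
      = ∑ j, ∑ m, ∑ a, ∑ b, X a b m j := by
    intro X
    rw [Finset.sum_congr rfl fun a _ => Finset.sum_comm, Finset.sum_comm]
    rw [Finset.sum_congr rfl fun m _ => Finset.sum_congr rfl fun a _ => Finset.sum_comm,
      Finset.sum_congr rfl fun m _ => Finset.sum_comm, Finset.sum_comm]
  rw [this]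
  exact Finset.sum_congr rfl fun i _ => Finset.sum_congr rfl fun j _ =>
    Finset.sum_congr rfl fun m _ => Finset.sum_congr rfl fun n _ => by ring

theorem trace_frame (F A X : Mat4) :
    (F * A * F.transpose * X).trace = (A * (F.transpose * X * F)).trace := by
  rw [Matrix.mul_assoc F, Matrix.mul_assoc F, trace_mul_comm]
  simp only [Matrix.mul_assoc]

theorem frame1_trace (F A : Mat4) (X : Fin 4 → Mat4) (k : Fin 4) :
    frame1 F (fun l => (F * A * F.transpose * X l).trace) k
      = (A * frame3 F X k).trace := by
  simp only [frame1, trace_frame, frame3_eq, Matrix.mul_sum, Matrix.mul_smul, trace_sum, trace_smul,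
    smul_eq_mul, mul_comm]

namespace PatchBrane

variable {D : ℕ} {P : PatchBrane D} {y : E4} {F V E : Mat4} {a b : ℝ}

/-- The inverse effective metric in a frame that is orthonormal for `g` has bounded entries. -/
theorem exists_frame (hy : y ∈ P.Ω) {ε : Fin 4 → ℝ} (hε : ∀ i, ε i = 1 ∨ ε i = -1)
    (hF : F.transpose * P.g y * F = Matrix.diagonal fun i => (ε i : ℂ))
    (hh : EntryLE (frame2 F (P.h y)) a) (ha : a ≤ 1 / 100) :
    ∃ V : Mat4, P.U y = F * V * F.transpose ∧ EntryLE V 2 := by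
  set E : Mat4 := Matrix.diagonal fun i => (ε i : ℂ) with hE
  have hEE : E * E = 1 := by
    rw [hE, diagonal_mul_diagonal, ← diagonal_one]
    congr 1
    ext i
    rcases hε i with h | h <;> simp [h]
  have hE1 : EntryLE E 1 := fun i j => by
    rw [hE, diagonal_apply]
    split_ifs
    · rcases hε i with h | h <;> simp [h]
    · simp
  obtain ⟨K, hFK⟩ : ∃ K : Mat4, F * K = 1 := by
    have h1 : (E * F.transpose * P.g y) * F = 1 := by
      rw [Matrix.mul_assoc, Matrix.mul_assoc, ← Matrix.mul_assoc F.transpose, hF, hEE]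
    exact ⟨_, mul_eq_one_comm.1 h1⟩
  have hKF : K * F = 1 := mul_eq_one_comm.1 hFK
  refine ⟨K * P.U y * K.transpose, ?_, ?_⟩
  · have : F * (K * P.U y * K.transpose) * F.transpose
        = (F * K) * P.U y * (F * K).transpose := by
      rw [transpose_mul]; simp only [Matrix.mul_assoc]
    rw [this, hFK]; simp
  · set V := K * P.U y * K.transpose with hV
    have hVG : V * (E + frame2 F (P.h y)) = 1 := by
      rw [frame2_eq, ← hF, ← Matrix.add_mul, ← Matrix.mul_add, PatchBrane.h, add_sub_cancel]
      have : V * (F.transpose * P.G y * F) = K * (P.U y * ((F * K).transpose * P.G y)) * F := by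
        rw [hV, transpose_mul]; simp only [Matrix.mul_assoc]
      rw [this, hFK, transpose_one, Matrix.one_mul, U_mul_G hy, Matrix.mul_one, hKF]
    -- In the frame G has components E + h, so its inverse satisfies a fixed point equation. For the
    -- largest entry m of V it gives m ≤ 1 + 16ma with a ≤ 1/100, hence m ≤ 2.
    have hV2 : V = E - V * frame2 F (P.h y) * E := by
      have := congrArg (· * E) hVG
      simp only [Matrix.mul_add, Matrix.add_mul, Matrix.one_mul, Matrix.mul_assoc V E, hEE,
        Matrix.mul_one] at this
      exact eq_sub_of_add_eq this
    obtain ⟨⟨i₀, j₀⟩, hm⟩ := Finite.exists_max fun p : Fin 4 × Fin 4 => ‖V p.1 p.2‖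
    have hVm : EntryLE V ‖V i₀ j₀‖ := fun i j => hm (i, j)
    have h1 := ((hVm.mul hh).mul hE1) i₀ j₀
    have h2 : ‖V i₀ j₀‖ ≤ 1 + 4 * (4 * (‖V i₀ j₀‖ * a) * 1) := by
      conv_lhs => rw [hV2]
      exact (norm_sub_le _ _).trans (add_le_add (hE1 i₀ j₀) h1)
    have h3 : ‖V i₀ j₀‖ * a ≤ ‖V i₀ j₀‖ * (1 / 100) :=
      mul_le_mul_of_nonneg_left ha (norm_nonneg _)
    exact fun i j => (hVm i j).trans (by linarith)

section

variable (hy : y ∈ P.Ω) (hU : P.U y = F * V * F.transpose) (hV : EntryLE V 2)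
  (hh : EntryLE (frame2 F (P.h y)) a) (ha : a ≤ 1 / 100)
  (hN : ∀ k, EntryLE (frame3 F (P.nablah y) k) b)

include hU hV hh in
theorem frame_Uh : P.U y * P.h y * P.U y = F * (V * frame2 F (P.h y) * V) * F.transpose
    ∧ EntryLE (V * frame2 F (P.h y) * V) (64 * a) := by
  constructor
  · rw [hU, frame2_eq]; simp only [Matrix.mul_assoc]
  · intro i j
    exact (((hV.mul hh).mul hV) i j).trans_eq (by ring)

include hy hU hV hh ha in
-- The trace of Uh gives the crude bound 32a, which keeps |τ| above 2; then `trace_h_sq` improves it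
-- to second order.
theorem norm_four_sub_τ : ‖4 - P.τ y‖ ≤ 1024 * a ^ 2 := by
  have h1 : 4 - P.τ y = (V * frame2 F (P.h y)).trace := by
    rw [← trace_h hy, hU, trace_frame, ← frame2_eq]
  have h2 := trace_h_sq hy
  have h3 : (P.U y * P.h y * (P.U y * P.h y)).trace
      = (V * frame2 F (P.h y) * (V * frame2 F (P.h y))).trace := by
    rw [hU, Matrix.mul_assoc (F * V * F.transpose), trace_frame, frame2_eq]
    simp only [Matrix.mul_assoc]
  have e1 := (hV.mul hh).trace
  have e2 := ((hV.mul hh).mul (hV.mul hh)).trace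
  rw [← h1] at e1
  rw [← h3] at e2
  have h4 : ‖P.τ y‖ * ‖4 - P.τ y‖ = 2 * ‖(P.U y * P.h y * (P.U y * P.h y)).trace‖ := by
    rw [← norm_mul, ← norm_neg, ← h2, norm_mul]; simp
  have h5 : 4 - ‖4 - P.τ y‖ ≤ ‖P.τ y‖ := by
    have := norm_sub_norm_le (4 : ℂ) (4 - P.τ y)
    simpa using this
  have h6 := norm_nonneg (4 - P.τ y)
  nlinarith [hh.nonneg]

include hy hN in
-- The formula `tang_eq` is tensorial, so it holds for frame components; three terms with weight ½
-- are within 2b.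
theorem frame_tang (k : Fin 4) : EntryLE (frame3 F (P.tangM y) k) (2 * b) := by
  have h : ∀ i j, frame3 F (P.tangM y) k i j = -(1 / 2 : ℂ) *
      (frame3 F (P.nablah y) i j k + frame3 F (P.nablah y) j i k
        - frame3 F (P.nablah y) k i j) := by
    intro i j
    simp only [frame3, of_apply, tangM, tang_eq hy]
    have h1 : ∑ l, ∑ m, ∑ n, P.nablah y l m n * F l i * F m j * F n k
        = ∑ l, ∑ m, ∑ n, P.nablah y m n l * F m i * F n j * F l k := by
      rw [Finset.sum_congr rfl fun l _ => Finset.sum_comm]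
      rw [Finset.sum_comm]
    have h2 : ∑ l, ∑ m, ∑ n, P.nablah y l m n * F l j * F m i * F n k
        = ∑ l, ∑ m, ∑ n, P.nablah y n m l * F n j * F m i * F l k := by
      rw [Finset.sum_comm]
      rw [Finset.sum_congr rfl fun l _ => Finset.sum_comm]
      rw [Finset.sum_comm]
    rw [h1, h2]
    simp only [← Finset.sum_add_distrib, ← Finset.sum_sub_distrib, Finset.mul_sum]
    refine Finset.sum_congr rfl fun l _ => Finset.sum_congr rfl fun m _ =>
      Finset.sum_congr rfl fun n _ => ?_
    simp only [nablah, of_apply]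
    ring
  intro i j
  rw [h, norm_mul]
  have e1 := norm_sub_le (frame3 F (P.nablah y) i j k
    + frame3 F (P.nablah y) j i k) (frame3 F (P.nablah y) k i j)
  have e2 := norm_add_le (frame3 F (P.nablah y) i j k)
    (frame3 F (P.nablah y) j i k)
  have e3 := hN i j k
  have e4 := hN j i k
  have e5 := hN k i j
  have e6 : ‖(-(1 / 2) : ℂ)‖ = 1 / 2 := by norm_num
  rw [e6]
  linarith [(hN 0).nonneg]

include hy hU hV hN in
theorem frame_trLap (k : Fin 4) : ‖frame1 F (P.trLap y) k‖ ≤ 64 * b := by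
  have h : P.trLap y = fun l => (F * V * F.transpose * P.tangM y l).trace := by
    ext l; rw [trLap, hU]
  rw [h, frame1_trace]
  exact ((hV.mul (frame_tang hy hN k)).trace).trans_eq (by ring)

include hy hU hV hh ha hN in
-- By `pd_τ`, after dividing by τ - 2, whose modulus is at least 1 since τ is close to 4.
theorem frame_dτ (k : Fin 4) : ‖frame1 F (dvec P.τ y) k‖ ≤ 2048 * (a * b) := by
  have h1 : (P.τ y - 2) * frame1 F (dvec P.τ y) k
      = 2 * (V * frame3 F (P.nablah y) k * (V * frame2 F (P.h y))).trace := by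
    have h2 : ∀ l, (P.U y * P.nablah y l * (P.U y * P.h y)).trace
        = (F * (V * frame2 F (P.h y) * V) * F.transpose * P.nablah y l).trace := by
      intro l
      rw [trace_mul_comm, ← (frame_Uh hU hV hh).1]
      simp only [Matrix.mul_assoc]
    have h3 : (P.τ y - 2) * frame1 F (dvec P.τ y) k = 2 * frame1 F (fun l => (F * (V *
        frame2 F (P.h y) * V) * F.transpose * P.nablah y l).trace) k := by
      simp only [frame1, dvec, Finset.mul_sum]
      exact Finset.sum_congr rfl fun l _ => by rw [← mul_assoc, pd_τ hy, h2, mul_assoc]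
    rw [h3, frame1_trace, trace_mul_comm (V * frame3 F (P.nablah y) k)]
    simp only [Matrix.mul_assoc]
  have h4 := norm_four_sub_τ hy hU hV hh ha
  have h5 := ((hV.mul (hN k)).mul (hV.mul hh)).trace
  have h6 : 1 ≤ ‖P.τ y - 2‖ := by
    have h7 := norm_sub_norm_le (2 : ℂ) (4 - P.τ y)
    rw [show (2 : ℂ) - (4 - P.τ y) = P.τ y - 2 by ring] at h7
    have h8 : ‖(2 : ℂ)‖ = 2 := by simp
    nlinarith [hh.nonneg]
  have h9 := congrArg norm h1
  rw [norm_mul, norm_mul] at h9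
  have h10 : ‖(2 : ℂ)‖ = 2 := by simp
  rw [h10] at h9
  nlinarith [norm_nonneg (frame1 F (dvec P.τ y) k)]

end

end PatchBrane

end

/-! ### The remainder terms: vanishing for G = g, and quadratic bounds -/

section

open Patch Matrix

namespace PatchBrane

variable {D : ℕ} (P : PatchBrane D) (v : Fin 4 → ℂ) (y : E4)

/-- The difference of the first matrix Lagrangian and its geometric form, up to a divergence and
the factor `e^{2σ}`, for `v = ∂σ`. -/
def errBare : ℂ :=
  -((4 - P.τ y) * ricciContract P.G (P.U y * P.g y * P.U y) y)
    + 2 * (∑ k, ∑ l, P.U y k l * (P.tangM y k * P.U y * (P.tangM y l * P.U y)).trace)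
    - 2 * (P.trLap y ⬝ᵥ (P.U y).mulVec (P.trLap y))
    + 2 * (v ⬝ᵥ (P.U y * P.h y * P.U y).mulVec (P.trLap y))
    + 1 / 2 * ((4 - P.τ y) * (v ⬝ᵥ (P.U y).mulVec (P.trLap y)))
    - 1 / 2 * (dvec P.τ y ⬝ᵥ (P.U y).mulVec (P.trLap y))
    + 1 / 2 * ((4 + P.τ y) * ((4 - P.τ y) * (v ⬝ᵥ (P.U y).mulVec v)))

/-- The same for the second matrix Lagrangian. -/
def errR : ℂ := 1 / 2 * P.errBare v y
    - 1 / 8 * ((4 + P.τ y) * ((4 - P.τ y) * (v ⬝ᵥ (P.U y).mulVec v)))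
    + 1 / 4 * (P.τ y * (v ⬝ᵥ (P.U y).mulVec (dvec P.τ y)))
    + 1 / 8 * (dvec P.τ y ⬝ᵥ (P.U y).mulVec (dvec P.τ y))
    - (4 - P.τ y) * scalarCurvature P.G y

/-- The same for the third matrix Lagrangian. -/
def errRtilde : ℂ := P.errR v y
    - 1 / 2 * ((4 - P.τ y) * (v ⬝ᵥ (P.U y).mulVec (P.trLap y)))
    + 1 / 2 * (dvec P.τ y ⬝ᵥ (P.U y).mulVec (P.trLap y))

variable {P v y}

theorem tangM_eq_zero (hG : ∀ z ∈ P.Ω, P.G z = P.g z) (hy : y ∈ P.Ω) (i : Fin 4) :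
    P.tangM y i = 0 := by
  have hN : ∀ l m n, covDeriv P.G (fun z => P.G z - P.g z) y l m n = 0 := by
    intro l m n
    have h1 : pd l (fun z => P.G z m n - P.g z m n) y = 0 := by
      rw [pd_congr_on P.isOpen hy (g := fun _ => 0) (fun z hz => by rw [hG z hz, sub_self]),
        pd_const]
    simp [covDeriv, h1, hG y hy]
  ext m n
  simp [tangM, tang_eq hy, hN]

theorem trLap_eq_zero (hG : ∀ z ∈ P.Ω, P.G z = P.g z) (hy : y ∈ P.Ω) : P.trLap y = 0 := by
  ext i; simp [trLap, tangM_eq_zero hG hy]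

/-- Each term has a factor among h, 4 - τ, dτ and the tangential components, and all of these vanish
when G and g agree on the patch. -/
theorem err_eq_zero (hG : ∀ z ∈ P.Ω, P.G z = P.g z) (hy : y ∈ P.Ω) :
    P.errBare v y = 0 ∧ P.errR v y = 0 ∧ P.errRtilde v y = 0 := by
  have hh : P.h y = 0 := by rw [h, hG y hy, sub_self]
  have hT := tangM_eq_zero hG hy
  have hL := trLap_eq_zero hG hy
  have hτ : P.τ y = 4 := by
    have := trace_h hy
    rw [hh, Matrix.mul_zero, trace_zero] at this
    linear_combination this
  have hdτ : dvec P.τ y = 0 := by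
    ext j
    have := pd_τ hy j
    rw [hh, Matrix.mul_zero, Matrix.mul_zero, trace_zero, hτ] at this
    rw [dvec, Pi.zero_apply]
    linear_combination this / 2
  have h0 : P.errBare v y = 0 := by simp [errBare, hh, hT, hL, hτ, hdτ]
  have h1 : P.errR v y = 0 := by simp [errR, h0, hτ, hdτ]
  exact ⟨h0, h1, by simp [errRtilde, h1, hL, hτ, hdτ]⟩

end PatchBrane

/-- `z` is bounded by `K` times `W`. -/
def BoundedBy (W K : ℝ) (z : ℂ) : Prop := ‖z‖ ≤ K * W

namespace BoundedBy

variable {W K L : ℝ} {z w : ℂ}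

theorem add (hz : BoundedBy W K z) (hw : BoundedBy W L w) : BoundedBy W (K + L) (z + w) :=
  (norm_add_le _ _).trans ((add_le_add hz hw).trans_eq (by ring))

theorem sub (hz : BoundedBy W K z) (hw : BoundedBy W L w) : BoundedBy W (K + L) (z - w) :=
  (norm_sub_le _ _).trans ((add_le_add hz hw).trans_eq (by ring))

theorem neg (hz : BoundedBy W K z) : BoundedBy W K (-z) := by
  rw [BoundedBy, norm_neg]; exact hz

theorem mul {c : ℂ} {M : ℝ} (hc : ‖c‖ ≤ M) (hz : BoundedBy W K z) : BoundedBy W (M * K) (c * z) := by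
  rw [BoundedBy, norm_mul, mul_assoc]
  exact mul_le_mul hc hz (norm_nonneg _) ((norm_nonneg _).trans hc)

theorem mono (hz : BoundedBy W K z) (hW : 0 ≤ W) (h : K ≤ L) : BoundedBy W L z :=
  le_trans hz (mul_le_mul_of_nonneg_right h hW)

end BoundedBy

namespace PatchBrane

variable {D : ℕ} {P : PatchBrane D} {v : Fin 4 → ℂ} {y : E4} {F V E : Mat4} {a b s r : ℝ}

/-- Counting orders: h counts a, tangential second derivatives b, 4 - τ counts a², dτ counts ab.
Every term then has one of the weights a²r, a²s², abs, b², ab², a²b², and each of these is dominated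
by the error density. -/
theorem err_bound (hy : y ∈ P.Ω) {ε : Fin 4 → ℝ} (hε : ∀ i, ε i = 1 ∨ ε i = -1)
    (hF : F.transpose * P.g y * F = Matrix.diagonal fun i => (ε i : ℂ))
    (hh : EntryLE (frame2 F (P.h y)) a) (ha : a ≤ 1 / 100)
    (hN : ∀ k, EntryLE (frame3 F (P.nablah y) k) b)
    (hv : ∀ i, ‖frame1 F v i‖ ≤ s)
    (hR : EntryLE (frame2 F (Matrix.of (ricci P.G y))) r) :
    BoundedBy (b ^ 2 + a ^ 2 * (s ^ 2 + r)) (2 ^ 31) (P.errBare v y) ∧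
    BoundedBy (b ^ 2 + a ^ 2 * (s ^ 2 + r)) (2 ^ 31) (P.errR v y) ∧
    BoundedBy (b ^ 2 + a ^ 2 * (s ^ 2 + r)) (2 ^ 31) (P.errRtilde v y) := by
  obtain ⟨V, hU, hV⟩ := exists_frame hy hε hF hh ha
  have ha0 := hh.nonneg
  have hb0 := (hN 0).nonneg
  have hr0 := hR.nonneg
  have hs0 : 0 ≤ s := (norm_nonneg _).trans (hv 0)
  have ht := norm_four_sub_τ hy hU hV hh ha
  have hT := frame_tang hy hN
  have hL := frame_trLap hy hU hV hN
  have hdτ := frame_dτ hy hU hV hh ha hN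
  obtain ⟨hUh, hUhV⟩ := frame_Uh hU hV hh
  set W := b ^ 2 + a ^ 2 * (s ^ 2 + r) with hW
  have hW0 : 0 ≤ W := by positivity
  have ha2 : a ^ 2 ≤ 1 := by nlinarith
  have hb2 : b ^ 2 ≤ W := le_add_of_nonneg_right (by positivity)
  have har : a ^ 2 * r ≤ W := by nlinarith [sq_nonneg b, sq_nonneg (a * s)]
  have has : a ^ 2 * s ^ 2 ≤ W := by nlinarith [sq_nonneg b, mul_nonneg (sq_nonneg a) hr0]
  -- The mixed weight is absorbed by the arithmetic-geometric mean inequality.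
  have habs : a * b * s ≤ W := by nlinarith [sq_nonneg (b - a * s), sq_nonneg b]
  have hab : a * b ^ 2 ≤ W := by nlinarith [sq_nonneg b]
  have haab : a ^ 2 * b ^ 2 ≤ W := by nlinarith [sq_nonneg b]
  -- A first-order bound is enough where another factor b is already present.
  have ht' : ‖4 - P.τ y‖ ≤ 16 * a := by nlinarith
  have ht1 : ‖4 - P.τ y‖ ≤ 1 := by nlinarith
  have hτ : ‖P.τ y‖ ≤ 5 := by
    have := norm_sub_le (4 : ℂ) (4 - P.τ y)
    rw [sub_sub_cancel] at this
    have h4 : ‖(4 : ℂ)‖ = 4 := by simp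
    linarith
  have h4τ : ‖4 + P.τ y‖ ≤ 9 := by
    have := norm_add_le (4 : ℂ) (P.τ y)
    have h4 : ‖(4 : ℂ)‖ = 4 := by simp
    linarith
  have hUg : P.U y * P.g y * P.U y
      = F * (V * Matrix.diagonal (fun i => (ε i : ℂ)) * V) * F.transpose := by
    rw [← hF, hU]; simp only [Matrix.mul_assoc]
  have hE : EntryLE (Matrix.diagonal fun i => (ε i : ℂ)) 1 := fun i j => by
    rw [diagonal_apply]
    split_ifs
    · rcases hε i with h | h <;> simp [h]
    · simp
  have hricci : ∀ A : Mat4, ricciContract P.G (F * A * F.transpose) y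
      = ∑ i, ∑ j, frame2 F (Matrix.of (ricci P.G y)) i j * A i j :=
    fun A => sum_mul_frame F A (Matrix.of (ricci P.G y))
  have q1 : BoundedBy W (2 ^ 20) ((4 - P.τ y) * ricciContract P.G (P.U y * P.g y * P.U y) y) := by
    rw [hUg, hricci, BoundedBy, norm_mul]
    have := hR.sum_mul ((hV.mul hE).mul hV)
    calc _ ≤ 1024 * a ^ 2 * (16 * (r * (4 * (4 * (2 * 1) * 2)))) :=
          mul_le_mul ht this (norm_nonneg _) (by positivity)
      _ = 2 ^ 20 * (a ^ 2 * r) := by ring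
      _ ≤ _ := by gcongr
  have q1' : BoundedBy W (2 ^ 15) ((4 - P.τ y) * scalarCurvature P.G y) := by
    have h1 : scalarCurvature P.G y = ricciContract P.G (F * V * F.transpose) y := by
      rw [scalarCurvature, P.metricOn.inv_eq hy, hU]
    rw [h1, hricci, BoundedBy, norm_mul]
    have := hR.sum_mul hV
    calc _ ≤ 1024 * a ^ 2 * (16 * (r * 2)) := mul_le_mul ht this (norm_nonneg _) (by positivity)
      _ = 2 ^ 15 * (a ^ 2 * r) := by ring
      _ ≤ _ := by gcongr
  have q2 : BoundedBy W (2 ^ 17)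
      (∑ k, ∑ l, P.U y k l * (P.tangM y k * P.U y * (P.tangM y l * P.U y)).trace) := by
    have h1 : ∀ k l, (P.tangM y k * P.U y * (P.tangM y l * P.U y)).trace
        = (frame2 F (P.tangM y k) * V * (frame2 F (P.tangM y l) * V)).trace := by
      intro k l
      have h : P.tangM y k * P.U y * (P.tangM y l * P.U y)
          = P.tangM y k * F * V * F.transpose * P.tangM y l * F * V * F.transpose := by
        rw [hU]; simp only [Matrix.mul_assoc]
      rw [h, trace_mul_comm, frame2_eq, frame2_eq]
      simp only [Matrix.mul_assoc]
    have h2 : ∑ k, ∑ l, P.U y k l * (P.tangM y k * P.U y * (P.tangM y l * P.U y)).trace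
        = ∑ i, ∑ j, V i j *
          (Matrix.of fun i j => (frame3 F (P.tangM y) i * V * (frame3 F (P.tangM y) j * V)).trace) i j := by
      have h3 := sum_mul_frame F V (Matrix.of fun k l =>
        (frame2 F (P.tangM y k) * V * (frame2 F (P.tangM y l) * V)).trace)
      simp only [h1]
      simp only [hU, mul_comm ((F * V * F.transpose) _ _)]
      refine h3.trans (Finset.sum_congr rfl fun i _ => Finset.sum_congr rfl fun j _ => ?_)
      rw [mul_comm]
      congr 1
      simp only [frame3_eq, ← frame2_eq, Finset.sum_mul, Finset.mul_sum, Matrix.smul_mul,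
        Matrix.mul_smul, trace_sum, trace_smul, smul_eq_mul, Matrix.of_apply]
      rw [Finset.sum_comm]
      generalize hX : (fun k l : Fin 4 =>
        (frame2 F (P.tangM y k) * V * (frame2 F (P.tangM y l) * V)).trace) = X
      have hX' : ∀ k l, (frame2 F (P.tangM y k) * V * (frame2 F (P.tangM y l) * V)).trace = X k l :=
        fun k l => by rw [← hX]
      simp only [hX']
      simp only [frame2, Matrix.of_apply]
      exact Finset.sum_congr rfl fun _ _ => Finset.sum_congr rfl fun _ _ => by ring
    rw [h2]
    have h3 : EntryLE (Matrix.of fun i j =>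
        (frame3 F (P.tangM y) i * V * (frame3 F (P.tangM y) j * V)).trace)
        (4 * (4 * (4 * (2 * b * 2) * (4 * (2 * b * 2))))) :=
      fun i j => (((hT i).mul hV).mul ((hT j).mul hV)).trace
    calc _ ≤ _ := hV.sum_mul h3
      _ = 2 ^ 17 * b ^ 2 := by ring
      _ ≤ _ := by gcongr
  have q3 : BoundedBy W (2 ^ 17) (P.trLap y ⬝ᵥ (P.U y).mulVec (P.trLap y)) := by
    rw [hU, dot_frame]
    calc _ ≤ _ := hV.dot hL hL
      _ = 2 ^ 17 * b ^ 2 := by ring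
      _ ≤ _ := by gcongr
  have q4 : BoundedBy W (2 ^ 16) (v ⬝ᵥ (P.U y * P.h y * P.U y).mulVec (P.trLap y)) := by
    rw [hUh, dot_frame]
    calc _ ≤ _ := hUhV.dot hv hL
      _ = 2 ^ 16 * (a * b * s) := by ring
      _ ≤ _ := by gcongr
  have q5 : BoundedBy W (2 ^ 15) ((4 - P.τ y) * (v ⬝ᵥ (P.U y).mulVec (P.trLap y))) := by
    rw [hU, dot_frame, BoundedBy, norm_mul]
    calc _ ≤ 16 * a * (16 * (s * 2 * (64 * b))) :=
          mul_le_mul ht' (hV.dot hv hL) (norm_nonneg _) (by positivity)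
      _ = 2 ^ 15 * (a * b * s) := by ring
      _ ≤ _ := by gcongr
  have q6 : BoundedBy W (2 ^ 22) (dvec P.τ y ⬝ᵥ (P.U y).mulVec (P.trLap y)) := by
    rw [hU, dot_frame]
    calc _ ≤ _ := hV.dot hdτ hL
      _ = 2 ^ 22 * (a * b ^ 2) := by ring
      _ ≤ _ := by gcongr
  have q7 : BoundedBy W (2 ^ 15) ((4 - P.τ y) * (v ⬝ᵥ (P.U y).mulVec v)) := by
    rw [hU, dot_frame, BoundedBy, norm_mul]
    calc _ ≤ 1024 * a ^ 2 * (16 * (s * 2 * s)) :=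
          mul_le_mul ht (hV.dot hv hv) (norm_nonneg _) (by positivity)
      _ = 2 ^ 15 * (a ^ 2 * s ^ 2) := by ring
      _ ≤ _ := by gcongr
  have q8 : BoundedBy W (2 ^ 16) (v ⬝ᵥ (P.U y).mulVec (dvec P.τ y)) := by
    rw [hU, dot_frame]
    calc _ ≤ _ := hV.dot hv hdτ
      _ = 2 ^ 16 * (a * b * s) := by ring
      _ ≤ _ := by gcongr
  have q9 : BoundedBy W (2 ^ 27) (dvec P.τ y ⬝ᵥ (P.U y).mulVec (dvec P.τ y)) := by
    rw [hU, dot_frame]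
    calc _ ≤ _ := hV.dot hdτ hdτ
      _ = 2 ^ 27 * (a ^ 2 * b ^ 2) := by ring
      _ ≤ _ := by gcongr
  have c2 : ‖(2 : ℂ)‖ ≤ 2 := by simp
  have ch : ‖(1 / 2 : ℂ)‖ ≤ 1 := by norm_num
  have c4 : ‖(1 / 4 : ℂ)‖ ≤ 1 := by norm_num
  have c8 : ‖(1 / 8 : ℂ)‖ ≤ 1 := by norm_num
  have e0 : BoundedBy W (2 ^ 25) (P.errBare v y) :=
    (((((((q1.neg.add (q2.mul c2)).sub (q3.mul c2)).add (q4.mul c2)).add (q5.mul ch)).sub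
      (q6.mul ch)).add ((q7.mul h4τ).mul ch)).mono hW0 (by norm_num))
  have e1 : BoundedBy W (2 ^ 30) (P.errR v y) :=
    (((((e0.mul ch).sub ((q7.mul h4τ).mul c8)).add ((q8.mul hτ).mul c4)).add (q9.mul c8)).sub
      q1').mono hW0 (by norm_num)
  have e2 : BoundedBy W (2 ^ 31) (P.errRtilde v y) :=
    ((e1.sub (q5.mul ch)).add (q6.mul ch)).mono hW0 (by norm_num)
  exact ⟨e0.mono hW0 (by norm_num), e1.mono hW0 (by norm_num), e2⟩

end PatchBrane

end

/-! ### The pointwise identities: Lagrangian = density + divergence + remainder -/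

section

open Patch Matrix
open PatchBrane (dvec)

variable {M : Type*} [TopologicalSpace M] [ChartedSpace E4 M]

namespace Brane

variable {D : ℕ} [T2Space M] [IsManifold (𝓡 4) ∞ M] (B : Brane D M)

theorem ev_inn (q : M) (f k : smoothFunctions M) : ev q (B.poisson.inn f k)
    = dvec (hat q f) (chartAt E4 q q) ⬝ᵥ ((B.patch q).U (chartAt E4 q q)).mulVec
      (dvec (hat q k) (chartAt E4 q q)) := by
  rw [ev_eq_hat, B.hat_inn (chart_mem q), PatchBrane.gradInner_dvec]

theorem ev_lap_x (q : M) (a : Fin D) : ev q (B.poisson.lap (B.poisson.x a))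
    = (B.patch q).lap ((B.patch q).ξ a) (chartAt E4 q q) := by
  rw [ev_eq_hat, B.hat_lap (chart_mem q)]; rfl

theorem ev_inn_x (q : M) (a : Fin D) (f : smoothFunctions M) :
    ev q (B.poisson.inn (B.poisson.x a) f)
      = gradInner (B.patch q).U ((B.patch q).ξ a) (hat q f) (chartAt E4 q q) := by
  rw [ev_eq_hat, B.hat_inn (chart_mem q)]; rfl

theorem ev_u (q : M) (a b : Fin D) :
    ev q (B.poisson.u a b) = (B.patch q).u a b (chartAt E4 q q) := by
  rw [ev_eq_hat, B.hat_u (chart_mem q)]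

theorem ev_τ (q : M) : ev q B.poisson.τ = (B.patch q).τ (chartAt E4 q q) := by
  rw [ev_eq_hat, B.hat_τ (chart_mem q)]

theorem ev_uSq (q : M) : ev q B.poisson.uSq
    = (1 / 2 : ℂ) * (B.patch q).τ (chartAt E4 q q) ^ 2 - 4 := by
  rw [ev_eq_hat, B.hat_uSq (chart_mem q)]

theorem ev_innLap (q : M) (f : smoothFunctions M) : ev q (B.poisson.innLap f)
    = dvec (hat q f) (chartAt E4 q q) ⬝ᵥ ((B.patch q).U (chartAt E4 q q)).mulVec
      ((B.patch q).trLap (chartAt E4 q q)) := by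
  rw [← PatchBrane.sum_lap_gradInner (P := B.patch q) (chart_mem q), PoissonEmbedding.innLap]
  simp only [map_mul, map_sum, B.ev_lap_x, B.ev_inn_x]
  rfl

theorem ev_uInnLap (q : M) (f : smoothFunctions M) : ev q (B.poisson.uInnLap f)
    = dvec (hat q f) (chartAt E4 q q) ⬝ᵥ ((B.patch q).U (chartAt E4 q q)
      * (B.patch q).g (chartAt E4 q q) * (B.patch q).U (chartAt E4 q q)).mulVec
      ((B.patch q).trLap (chartAt E4 q q)) := by
  rw [← PatchBrane.sum_u_lap_gradInner (P := B.patch q) (chart_mem q), PoissonEmbedding.uInnLap]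
  simp only [map_mul, map_sum, B.ev_lap_x, B.ev_inn_x, B.ev_u]
  rfl

theorem ev_uLapLap (q : M) : ev q B.poisson.uLapLap
    = (B.patch q).trLap (chartAt E4 q q) ⬝ᵥ ((B.patch q).U (chartAt E4 q q)).mulVec
      ((B.patch q).trLap (chartAt E4 q q)) := by
  rw [← PatchBrane.sum_u_lap_lap (P := B.patch q) (chart_mem q), PoissonEmbedding.uLapLap]
  simp only [map_mul, map_sum, B.ev_lap_x, B.ev_u]
  rfl

theorem dvec_l (q : M) : dvec (hat q B.poisson.l) (chartAt E4 q q) = B.ell q • B.dσ q := by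
  ext m
  rw [dvec, pd_congr_on (chartAt E4 q).open_target (chart_mem q) B.hat_l, B.pd_l (chart_mem q),
    B.ell_eq (mem_chart_source E4 q)]
  rfl

theorem dvec_τ (q : M) : dvec (hat q B.poisson.τ) (chartAt E4 q q)
    = dvec (B.patch q).τ (chartAt E4 q q) := by
  ext m
  rw [dvec, pd_congr_on (chartAt E4 q).open_target (chart_mem q) fun z hz => B.hat_τ hz]
  rfl

theorem ev_lap_u (q : M) : ev q (∑ a, ∑ b, B.poisson.e a * B.poisson.e b * (B.poisson.u a b
      * (2 * B.poisson.lap (B.poisson.u a b)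
        - 2 * B.poisson.inn (B.poisson.x a) (B.poisson.lap (B.poisson.x b))
        - 2 * B.poisson.inn (B.poisson.x b) (B.poisson.lap (B.poisson.x a)))))
    = 4 * ((1 / 2 : ℂ) * (B.patch q).τ (chartAt E4 q q) * B.ricGgG q - B.scalG q)
      + 4 * ∑ k, ∑ l, (B.patch q).U (chartAt E4 q q) k l * ((B.patch q).tangM (chartAt E4 q q) k
        * (B.patch q).U (chartAt E4 q q) * ((B.patch q).tangM (chartAt E4 q q) l
        * (B.patch q).U (chartAt E4 q q))).trace := by
  have h1 : ∀ a b, ev q (2 * B.poisson.lap (B.poisson.u a b)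
        - 2 * B.poisson.inn (B.poisson.x a) (B.poisson.lap (B.poisson.x b))
        - 2 * B.poisson.inn (B.poisson.x b) (B.poisson.lap (B.poisson.x a)))
      = 4 * ev q (B.ricF a b) + 4 * hessInner (B.patch q).G (B.patch q).U ((B.patch q).ξ a)
        ((B.patch q).ξ b) (chartAt E4 q q) := by
    intro a b
    rw [← B.hat_hessInnerF (chart_mem q), ← ev_eq_hat, ricF]
    simp only [map_sub, map_smul, map_mul, map_ofNat, smul_eq_mul]
    ring
  have h2 : B.scalG q = (1 / 2 : ℂ) * ((B.patch q).τ (chartAt E4 q q) * B.ricGgG q)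
      - ∑ a, ∑ b, ev q (B.poisson.e a) * ev q (B.poisson.e b)
        * (ev q (B.poisson.u a b) * ev q (B.ricF a b)) := by
    rw [B.scalG_eq, B.ricGgG_eq, ← B.ev_τ, scalGF]
    simp only [map_sub, map_smul, map_mul, smul_eq_mul, map_sum]
  rw [← PatchBrane.sum_u_hessInner (P := B.patch q) (chart_mem q)]
  simp only [map_sum, map_mul, h1]
  have h3 : ∀ a b, ((B.patch q).η a : ℂ) * (B.patch q).η b = ev q (B.poisson.e a)
    * ev q (B.poisson.e b) := fun _ _ => rfl
  simp only [h3, ← B.ev_u]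
  have h4 : ∀ a b, ev q (B.poisson.e a) * ev q (B.poisson.e b) * (ev q (B.poisson.u a b)
      * (4 * ev q (B.ricF a b) + 4 * hessInner (B.patch q).G (B.patch q).U ((B.patch q).ξ a)
        ((B.patch q).ξ b) (chartAt E4 q q)))
      = 4 * (ev q (B.poisson.e a) * ev q (B.poisson.e b) * (ev q (B.poisson.u a b)
        * ev q (B.ricF a b)))
      + 4 * (ev q (B.poisson.e a) * ev q (B.poisson.e b) * (ev q (B.poisson.u a b)
        * hessInner (B.patch q).G (B.patch q).U ((B.patch q).ξ a)
        ((B.patch q).ξ b) (chartAt E4 q q))) := fun a b => by ring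
  simp only [h4, Finset.sum_add_distrib, ← Finset.mul_sum]
  linear_combination 4 * h2

omit [T2Space M] [IsManifold (𝓡 4) ∞ M] in
theorem exp_two_σ (q : M) : (Real.exp (2 * B.σ q) : ℂ) = B.ell q ^ 2 := by
  rw [ell, two_mul, Real.exp_add, Complex.ofReal_mul, sq]

theorem UgU_mulVec (q : M) (v : Fin 4 → ℂ) :
    ((B.patch q).U (chartAt E4 q q) * (B.patch q).g (chartAt E4 q q)
      * (B.patch q).U (chartAt E4 q q)).mulVec v
    = ((B.patch q).U (chartAt E4 q q)).mulVec v - ((B.patch q).U (chartAt E4 q q)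
      * (B.patch q).h (chartAt E4 q q) * (B.patch q).U (chartAt E4 q q)).mulVec v := by
  rw [← Matrix.sub_mulVec, PatchBrane.g_eq_sub, Matrix.mul_sub, Matrix.sub_mul,
    PatchBrane.U_mul_G (chart_mem q), Matrix.one_mul]

/-- The first matrix Lagrangian is the geometric one up to a divergence and an error. -/
theorem bare_eq (q : M) : ev q (B.poisson.m * B.poisson.bare) - ev q B.poisson.bareDv
      - B.densityBare q
    = B.ell q ^ 2 * (B.patch q).errBare (B.dσ q) (chartAt E4 q q) := by
  have h := congrArg (ev q) B.poisson.two_bare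
  simp only [map_sub, map_add, map_mul, map_ofNat] at h
  have hu := B.ev_lap_u q
  simp only [map_sub, map_mul, map_ofNat, map_sum] at hu
  simp only [map_sum, map_mul, map_sub, map_ofNat] at h
  rw [hu] at h
  have hb := B.boxExp_eq q
  have hd := B.divgdσ_eq q
  simp only [ev_l, B.ev_uSq, B.ev_τ, B.ev_innLap, B.ev_uInnLap, B.ev_uLapLap, B.ev_inn, B.dvec_l,
    B.dvec_τ, UgU_mulVec, smul_dotProduct, dotProduct_smul, mulVec_smul, smul_eq_mul,
    dotProduct_sub] at h hd
  rw [← hb] at h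
  have hr : B.ricGgG q = ricciContract (B.patch q).G ((B.patch q).U (chartAt E4 q q)
    * (B.patch q).g (chartAt E4 q q) * (B.patch q).U (chartAt E4 q q)) (chartAt E4 q q) := by
    rw [B.ricGgG_eq, ev_eq_hat, B.hat_ricGgGF (chart_mem q)]
  rw [densityBare, exp_two_σ, PatchBrane.errBare, ← hr, map_mul]
  -- Half of `two_bare`; the multiple of `hd` introduces the ∇g ∂σ term of the density, the
  -- remaining ∂σ terms being of second order after τ is split as 4 - (4 - τ) and UgU as U - UhU.
  linear_combination (1 / 2 : ℂ) * h - 4 * B.ell q * hd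

/-- The divergence terms in the second matrix Lagrangian. -/
def divR : smoothFunctions M := (1 / 2 : ℂ) • B.poisson.bareDv
  + (2 : ℂ) • B.poisson.dv B.poisson.l B.poisson.l
  - (1 / 8 : ℂ) • B.poisson.dv B.poisson.trH B.poisson.trH

/-- Minus the symbol of the second matrix Lagrangian, divided by `e^σ`. -/
def lagR : smoothFunctions M := (1 / 2 : ℂ) • (B.poisson.m * B.poisson.bare)
  - (1 / 8 : ℂ) • (B.poisson.m * (B.poisson.trH * B.poisson.box B.poisson.trH))

/-- Minus the symbol of the third matrix Lagrangian, divided by `e^σ`. -/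
def lagRtilde : smoothFunctions M := (1 / 2 : ℂ) • (B.poisson.m * B.poisson.bare)
  - (1 / 2 : ℂ) • (B.poisson.m * B.poisson.HH)

/-- The divergence terms in the third matrix Lagrangian. -/
def divRtilde : smoothFunctions M := (1 / 2 : ℂ) • B.poisson.bareDv
  + (2 : ℂ) • B.poisson.dv B.poisson.l B.poisson.l - (1 / 2 : ℂ) • (B.poisson.m * B.poisson.HHdv)

theorem ev_inn_trH (q : M) : ev q (B.poisson.inn B.poisson.trH B.poisson.trH)
    = ev q B.poisson.τ ^ 2 * ev q (B.poisson.inn B.poisson.l B.poisson.l)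
      + 2 * B.ell q * ev q B.poisson.τ * ev q (B.poisson.inn B.poisson.l B.poisson.τ)
      + B.ell q ^ 2 * ev q (B.poisson.inn B.poisson.τ B.poisson.τ) := by
  rw [PoissonEmbedding.trH_eq, PoissonEmbedding.inn_mul, PoissonEmbedding.inn_mul_left,
    PoissonEmbedding.inn_mul_left, B.poisson.inn_comm B.poisson.τ B.poisson.l]
  simp only [map_add, map_mul, ev_l]
  ring

/-- The relation R_{μν}g^{μν} = ½τR - R_{μν}(GgG)^{μν} exchanges the two Ricci contractions, with a
second-order discrepancy (4 - τ)R. The Laplacian of e^σ that is left over is a divergence up to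
|∂σ|². -/
theorem densityR_eq (q : M) : B.densityR q = B.densityBare q / 2
    + B.ell q ^ 2 * (4 - (B.patch q).τ (chartAt E4 q q)) * B.scalG q
    - 2 * B.ell q * ev q (B.poisson.lap B.poisson.l) := by
  have h := B.ricg_eq q
  rw [ricgF, map_sub, map_smul, map_mul, ← B.ricGgG_eq, ← B.scalG_eq, B.ev_τ, smul_eq_mul] at h
  rw [densityR, densityBare, exp_two_σ, h, ← B.boxExp_eq]
  ring

/-- Integrating the trace term -⅛H□H by parts gives ⅛⟨dH, dH⟩, whose leading part ⅛τ²⟨de^σ, de^σ⟩ is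
2⟨de^σ, de^σ⟩ up to a multiple of 4 - τ. It cancels the square of de^σ that arises when the leftover
□e^σ is turned into a divergence. -/
theorem R_eq (q : M) : ev q B.lagR - ev q B.divR - B.densityR q
    = B.ell q ^ 2 * (B.patch q).errR (B.dσ q) (chartAt E4 q q) := by
  have h := B.bare_eq q
  have h1 := B.ev_inn_trH q
  have h2 : B.poisson.m * (B.poisson.trH * B.poisson.box B.poisson.trH)
      = B.poisson.trH * B.poisson.lap B.poisson.trH := by rw [PoissonEmbedding.lap]; ring
  rw [densityR_eq, lagR, divR, h2, PatchBrane.errR, PoissonEmbedding.dv, PoissonEmbedding.dv]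
  simp only [map_sub, map_add, map_smul, map_mul, smul_eq_mul, ev_l] at h h1 ⊢
  simp only [B.ev_inn, B.ev_τ, B.dvec_l, B.dvec_τ, smul_dotProduct, dotProduct_smul, mulVec_smul,
    smul_eq_mul] at h1 ⊢
  have h3 : B.scalG q = scalarCurvature (B.patch q).G (chartAt E4 q q) := rfl
  rw [← h3]
  linear_combination (1 / 2 : ℂ) * h + (1 / 8 : ℂ) * h1

/-- By `four_HH` the new term yields the same ⅛⟨dH, dH⟩ and in addition half of e^σ □x^a⟨dx_a, dH⟩.
To leading order this is -2e^{2σ} times the ∇g ∂σ term, which therefore disappears from the density.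
-/
theorem Rtilde_eq (q : M) : ev q B.lagRtilde - ev q B.divRtilde - B.densityRtilde q
    = B.ell q ^ 2 * (B.patch q).errRtilde (B.dσ q) (chartAt E4 q q) := by
  have h := B.R_eq q
  have h1 := B.ev_inn_trH q
  have h2 : B.poisson.m * (B.poisson.trH * B.poisson.box B.poisson.trH)
      = B.poisson.trH * B.poisson.lap B.poisson.trH := by rw [PoissonEmbedding.lap]; ring
  have h3 := congrArg (ev q) B.poisson.four_HH
  have h4 : B.poisson.innLap B.poisson.trH = B.poisson.l * B.poisson.innLap B.poisson.τ
      + B.poisson.τ * B.poisson.innLap B.poisson.l := by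
    simp only [PoissonEmbedding.innLap, PoissonEmbedding.trH_eq, PoissonEmbedding.inn_mul,
      Finset.mul_sum, ← Finset.sum_add_distrib]
    exact Finset.sum_congr rfl fun _ _ => by ring
  have h5 : B.densityRtilde q = B.densityR q - 2 * B.ell q * (B.ell q * B.divgdσ q) := by
    rw [densityRtilde, densityR, exp_two_σ]; ring
  rw [h4] at h3
  rw [h5, B.divgdσ_eq]
  rw [lagR, divR, h2, PoissonEmbedding.dv, PoissonEmbedding.dv] at h
  rw [lagRtilde, divRtilde, PatchBrane.errRtilde, PoissonEmbedding.dv]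
  simp only [map_sub, map_add, map_smul, map_mul, map_ofNat, smul_eq_mul, ev_l] at h h1 h3 ⊢
  simp only [B.ev_inn, B.ev_innLap, B.ev_τ, B.dvec_l, B.dvec_τ, smul_dotProduct, dotProduct_smul,
    mulVec_smul, smul_eq_mul] at h h1 h3 ⊢
  linear_combination h + (1 / 8 : ℂ) * h3

end Brane

end

/-! ### The volume measure -/

section

open Patch

theorem measurableSet_preimage_inter {α β : Type*} [TopologicalSpace α] [MeasurableSpace α]
    [OpensMeasurableSpace α] [TopologicalSpace β] [MeasurableSpace β] [BorelSpace β] {f : α → β}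
    {T : Set α} {A : Set β} (hT : MeasurableSet T) (hf : ContinuousOn f T) (hA : MeasurableSet A) :
    MeasurableSet (f ⁻¹' A ∩ T) := by
  have h1 : MeasurableSet ((fun x : T => f x) ⁻¹' A) :=
    (continuousOn_iff_continuous_domRestrict.1 hf).measurable hA
  have h2 := hT.subtype_image h1
  convert h2 using 1
  ext x
  simp [and_comm]

variable {M : Type*} [TopologicalSpace M] [ChartedSpace E4 M]

/-- The change of coordinates between two charts. -/
def coordChange (p p' : M) (y : E4) : E4 := chartAt E4 p ((chartAt E4 p').symm y)

section

variable [IsManifold (𝓡 4) ∞ M] {p p' q : M}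

theorem differentiableAt_coordChange (hq : q ∈ (chartAt E4 p).source)
    (hq' : q ∈ (chartAt E4 p').source) :
    DifferentiableAt ℝ (coordChange p p') (chartAt E4 p' q) := by
  rw [← mdifferentiableAt_iff_differentiableAt]
  refine MDifferentiableAt.comp (I' := 𝓡 4) _ ?_ (mdifferentiableAt_chart_symm hq')
  rw [(chartAt E4 p').left_inv hq']
  exact mdifferentiableAt_chart hq

/-- The complex transition matrix is the complexification of the real Jacobian matrix that enters
the change of variables formula. -/
theorem norm_det_transition (hq : q ∈ (chartAt E4 p).source) (hq' : q ∈ (chartAt E4 p').source) :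
    ‖(transition p p' (chartAt E4 p' q)).det‖
      = |(fderiv ℝ (coordChange p p') (chartAt E4 p' q)).det| := by
  set L := fderiv ℝ (coordChange p p') (chartAt E4 p' q) with hL
  set b := (EuclideanSpace.basisFun (Fin 4) ℝ).toBasis with hb
  have h1 : transition p p' (chartAt E4 p' q)
      = (LinearMap.toMatrix b b (L : E4 →ₗ[ℝ] E4)).map Complex.ofRealHom := by
    ext μ α
    have h2 : HasFDerivAt (hat p' (coordFn p μ)) ((Complex.ofRealCLM.comp
        (EuclideanSpace.proj (𝕜 := ℝ) μ)).comp L) (chartAt E4 p' q) :=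
      (Complex.ofRealCLM.comp (EuclideanSpace.proj (𝕜 := ℝ) μ)).hasFDerivAt.comp _
        (differentiableAt_coordChange hq hq').hasFDerivAt
    rw [transition, Matrix.of_apply, pd, h2.fderiv, Matrix.map_apply, LinearMap.toMatrix_apply]
    simp [hb]
  have h3 := Complex.ofRealHom.map_det (LinearMap.toMatrix b b (L : E4 →ₗ[ℝ] E4))
  rw [h1, ← RingHom.mapMatrix_apply, ← h3, LinearMap.det_toMatrix, Complex.ofRealHom_eq_coe,
    Complex.norm_real, Real.norm_eq_abs]

end

namespace Brane

variable {D : ℕ} (B : Brane D M) {p p' q : M}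

/-- The density of the volume in a chart. -/
def dens (p : M) (y : E4) : ENNReal := ENNReal.ofReal (Real.sqrt ‖(B.G p y).det‖)

/-- The volume measure of the domain of a chart. -/
def chartVol [MeasurableSpace M] (p : M) : Measure M :=
  Measure.map (chartAt E4 p).symm
    ((volume.restrict (chartAt E4 p).target).withDensity (B.dens p))

theorem vol_eq [MeasurableSpace M] : B.vol = ⨆ p, B.chartVol p := rfl

variable [MeasurableSpace M] [BorelSpace M]

theorem aemeasurable_chart_symm (p : M) (w : E4 → ENNReal) : AEMeasurable (chartAt E4 p).symm
    ((volume.restrict (chartAt E4 p).target).withDensity w) :=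
  ((chartAt E4 p).continuousOn_symm.aemeasurable (chartAt E4 p).open_target.measurableSet).mono_ac
    (withDensity_absolutelyContinuous _ _)

theorem chartVol_apply {A : Set M} (hA : MeasurableSet A) :
    B.chartVol p A = ∫⁻ y in (chartAt E4 p).symm ⁻¹' A ∩ (chartAt E4 p).target, B.dens p y := by
  rw [chartVol, Measure.map_apply_of_aemeasurable (aemeasurable_chart_symm p _) hA,
    withDensity_apply', Measure.restrict_restrict' (chartAt E4 p).open_target.measurableSet]

variable [T2Space M] [IsManifold (𝓡 4) ∞ M]

-- As det G = det g, the transformation law of g suffices, and it produces the squared Jacobian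
-- under the root.
omit [MeasurableSpace M] [BorelSpace M] in
theorem dens_transition (hq : q ∈ (chartAt E4 p).source) (hq' : q ∈ (chartAt E4 p').source) :
    B.dens p' (chartAt E4 p' q)
      = ENNReal.ofReal |(fderiv ℝ (coordChange p p') (chartAt E4 p' q)).det|
        * B.dens p (chartAt E4 p q) := by
  have h1 : ∀ {p : M}, q ∈ (chartAt E4 p).source →
      (B.G p (chartAt E4 p q)).det = (B.g p (chartAt E4 p q)).det := fun {p} hq =>
    PatchBrane.G_det (P := B.patch p) ((chartAt E4 p).map_source hq)
  rw [dens, dens, h1 hq, h1 hq', B.g_transition hq hq', ← norm_det_transition hq hq',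
    ← ENNReal.ofReal_mul (norm_nonneg _)]
  congr 1
  rw [Matrix.det_mul, Matrix.det_mul, Matrix.det_transpose, norm_mul, norm_mul,
    show ∀ a b : ℝ, a * b * a = a ^ 2 * b from fun a b => by ring,
    Real.sqrt_mul (sq_nonneg _), Real.sqrt_sq (norm_nonneg _)]

/-- Change of variables on the overlap: there the two chart measures agree, and the image of the
overlap is only part of the chart at p. -/
theorem restrict_chartVol_le (p p' : M) :
    (B.chartVol p').restrict (chartAt E4 p).source ≤ B.chartVol p := by
  refine Measure.le_iff.2 fun A hA => ?_
  have hS : MeasurableSet (A ∩ (chartAt E4 p).source) :=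
    hA.inter (chartAt E4 p).open_source.measurableSet
  rw [Measure.restrict_apply hA, B.chartVol_apply hS, B.chartVol_apply hA]
  set s := (chartAt E4 p').symm ⁻¹' (A ∩ (chartAt E4 p).source) ∩ (chartAt E4 p').target with hs
  have hsm : MeasurableSet s := measurableSet_preimage_inter
    (chartAt E4 p').open_target.measurableSet (chartAt E4 p').continuousOn_symm hS
  have hq : ∀ y ∈ s, ∃ q, q ∈ A ∧ q ∈ (chartAt E4 p).source ∧ q ∈ (chartAt E4 p').source ∧
      chartAt E4 p' q = y := fun y hy => ⟨(chartAt E4 p').symm y, hy.1.1, hy.1.2,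
    (chartAt E4 p').map_target hy.2, (chartAt E4 p').right_inv hy.2⟩
  have h1 : ∫⁻ y in s, B.dens p' y = ∫⁻ y in s,
      ENNReal.ofReal |(fderiv ℝ (coordChange p p') y).det| * B.dens p (coordChange p p' y) := by
    refine setLIntegral_congr_fun hsm fun y hy => ?_
    obtain ⟨q, -, h1, h2, rfl⟩ := hq y hy
    rw [B.dens_transition h1 h2, coordChange, (chartAt E4 p').left_inv h2]
  have h2 : ∀ y ∈ s, HasFDerivWithinAt (coordChange p p') (fderiv ℝ (coordChange p p') y) s y := by
    intro y hy
    obtain ⟨q, -, h1, h2, rfl⟩ := hq y hy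
    exact (differentiableAt_coordChange h1 h2).hasFDerivAt.hasFDerivWithinAt
  have h3 : Set.InjOn (coordChange p p') s := by
    intro y hy z hz hyz
    obtain ⟨q, -, h1, h2, rfl⟩ := hq y hy
    obtain ⟨q', -, h1', h2', rfl⟩ := hq z hz
    rw [coordChange, coordChange, (chartAt E4 p').left_inv h2, (chartAt E4 p').left_inv h2'] at hyz
    rw [(chartAt E4 p).injOn h1 h1' hyz]
  rw [h1, ← lintegral_image_eq_lintegral_abs_det_fderiv_mul volume hsm h2 h3]
  refine lintegral_mono_set ?_
  rintro _ ⟨y, hy, rfl⟩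
  obtain ⟨q, hA, h1, h2, rfl⟩ := hq y hy
  rw [coordChange, (chartAt E4 p').left_inv h2]
  exact ⟨by rwa [Set.mem_preimage, (chartAt E4 p).left_inv h1], (chartAt E4 p).map_source h1⟩

/-- On the domain of a chart, the volume is given by the density in that chart. -/
theorem vol_restrict (p : M) : B.vol.restrict (chartAt E4 p).source = B.chartVol p := by
  set S := (chartAt E4 p).source with hS
  have hSm : MeasurableSet S := (chartAt E4 p).open_source.measurableSet
  apply le_antisymm
  -- A bound for every chart measure, split along S, passes to the supremum; restricting to S kills
  -- the second summand.
  · have h1 : B.vol ≤ B.chartVol p + B.vol.restrict Sᶜ := by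
      conv_lhs => rw [vol_eq]
      refine iSup_le fun p' => ?_
      rw [← Measure.restrict_add_restrict_compl (μ := B.chartVol p') hSm]
      exact add_le_add (B.restrict_chartVol_le p p')
        (Measure.restrict_mono le_rfl (le_iSup B.chartVol p'))
    have h2 := Measure.restrict_mono (le_refl S) h1
    rw [Measure.restrict_add, Measure.restrict_restrict hSm, Set.inter_compl_self,
      Measure.restrict_empty, add_zero] at h2
    exact h2.trans Measure.restrict_le_self
  · have h1 : (B.chartVol p).restrict Sᶜ = 0 := by
      rw [Measure.restrict_eq_zero, B.chartVol_apply hSm.compl]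
      have : (chartAt E4 p).symm ⁻¹' Sᶜ ∩ (chartAt E4 p).target = ∅ := by
        ext y
        simp only [Set.mem_inter_iff, Set.mem_preimage, Set.mem_compl_iff, Set.mem_empty_iff_false,
          iff_false, not_and, hS]
        exact fun h1 h2 => h1 ((chartAt E4 p).map_target h2)
      rw [this, Measure.restrict_empty, lintegral_zero_measure]
    rw [← Measure.restrict_add_restrict_compl (μ := B.chartVol p) hSm, h1, add_zero]
    exact Measure.restrict_mono le_rfl (le_iSup B.chartVol p)

omit [MeasurableSpace M] [BorelSpace M] in
theorem w_eq (p : M) (y : E4) : B.dens p y = ENNReal.ofReal ‖(B.patch p).w y‖ := by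
  rw [dens, PatchBrane.w, Complex.norm_real, Real.norm_of_nonneg (Real.sqrt_nonneg _)]; rfl

/-- The density is continuous, hence bounded on a small coordinate ball. This makes compactly
supported continuous functions integrable. -/
instance : IsLocallyFiniteMeasure B.vol := by
  refine ⟨fun q => ?_⟩
  set y := chartAt E4 q q
  have hy : y ∈ (chartAt E4 q).target := chart_mem q
  have hw : ContinuousAt (fun z => ‖(B.patch q).w z‖) y :=
    ((PatchBrane.w_smooth (P := B.patch q)).continuousOn.continuousAt
      ((chartAt E4 q).open_target.mem_nhds hy)).norm
  obtain ⟨c, hc⟩ := exists_gt ‖(B.patch q).w y‖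
  have h1 : {z | ‖(B.patch q).w z‖ < c} ∈ nhds y := hw.eventually (gt_mem_nhds hc)
  obtain ⟨r, hr, hb⟩ := Metric.mem_nhds_iff.1 h1
  set s := (chartAt E4 q).source ∩ chartAt E4 q ⁻¹' Metric.ball y r with hs
  have hso : IsOpen s := (chartAt E4 q).isOpen_inter_preimage Metric.isOpen_ball
  refine ⟨s, hso.mem_nhds ⟨mem_chart_source E4 q, Metric.mem_ball_self hr⟩, ?_⟩
  have h2 : B.vol s = B.chartVol q s := by
    rw [← B.vol_restrict q, Measure.restrict_apply hso.measurableSet, Set.inter_eq_left.2]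
    exact Set.inter_subset_left
  rw [h2, B.chartVol_apply hso.measurableSet]
  have h3 : (chartAt E4 q).symm ⁻¹' s ∩ (chartAt E4 q).target ⊆ Metric.ball y r := by
    rintro z ⟨⟨-, hz⟩, hz'⟩
    rwa [Set.mem_preimage, (chartAt E4 q).right_inv hz'] at hz
  calc _ ≤ ∫⁻ z in Metric.ball y r, B.dens q z := lintegral_mono_set h3
    _ ≤ ∫⁻ _ in Metric.ball y r, ENNReal.ofReal c := by
        refine setLIntegral_mono' measurableSet_ball fun z hz => ?_
        rw [w_eq]
        exact ENNReal.ofReal_le_ofReal (hb hz).le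
    _ = ENNReal.ofReal c * volume (Metric.ball y r) := setLIntegral_const _ _
    _ < ⊤ := ENNReal.mul_lt_top ENNReal.ofReal_lt_top measure_ball_lt_top

/-- Continuous functions with compact support are integrable. -/
theorem integrable_of_eq_zero {f : M → ℂ} (hf : Continuous f) {K : Set M} (hK : IsCompact K)
    (h : ∀ q, q ∉ K → f q = 0) : Integrable f B.vol :=
  hf.integrable_of_hasCompactSupport (HasCompactSupport.intro hK fun q hq => h q hq)

/-- The integral over the domain of a chart. -/
theorem setIntegral_chart {f : M → ℂ} (hf : Continuous f) (p : M) :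
    ∫ q in (chartAt E4 p).source, f q ∂B.vol
      = ∫ y in (chartAt E4 p).target, (B.patch p).w y * hat p f y := by
  rw [B.vol_restrict, chartVol, integral_map (aemeasurable_chart_symm p _)
    hf.aestronglyMeasurable, integral_withDensity_eq_integral_toReal_smul₀]
  · refine integral_congr_ae (Filter.Eventually.of_forall fun y => ?_)
    simp only [dens, ENNReal.toReal_ofReal (Real.sqrt_nonneg _), PatchBrane.w, Complex.real_smul]
    rfl
  · have hw : AEMeasurable (fun y => ‖(B.patch p).w y‖) (volume.restrict (chartAt E4 p).target) :=
      (PatchBrane.w_smooth (P := B.patch p)).continuousOn.norm.aemeasurable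
        (chartAt E4 p).open_target.measurableSet
    exact hw.ennreal_ofReal.congr (Filter.Eventually.of_forall fun y => (B.w_eq p y).symm)
  · exact Filter.Eventually.of_forall fun y => ENNReal.ofReal_lt_top

end Brane

end

/-! ### Integrals of Poisson brackets vanish -/

section

open Patch

theorem integral_pd_eq_zero {f : E4 → ℂ} (hf : ContDiff ℝ 1 f) (hs : HasCompactSupport f)
    (ν : Fin 4) : ∫ y, pd ν f y = 0 := by
  have h1 : Integrable (fun y => fderiv ℝ f y (EuclideanSpace.single ν (1 : ℝ))) := by
    refine Continuous.integrable_of_hasCompactSupport ?_ ?_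
    · exact (hf.continuous_fderiv one_ne_zero).clm_apply continuous_const
    · exact hs.fderiv_apply ℝ _
  have h2 := integral_mul_fderiv_eq_neg_fderiv_mul_of_integrable (𝕜 := ℂ) (μ := volume)
    (f := fun _ : E4 => (1 : ℂ)) (g := f) (v := EuclideanSpace.single ν (1 : ℝ)) (by simp)
    (by simpa using h1) (by simpa using hf.continuous.integrable_of_hasCompactSupport hs)
    (fun _ _ => differentiableAt_const _) (fun y _ => hf.differentiable one_ne_zero y)
  simpa [pd] using h2

variable {M : Type*} [TopologicalSpace M] [ChartedSpace E4 M]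

namespace Brane

variable {D : ℕ} (B : Brane D M) {p q : M}

theorem bracket_eq_zero {f k : M → ℂ} (h : k =ᶠ[nhds q] 0) : B.bracket f k q = 0 := by
  have h1 : differential k q = 0 := by
    rw [differential, h.mfderiv_eq]
    exact mfderiv_const
  rw [bracket, bracketOf, h1, map_zero]

variable [T2Space M] [IsManifold (𝓡 4) ∞ M]

omit [T2Space M] [IsManifold (𝓡 4) ∞ M] in
theorem continuous_ev (f : smoothFunctions M) : Continuous fun q => ev q f :=
  ContMDiff.continuous (I := 𝓡 4) (I' := 𝓘(ℝ, ℂ)) (n := ∞) f.2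

theorem ev_br_eq_zero {K : Set M} (hK : IsClosed K) {f k : smoothFunctions M}
    (hk : ∀ q, q ∉ K → ev q k = 0) (hq : q ∉ K) : ev q (B.poisson.br f k) = 0 :=
  B.bracket_eq_zero (Filter.eventuallyEq_of_mem (hK.isOpen_compl.mem_nhds hq) hk)

variable [MeasurableSpace M] [BorelSpace M]

/-- In the chart the integrand is a coordinate divergence by `brk_divergence`, of a field supported
in the compact image of K. -/
theorem integral_br_of_chart (f k : smoothFunctions M) {K : Set M} (hK : IsCompact K)
    (hKp : K ⊆ (chartAt E4 p).source) (hk : ∀ q, q ∉ K → ev q k = 0) :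
    ∫ q, ev q (B.poisson.m * B.poisson.br f k) ∂B.vol = 0 := by
  have h0 : ∀ q, q ∉ (chartAt E4 p).source → ev q (B.poisson.m * B.poisson.br f k) = 0 := by
    intro q hq
    rw [map_mul, B.ev_br_eq_zero hK.isClosed hk (fun h => hq (hKp h)), mul_zero]
  rw [← setIntegral_eq_integral_of_forall_compl_eq_zero h0,
    B.setIntegral_chart (continuous_ev _) p]
  set P := B.patch p with hP
  set T := (chartAt E4 p).target with hT
  have hTo : IsOpen T := (chartAt E4 p).open_target
  -- Extension by zero to the whole model space; it is smooth because the factor k vanishes outside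
  -- a compact subset of the chart image.
  set Φ : Fin 4 → E4 → ℂ := fun ν =>
    T.indicator fun z => P.ρ z * hamVec P.θ (hat p f) z ν * hat p k z with hΦ
  have hC : IsCompact (chartAt E4 p '' K) := hK.image_of_continuousOn
    ((chartAt E4 p).continuousOn.mono hKp)
  have hz : ∀ ν z, z ∉ chartAt E4 p '' K → Φ ν z = 0 := by
    intro ν z hz
    by_cases hzT : z ∈ T
    · rw [hΦ]
      simp only [Set.indicator_of_mem hzT]
      have : hat p k z = 0 := hk _ fun h => hz ⟨_, h, (chartAt E4 p).right_inv hzT⟩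
      rw [this, mul_zero]
    · exact Set.indicator_of_notMem hzT _
  have hs : ∀ ν, ContDiff ℝ 1 (Φ ν) := by
    intro ν
    rw [contDiff_iff_contDiffAt]
    intro z
    by_cases hzT : z ∈ T
    · have h1 : SmoothOn T fun z => P.ρ z * hamVec P.θ (hat p f) z ν * hat p k z :=
        (PatchBrane.ρ_smooth.mul (PatchBrane.hamVec_smooth (hat_smooth f.2 p) ν)).mul
          (hat_smooth k.2 p)
      refine ((h1.contDiffAt (hTo.mem_nhds hzT)).of_le (by simp)).congr_of_eventuallyEq ?_
      exact Filter.eventuallyEq_of_mem (hTo.mem_nhds hzT) fun w hw => Set.indicator_of_mem hw _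
    · have hz' : z ∈ (chartAt E4 p '' K)ᶜ := fun ⟨q, hq, h⟩ =>
        hzT (h ▸ (chartAt E4 p).map_source (hKp hq))
      exact (contDiffAt_const (c := (0 : ℂ))).congr_of_eventuallyEq
        (Filter.eventuallyEq_of_mem (hC.isClosed.isOpen_compl.mem_nhds hz') fun w hw => hz ν w hw)
  have hcs : ∀ ν, HasCompactSupport (Φ ν) := fun ν => HasCompactSupport.intro hC fun z h => hz ν z h
  have h1 : ∀ y ∈ T, P.w y * hat p (fun q => ev q (B.poisson.m * B.poisson.br f k)) y
      = ∑ ν, pd ν (Φ ν) y := by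
    intro y hy
    have h2 := PatchBrane.brk_divergence (P := P) hy (hat_smooth f.2 p) (hat_smooth k.2 p)
    rw [hat, map_mul, ← hat_eq_ev p (B.poisson.br f k), B.hat_br hy, ev_m, B.ell_symm hy,
      ← mul_assoc]
    refine h2.trans (Finset.sum_congr rfl fun ν _ => ?_)
    refine pd_congr_on hTo hy (fun z hz => ?_) ν
    simp only [hΦ, Set.indicator_of_mem hz]
  rw [setIntegral_congr_fun hTo.measurableSet h1,
    setIntegral_eq_integral_of_forall_compl_eq_zero, integral_finsetSum]
  · exact Finset.sum_eq_zero fun ν _ => integral_pd_eq_zero (hs ν) (hcs ν) ν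
  · intro ν _
    refine Continuous.integrable_of_hasCompactSupport ?_ ((hcs ν).fderiv_apply ℝ _)
    exact ((hs ν).continuous_fderiv one_ne_zero).clm_apply continuous_const
  · intro z hzT
    have hz' : z ∈ (chartAt E4 p '' K)ᶜ := fun ⟨q, hq, h⟩ =>
      hzT (h ▸ (chartAt E4 p).map_source (hKp hq))
    refine Finset.sum_eq_zero fun ν _ => ?_
    rw [pd, (Filter.eventuallyEq_of_mem (hC.isClosed.isOpen_compl.mem_nhds hz')
      fun w hw => hz ν w hw : Φ ν =ᶠ[nhds z] fun _ => 0).fderiv_eq]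
    simp

variable [SecondCountableTopology M]

/-- The integral of a Poisson bracket with a compactly supported function vanishes. -/
theorem integral_br (f k : smoothFunctions M) {K : Set M} (hK : IsCompact K)
    (hk : ∀ q, q ∉ K → ev q k = 0) :
    ∫ q, ev q (B.poisson.m * B.poisson.br f k) ∂B.vol = 0 := by
  have : LocallyCompactSpace M := ChartedSpace.locallyCompactSpace E4 M
  obtain ⟨t, ht⟩ := hK.elim_finite_subcover (fun p : M => (chartAt E4 p).source)
    (fun p => (chartAt E4 p).open_source) fun q _ => Set.mem_iUnion.2 ⟨q, mem_chart_source E4 q⟩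
  -- Only the second argument of the bracket needs a small support, so only k is decomposed.
  obtain ⟨φ, hφ⟩ := SmoothPartitionOfUnity.exists_isSubordinate (𝓡 4) hK.isClosed
    (fun p : t => (chartAt E4 (p : M)).source) (fun p => (chartAt E4 (p : M)).open_source)
    (by simpa [Set.iUnion_subtype] using ht)
  have hφs : ∀ i, IsSmooth fun q => (φ i q : ℂ) := fun i =>
    Complex.ofRealCLM.contDiff.contMDiff.comp (φ i).contMDiff
  set ψ : t → smoothFunctions M := fun i => ⟨_, hφs i⟩ with hψ
  have hsum : k = ∑ i, ψ i * k := by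
    refine Subtype.ext (funext fun q => ?_)
    change ev q k = ev q (∑ i, ψ i * k)
    rw [map_sum]
    simp only [map_mul, ← Finset.sum_mul]
    by_cases hq : q ∈ K
    · have h1 := φ.sum_eq_one hq
      rw [finsum_eq_sum_of_fintype] at h1
      have h2 : ∑ i, ev q (ψ i) = ((∑ i, φ i q : ℝ) : ℂ) := by
        rw [Complex.ofReal_sum]; rfl
      rw [h2, h1, Complex.ofReal_one, one_mul]
    · rw [hk q hq, mul_zero]
  have hk' : ∀ i q, q ∉ K → ev q (ψ i * k) = 0 := fun i q hq => by rw [map_mul, hk q hq, mul_zero]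
  rw [hsum, PoissonEmbedding.br_sum, Finset.mul_sum]
  simp only [map_sum]
  rw [integral_finsetSum]
  · refine Finset.sum_eq_zero fun i _ => ?_
    refine B.integral_br_of_chart (p := i) f (ψ i * k) (K := K ∩ tsupport (φ i))
      (hK.inter_right (isClosed_tsupport _)) (Set.inter_subset_right.trans (hφ i)) fun q hq => ?_
    by_cases h : q ∈ K
    · have h1 : φ i q = 0 := image_eq_zero_of_notMem_tsupport fun h' => hq ⟨h, h'⟩
      have h2 : ev q (ψ i) = 0 := by
        change ((φ i q : ℝ) : ℂ) = 0
        rw [h1, Complex.ofReal_zero]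
      rw [map_mul, h2, zero_mul]
    · exact hk' i q h
  · intro i _
    refine B.integrable_of_eq_zero (continuous_ev _) hK fun q hq => ?_
    rw [map_mul, B.ev_br_eq_zero hK.isClosed (hk' i) hq, mul_zero]

end Brane

end

/-! ### Flatness outside K: compact support of Lagrangians and divergences -/

section

open Patch

namespace PoissonEmbedding

section

variable {A : Type*} [CommRing A] {D : ℕ} (P : PoissonEmbedding A D) {I : Ideal A}

/-- Writes a divergence as a sum of brackets divided by e^σ, the form in which `integral_br` shows
that it integrates to zero. -/
theorem dv_eq (f k : A) :
    P.dv f k = ∑ a, P.m * P.br (P.x a) (P.e a * (f * P.br (P.x a) k)) := by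
  rw [dv, lap, box, inn]
  simp only [Finset.mul_sum, ← Finset.sum_add_distrib]
  exact Finset.sum_congr rfl fun a _ => by rw [br_e_mul, br_mul]; ring

theorem e_mul_dv (a : Fin D) (f k : A) : P.e a * P.dv f k = P.dv (P.e a * f) k := by
  rw [dv, dv, P.inn_comm (P.e a * f), inn_e_mul, P.inn_comm k]
  ring

theorem m_mul_H (a b : Fin D) : P.m * P.H a b = P.u a b := by
  rw [H_eq]; linear_combination P.u a b * P.l_mul_m

/-- The elements whose brackets lie in an ideal. -/
def central (I : Ideal A) : Subring A where
  carrier := {k | ∀ f, P.br f k ∈ I}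
  zero_mem' f := by rw [br_zero]; exact I.zero_mem
  one_mem' f := by rw [br_one]; exact I.zero_mem
  add_mem' hk hk' f := by rw [br_add]; exact I.add_mem (hk f) (hk' f)
  neg_mem' hk f := by rw [br_neg]; exact I.neg_mem (hk f)
  mul_mem' hk hk' f := by
    rw [br_mul]; exact I.add_mem (I.mul_mem_left _ (hk' f)) (I.mul_mem_right _ (hk f))

theorem e_mem_central (a : Fin D) : P.e a ∈ P.central I := fun f => by
  rw [br_e]; exact I.zero_mem

/-- A Poisson ideal modulo which the brackets `{x^a, x^b}` and `l` are central. -/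
structure IsFlat (I : Ideal A) : Prop where
  br_mem : ∀ f, ∀ k ∈ I, P.br f k ∈ I
  br_x : ∀ a b, P.br (P.x a) (P.x b) ∈ P.central I
  l_mem : P.l ∈ P.central I

theorem H_mem_central (h : ∀ a b, P.br (P.x a) (P.x b) ∈ P.central I) (a b : Fin D) :
    P.H a b ∈ P.central I :=
  sum_mem fun c _ => mul_mem (P.e_mem_central c) (mul_mem (h a c) (h b c))

theorem trH_mem_central (h : ∀ a b, P.br (P.x a) (P.x b) ∈ P.central I) :
    P.trH ∈ P.central I :=
  sum_mem fun a _ => mul_mem (P.e_mem_central a) (P.H_mem_central h a a)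

namespace IsFlat

variable {P} (h : P.IsFlat I) {f k : A}

include h

theorem m_mem : P.m ∈ P.central I := by
  intro f
  have h1 := P.br_mul f P.l P.m
  rw [P.l_mul_m, br_one] at h1
  have h2 : P.br f P.m = -(P.m * P.m * P.br f P.l) := by
    linear_combination -P.m * h1 - P.br f P.m * P.l_mul_m
  rw [h2]
  exact I.neg_mem (I.mul_mem_left _ (h.l_mem f))

theorem u_mem (a b : Fin D) : P.u a b ∈ P.central I := by
  rw [← P.m_mul_H]; exact mul_mem h.m_mem (P.H_mem_central h.br_x a b)

theorem box_mem (hk : k ∈ P.central I) : P.box k ∈ I :=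
  sum_mem fun a _ => I.mul_mem_left _ (h.br_mem _ _ (hk (P.x a)))

theorem box_x_mem (c : Fin D) : P.box (P.x c) ∈ I :=
  sum_mem fun a _ => I.mul_mem_left _ (h.br_x a c (P.x a))

theorem lap_mem (hk : k ∈ P.central I) : P.lap k ∈ I := I.mul_mem_left _ (h.box_mem hk)

theorem lap_x_mem (c : Fin D) : P.lap (P.x c) ∈ I := I.mul_mem_left _ (h.box_x_mem c)

omit h in
theorem inn_mem (hk : k ∈ P.central I) : P.inn f k ∈ I :=
  I.mul_mem_left _ (sum_mem fun a _ => I.mul_mem_left _ (I.mul_mem_left _ (hk (P.x a))))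

theorem inn_mem' (hk : k ∈ I) : P.inn f k ∈ I :=
  inn_mem fun f => h.br_mem f k hk

theorem innLap_mem : P.innLap f ∈ I :=
  sum_mem fun a _ => I.mul_mem_left _ (I.mul_mem_right _ (h.lap_x_mem a))

theorem bare_mem : P.bare ∈ I := by
  refine I.add_mem (sum_mem fun a _ => sum_mem fun b _ => I.mul_mem_left _ (I.mul_mem_left _
    (h.box_mem (P.H_mem_central h.br_x a b)))) (I.mul_mem_left _ (sum_mem fun c _ => ?_))
  exact I.mul_mem_left _ (I.mul_mem_right _ (h.box_x_mem c))

theorem HH_mem : P.HH ∈ I :=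
  sum_mem fun _ _ => sum_mem fun b _ => I.mul_mem_left _ (I.mul_mem_left _
    (h.br_mem _ _ (P.trH_mem_central h.br_x (P.x b))))

variable {N : AddSubgroup A} (hN : ∀ f, ∀ k ∈ I, P.m * P.br f k ∈ N)

include hN

-- It suffices that the products f{x^a, k} lie in the ideal; neither factor alone has to.
omit h in
theorem dv_mem (hf : ∀ a, f * P.br (P.x a) k ∈ I) : P.dv f k ∈ N := by
  rw [dv_eq]
  exact sum_mem fun a _ => hN _ _ (I.mul_mem_left _ (hf a))

omit h in
theorem dv_mem_central (hk : k ∈ P.central I) : P.dv f k ∈ N :=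
  dv_mem hN fun a => I.mul_mem_left _ (hk (P.x a))

/-- In the first family of divergences the coefficient □x^b lies in the ideal, in the last one the
differential of l does. -/
theorem bareDv_mem : P.bareDv ∈ N := by
  refine N.add_mem (sum_mem fun a _ => sum_mem fun b _ => ?_) (dv_mem_central hN h.l_mem)
  rw [mul_assoc, e_mul_dv, e_mul_dv]
  exact dv_mem hN fun _ => I.mul_mem_right _ (I.mul_mem_left _ (I.mul_mem_left _
    (I.mul_mem_left _ (I.mul_mem_left _ (h.lap_x_mem b)))))

theorem HHdv_mem : P.m * P.HHdv ∈ N := by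
  rw [HHdv, Finset.mul_sum]
  refine sum_mem fun a _ => ?_
  rw [Finset.mul_sum]
  refine sum_mem fun b _ => ?_
  rw [mul_assoc (P.e a), ← br_e_mul, ← br_e_mul]
  exact hN _ _ (I.mul_mem_left _ (I.mul_mem_left _ (I.mul_mem_left _
    (P.trH_mem_central h.br_x (P.x b)))))

end IsFlat

end

end PoissonEmbedding

variable {M : Type*} [TopologicalSpace M] [ChartedSpace E4 M]

/-- The smooth functions that vanish outside of `K`. -/
def vanishingIdeal (K : Set M) : Ideal (smoothFunctions M) where
  carrier := {f | ∀ q, q ∉ K → ev q f = 0}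
  zero_mem' _ _ := rfl
  add_mem' hf hk q hq := by rw [map_add, hf q hq, hk q hq, add_zero]
  smul_mem' c f hf q hq := by rw [smul_eq_mul, map_mul, hf q hq, mul_zero]

theorem smul_mem_vanishingIdeal {K : Set M} {f : smoothFunctions M} (c : ℂ)
    (hf : f ∈ vanishingIdeal K) : c • f ∈ vanishingIdeal K := fun q hq => by
  rw [map_smul, hf q hq, smul_zero]

namespace Brane

variable {D : ℕ} [T2Space M] [IsManifold (𝓡 4) ∞ M] (B : Brane D M) {K : Set M}

theorem uSq_eq : 2 * B.poisson.uSq = B.poisson.τ * B.poisson.τ - 8 := by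
  refine Subtype.ext (funext fun q => ?_)
  change ev q (2 * B.poisson.uSq) = ev q (B.poisson.τ * B.poisson.τ - 8)
  rw [map_mul, map_sub, map_mul, map_ofNat, map_ofNat, B.ev_uSq, B.ev_τ]
  ring

/-- Outside of `K`, a brane that is flat there has constant brackets and constant `σ`. -/
theorem isFlat (hK : IsClosed K) (hB : B.FlatOutside K) : B.poisson.IsFlat (vanishingIdeal K) := by
  have hx : ∀ a b, B.poisson.br (B.poisson.x a) (B.poisson.x b)
      ∈ B.poisson.central (vanishingIdeal K) := by
    intro a b f q hq
    change B.θ q (differential f q) (differential (B.bracket (B.emb a) (B.emb b)) q) = 0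
    rw [hB q hq, map_zero]
  refine ⟨fun f k hk q hq => B.ev_br_eq_zero hK hk hq, hx, ?_⟩
  set S := ∑ a, ∑ b, B.poisson.e a * B.poisson.e b * (B.poisson.H a b * B.poisson.H a b) with hS
  have hSm : S ∈ B.poisson.central (vanishingIdeal K) := sum_mem fun a _ => sum_mem fun b _ =>
    mul_mem (mul_mem (B.poisson.e_mem_central a) (B.poisson.e_mem_central b))
      (mul_mem (B.poisson.H_mem_central hx a b) (B.poisson.H_mem_central hx a b))
  have hSl : S = B.poisson.l * B.poisson.l * B.poisson.uSq := by
    rw [hS, PoissonEmbedding.uSq, Finset.mul_sum]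
    refine Finset.sum_congr rfl fun a _ => ?_
    rw [Finset.mul_sum]
    exact Finset.sum_congr rfl fun b _ => by rw [PoissonEmbedding.H_eq]; ring
  -- With H = e^σ u and `uSq_eq` this recovers e^{2σ} from the brackets {x^a, x^b} alone; so
  -- constancy of the brackets implies constancy of σ.
  have hl : 8 * (B.poisson.l * B.poisson.l) = B.poisson.trH * B.poisson.trH - 2 * S := by
    rw [hSl, PoissonEmbedding.trH_eq]
    linear_combination B.poisson.l * B.poisson.l * B.uSq_eq
  have h2 : 8 * (B.poisson.l * B.poisson.l) ∈ B.poisson.central (vanishingIdeal K) := by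
    rw [hl, two_mul]
    exact sub_mem (mul_mem (B.poisson.trH_mem_central hx) (B.poisson.trH_mem_central hx))
      (add_mem hSm hSm)
  intro f q hq
  have h3 := h2 f q hq
  -- The multiple is spelled out as a sum, so that additivity and the Leibniz rule alone give 16
  -- e^σ{f, e^σ} = 0.
  rw [show 8 * (B.poisson.l * B.poisson.l) = B.poisson.l * B.poisson.l + B.poisson.l * B.poisson.l
    + B.poisson.l * B.poisson.l + B.poisson.l * B.poisson.l + B.poisson.l * B.poisson.l
    + B.poisson.l * B.poisson.l + B.poisson.l * B.poisson.l + B.poisson.l * B.poisson.l by ring] at h3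
  simp only [PoissonEmbedding.br_add, PoissonEmbedding.br_mul, map_add, map_mul, ev_l] at h3
  have h4 : (16 * B.ell q) * ev q (B.poisson.br f B.poisson.l) = 0 := by linear_combination h3
  exact (mul_eq_zero.1 h4).resolve_left (mul_ne_zero (by norm_num) (B.ell_ne_zero q))

/-- Every term of Bochner's formula contains a derivative of some u or of some □x, and the u are
constant and the □x zero in the flat region. -/
theorem ricF_mem (h : B.poisson.IsFlat (vanishingIdeal K)) (a b : Fin D) :
    B.ricF a b ∈ vanishingIdeal K := by
  have hu := fun a b => h.u_mem a b
  have h1 : ∀ a c d, B.hessF a c d ∈ vanishingIdeal K := fun a c d => by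
    refine smul_mem_vanishingIdeal _ (Ideal.sub_mem _ (Ideal.add_mem _ ?_ ?_) ?_) <;>
    · rw [PoissonEmbedding.inn_comm]; exact PoissonEmbedding.IsFlat.inn_mem (hu _ _)
  refine Ideal.sub_mem _ (smul_mem_vanishingIdeal _ (Ideal.sub_mem _ (Ideal.sub_mem _
    (h.lap_mem (hu a b)) (h.inn_mem' (h.lap_x_mem b))) (h.inn_mem' (h.lap_x_mem a)))) ?_
  exact sum_mem fun c _ => sum_mem fun d _ => sum_mem fun e _ => sum_mem fun k _ =>
    Ideal.mul_mem_right _ _ (Ideal.mul_mem_right _ _ (h1 a c d))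

theorem ricGgGF_mem (h : B.poisson.IsFlat (vanishingIdeal K)) : B.ricGgGF ∈ vanishingIdeal K :=
  sum_mem fun a _ => Ideal.mul_mem_left _ _ (B.ricF_mem h a a)

theorem scalGF_mem (h : B.poisson.IsFlat (vanishingIdeal K)) : B.scalGF ∈ vanishingIdeal K :=
  Ideal.sub_mem _ (smul_mem_vanishingIdeal _ (Ideal.mul_mem_left _ _ (B.ricGgGF_mem h)))
    (sum_mem fun a _ => sum_mem fun b _ => Ideal.mul_mem_left _ _
      (Ideal.mul_mem_left _ _ (B.ricF_mem h a b)))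

theorem ricgF_mem (h : B.poisson.IsFlat (vanishingIdeal K)) : B.ricgF ∈ vanishingIdeal K :=
  Ideal.sub_mem _ (smul_mem_vanishingIdeal _ (Ideal.mul_mem_left _ _ (B.scalGF_mem h)))
    (B.ricGgGF_mem h)

/-- The first geometric Lagrangian as a smooth function. -/
def densityBareF : smoothFunctions M := B.poisson.l * (B.poisson.l * (4 * B.ricGgGF - 2 * B.scalGF)
  + 4 * B.poisson.lap B.poisson.l - 4 * B.poisson.innLap B.poisson.l)

/-- The second geometric Lagrangian as a smooth function. -/
def densityRF : smoothFunctions M := B.poisson.l * (B.poisson.l * (3 * B.scalGF - 2 * B.ricgF)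
  - 2 * B.poisson.innLap B.poisson.l)

/-- The third geometric Lagrangian as a smooth function. -/
def densityRtildeF : smoothFunctions M :=
  B.poisson.l * (B.poisson.l * (3 * B.scalGF - 2 * B.ricgF))

theorem densityBare_eq (q : M) : B.densityBare q = ev q B.densityBareF := by
  have h1 := B.boxExp_eq q
  have h2 := B.divgdσ_eq q
  rw [densityBare, exp_two_σ, densityBareF, B.ricGgG_eq, B.scalG_eq]
  simp only [map_mul, map_add, map_sub, map_ofNat, ev_l]
  linear_combination 4 * B.ell q * h1 + 4 * B.ell q * h2

theorem densityR_eq_ev (q : M) : B.densityR q = ev q B.densityRF := by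
  have h2 := B.divgdσ_eq q
  rw [densityR, exp_two_σ, densityRF, B.ricg_eq, B.scalG_eq]
  simp only [map_mul, map_sub, map_ofNat, ev_l]
  linear_combination 2 * B.ell q * h2

theorem densityRtilde_eq (q : M) : B.densityRtilde q = ev q B.densityRtildeF := by
  rw [densityRtilde, exp_two_σ, densityRtildeF, B.ricg_eq, B.scalG_eq]
  simp only [map_mul, map_sub, map_ofNat, ev_l]
  ring

theorem densityBareF_mem (h : B.poisson.IsFlat (vanishingIdeal K)) :
    B.densityBareF ∈ vanishingIdeal K := by
  refine Ideal.mul_mem_left _ _ (Ideal.sub_mem _ (Ideal.add_mem _ (Ideal.mul_mem_left _ _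
    (Ideal.sub_mem _ ?_ ?_)) ?_) ?_) <;> refine Ideal.mul_mem_left _ _ ?_
  exacts [B.ricGgGF_mem h, B.scalGF_mem h, h.lap_mem h.l_mem, h.innLap_mem]

theorem densityRtildeF_mem (h : B.poisson.IsFlat (vanishingIdeal K)) :
    B.densityRtildeF ∈ vanishingIdeal K := by
  refine Ideal.mul_mem_left _ _ (Ideal.mul_mem_left _ _
    (Ideal.sub_mem _ ?_ ?_)) <;> refine Ideal.mul_mem_left _ _ ?_
  exacts [B.scalGF_mem h, B.ricgF_mem h]

theorem densityRF_mem (h : B.poisson.IsFlat (vanishingIdeal K)) :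
    B.densityRF ∈ vanishingIdeal K := by
  refine Ideal.mul_mem_left _ _ (Ideal.sub_mem _ (Ideal.mul_mem_left _ _
    (Ideal.sub_mem _ ?_ ?_)) ?_) <;> refine Ideal.mul_mem_left _ _ ?_
  exacts [B.scalGF_mem h, B.ricgF_mem h, h.innLap_mem]

theorem lagR_mem (h : B.poisson.IsFlat (vanishingIdeal K)) : B.lagR ∈ vanishingIdeal K :=
  Ideal.sub_mem _ (smul_mem_vanishingIdeal _ (Ideal.mul_mem_left _ _ h.bare_mem))
    (smul_mem_vanishingIdeal _ (Ideal.mul_mem_left _ _ (Ideal.mul_mem_left _ _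
      (h.box_mem (B.poisson.trH_mem_central h.br_x)))))

theorem lagRtilde_mem (h : B.poisson.IsFlat (vanishingIdeal K)) :
    B.lagRtilde ∈ vanishingIdeal K :=
  Ideal.sub_mem _ (smul_mem_vanishingIdeal _ (Ideal.mul_mem_left _ _ h.bare_mem))
    (smul_mem_vanishingIdeal _ (Ideal.mul_mem_left _ _ h.HH_mem))

variable [MeasurableSpace M] [BorelSpace M]

theorem integrable_of_mem (hK : IsCompact K) {f : smoothFunctions M} (hf : f ∈ vanishingIdeal K) :
    Integrable (fun q => ev q f) B.vol :=
  B.integrable_of_eq_zero (continuous_ev f) hK hf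

/-- The smooth functions with support in `K` and vanishing integral. -/
def nullFunctions (hK : IsCompact K) : Submodule ℂ (smoothFunctions M) where
  carrier := {f | f ∈ vanishingIdeal K ∧ ∫ q, ev q f ∂B.vol = 0}
  zero_mem' := ⟨Ideal.zero_mem _, by simp⟩
  add_mem' {f k} hf hk := by
    refine ⟨Ideal.add_mem _ hf.1 hk.1, ?_⟩
    simp only [map_add]
    rw [integral_add (B.integrable_of_mem hK hf.1) (B.integrable_of_mem hK hk.1), hf.2, hk.2,
      add_zero]
  smul_mem' c f hf := by
    refine ⟨smul_mem_vanishingIdeal c hf.1, ?_⟩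
    simp only [map_smul]
    rw [integral_smul, hf.2, smul_zero]

variable [SecondCountableTopology M]

theorem br_mem_nullFunctions (hK : IsCompact K) (f k : smoothFunctions M)
    (hk : k ∈ vanishingIdeal K) :
    B.poisson.m * B.poisson.br f k ∈ (B.nullFunctions hK).toAddSubgroup :=
  ⟨Ideal.mul_mem_left _ _ fun _ hq => B.ev_br_eq_zero hK.isClosed hk hq, B.integral_br f k hK hk⟩

variable (hK : IsCompact K) (h : B.poisson.IsFlat (vanishingIdeal K))

include h

theorem bareDv_mem : B.poisson.bareDv ∈ B.nullFunctions hK :=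
  h.bareDv_mem (B.br_mem_nullFunctions hK)

omit h in
theorem dv_mem {f k : smoothFunctions M} (hk : k ∈ B.poisson.central (vanishingIdeal K)) :
    B.poisson.dv f k ∈ B.nullFunctions hK :=
  PoissonEmbedding.IsFlat.dv_mem_central (B.br_mem_nullFunctions hK) hk

theorem divR_mem : B.divR ∈ B.nullFunctions hK :=
  sub_mem (add_mem (Submodule.smul_mem _ _ (B.bareDv_mem hK h))
    (Submodule.smul_mem _ _ (B.dv_mem hK h.l_mem)))
    (Submodule.smul_mem _ _ (B.dv_mem hK (B.poisson.trH_mem_central h.br_x)))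

theorem divRtilde_mem : B.divRtilde ∈ B.nullFunctions hK :=
  sub_mem (add_mem (Submodule.smul_mem _ _ (B.bareDv_mem hK h))
    (Submodule.smul_mem _ _ (B.dv_mem hK h.l_mem)))
    (Submodule.smul_mem _ _ (h.HHdv_mem (B.br_mem_nullFunctions hK)))

end Brane

end

/-! ### From pointwise errors to integrals; the case G = g -/

section

open Patch

theorem christoffel_congr_on {G g : E4 → Mat4} {s : Set E4} (hs : IsOpen s) {y : E4} (hy : y ∈ s)
    (h : ∀ z ∈ s, G z = g z) (l m n : Fin 4) : christoffel G y l m n = christoffel g y l m n := by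
  have h1 : ∀ i m n, pd i (fun z => G z m n) y = pd i (fun z => g z m n) y := fun i m n =>
    pd_congr_on hs hy (fun z hz => by rw [h z hz]) i
  simp only [christoffel, h1, h y hy]

theorem ricci_congr_on {G g : E4 → Mat4} {s : Set E4} (hs : IsOpen s) {y : E4} (hy : y ∈ s)
    (h : ∀ z ∈ s, G z = g z) (m n : Fin 4) : ricci G y m n = ricci g y m n := by
  have h1 : ∀ i l m n, pd i (fun z => christoffel G z l m n) y
      = pd i (fun z => christoffel g z l m n) y := fun i l m n =>
    pd_congr_on hs hy (fun z hz => christoffel_congr_on hs hz h l m n) i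
  simp only [ricci, h1, christoffel_congr_on hs hy h]

variable {M : Type*} [TopologicalSpace M] [ChartedSpace E4 M]

theorem norm_le_sqrt_sum {ι : Type*} [Fintype ι] (z : ι → ℂ) (i : ι) :
    ‖z i‖ ≤ Real.sqrt (∑ i, ‖z i‖ ^ 2) :=
  Real.le_sqrt_of_sq_le (Finset.single_le_sum (f := fun i => ‖z i‖ ^ 2)
    (fun _ _ => sq_nonneg _) (Finset.mem_univ i))

theorem norm_le_sqrt_sum₂ {ι κ : Type*} [Fintype ι] [Fintype κ] (z : ι → κ → ℂ) (i : ι) (j : κ) :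
    ‖z i j‖ ≤ Real.sqrt (∑ i, ∑ j, ‖z i j‖ ^ 2) := by
  rw [← Fintype.sum_prod_type' (f := fun i j => ‖z i j‖ ^ 2)]
  exact norm_le_sqrt_sum (fun p : ι × κ => z p.1 p.2) (i, j)

theorem norm_le_sqrt_sum₃ {ι κ τ : Type*} [Fintype ι] [Fintype κ] [Fintype τ]
    (z : ι → κ → τ → ℂ) (i : ι) (j : κ) (k : τ) :
    ‖z i j k‖ ≤ Real.sqrt (∑ i, ∑ j, ∑ k, ‖z i j k‖ ^ 2) := by
  simp only [← Fintype.sum_prod_type' (f := fun j k => ‖z _ j k‖ ^ 2)]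
  exact norm_le_sqrt_sum₂ (fun i (p : κ × τ) => z i p.1 p.2) i (j, k)

namespace Brane

variable {D : ℕ} [T2Space M] [IsManifold (𝓡 4) ∞ M] (B : Brane D M) {K : Set M}

/-- The errors of the three Lagrangians are bounded by the error density. -/
theorem norm_err_le {F : M → Matrix (Fin 4) (Fin 4) ℝ} (hF : B.IsOrthonormalFrame F) {q : M}
    (hq : B.hSq F q ≤ (1 / 100) ^ 2) :
    ‖B.ell q ^ 2 * (B.patch q).errBare (B.dσ q) (chartAt E4 q q)‖ ≤ 2 ^ 31 * B.errorDensity F q ∧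
    ‖B.ell q ^ 2 * (B.patch q).errR (B.dσ q) (chartAt E4 q q)‖ ≤ 2 ^ 31 * B.errorDensity F q ∧
    ‖B.ell q ^ 2 * (B.patch q).errRtilde (B.dσ q) (chartAt E4 q q)‖
      ≤ 2 ^ 31 * B.errorDensity F q := by
  obtain ⟨ε, hε, hFF⟩ := hF q
  have h0 : ∀ {ι : Type} (s : Finset ι) (f : ι → ℝ), (∀ i, 0 ≤ f i) → 0 ≤ ∑ i ∈ s, f i :=
    fun s f hf => Finset.sum_nonneg fun i _ => hf i
  have h1 : 0 ≤ B.hSq F q := h0 _ _ fun _ => h0 _ _ fun _ => sq_nonneg _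
  have h2 : 0 ≤ B.nablahSq F q := h0 _ _ fun _ => h0 _ _ fun _ => h0 _ _ fun _ => sq_nonneg _
  have h3 : 0 ≤ B.dσSq F q := h0 _ _ fun _ => sq_nonneg _
  have h4 := PatchBrane.err_bound (P := B.patch q) (F := (F q).map Complex.ofReal)
    (v := B.dσ q) (a := Real.sqrt (B.hSq F q)) (b := Real.sqrt (B.nablahSq F q))
    (s := Real.sqrt (B.dσSq F q)) (r := B.ricNorm F q) (chart_mem q) hε hFF
    (fun i j => norm_le_sqrt_sum₂ _ i j) (Real.sqrt_le_iff.2 ⟨by norm_num, hq⟩)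
    (fun k i j => norm_le_sqrt_sum₃ _ k i j) (fun i => norm_le_sqrt_sum _ i)
    (fun i j => norm_le_sqrt_sum₂ _ i j)
  rw [Real.sq_sqrt h1, Real.sq_sqrt h2, Real.sq_sqrt h3] at h4
  have h5 : ∀ z : ℂ, BoundedBy (B.nablahSq F q + B.hSq F q * (B.dσSq F q + B.ricNorm F q)) (2 ^ 31) z
      → ‖B.ell q ^ 2 * z‖ ≤ 2 ^ 31 * B.errorDensity F q := by
    intro z hz
    rw [norm_mul, ← exp_two_σ, Complex.norm_real, Real.norm_of_nonneg (Real.exp_pos _).le,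
      errorDensity]
    calc _ ≤ _ := mul_le_mul_of_nonneg_left hz (Real.exp_pos _).le
      _ = _ := by ring
  exact ⟨h5 _ h4.1, h5 _ h4.2.1, h5 _ h4.2.2⟩

variable [MeasurableSpace M] [BorelSpace M]

/-- Lagrangians that agree up to a divergence and a pointwise error. -/
theorem integral_sub_le (hK : IsCompact K) {lag div L : smoothFunctions M}
    (hlag : lag ∈ vanishingIdeal K) (hdiv : div ∈ B.nullFunctions hK) (hL : L ∈ vanishingIdeal K)
    {err : M → ℝ} {C : ℝ} (hC : 0 ≤ C) (h : ∀ q, ‖ev q lag - ev q div - ev q L‖ ≤ C * err q) :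
    ENNReal.ofReal ‖(∫ q, ev q lag ∂B.vol) - ∫ q, ev q L ∂B.vol‖
      ≤ ENNReal.ofReal C * ∫⁻ q, ENNReal.ofReal (err q) ∂B.vol := by
  have h1 := B.integrable_of_mem hK hlag
  have h2 := B.integrable_of_mem hK hdiv.1
  have h3 := B.integrable_of_mem hK hL
  have h4 : (∫ q, ev q lag ∂B.vol) - ∫ q, ev q L ∂B.vol
      = ∫ q, (ev q lag - ev q div - ev q L) ∂B.vol := by
    have h5 := integral_sub (f := fun q => ev q lag - ev q div) (h1.sub h2) h3
    rw [h5, integral_sub h1 h2, hdiv.2, sub_zero]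
  rw [h4, ofReal_norm, ← lintegral_const_mul' _ _ ENNReal.ofReal_ne_top]
  refine (enorm_integral_le_lintegral_enorm _).trans (lintegral_mono fun q => ?_)
  rw [← ofReal_norm, ← ENNReal.ofReal_mul hC]
  exact ENNReal.ofReal_le_ofReal (h q)

theorem integral_eq_of_sub_eq_zero (hK : IsCompact K) {lag div L : smoothFunctions M}
    (hlag : lag ∈ vanishingIdeal K) (hdiv : div ∈ B.nullFunctions hK) (hL : L ∈ vanishingIdeal K)
    (h : ∀ q, ev q lag - ev q div - ev q L = 0) :
    ∫ q, ev q lag ∂B.vol = ∫ q, ev q L ∂B.vol := by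
  have h1 := B.integral_sub_le hK hlag hdiv hL (err := 0) le_rfl fun q => by simp [h q]
  simpa [sub_eq_zero] using h1

omit [MeasurableSpace M] [BorelSpace M]

omit [T2Space M] [IsManifold (𝓡 4) ∞ M] in
/-- If `G = g`, the last two geometric Lagrangians are the Einstein-Hilbert one. -/
theorem densityRtilde_eq_densityEH (hG : ∀ q, ∀ y ∈ (chartAt E4 q).target, B.G q y = B.g q y)
    (q : M) : B.densityRtilde q = B.densityEH q := by
  have hy := chart_mem q
  have h1 : B.scalg q = B.scalG q := by
    rw [scalg, scalG, scalarCurvature, scalarCurvature, ricciContract, ricciContract, hG q _ hy]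
    simp only [ricci_congr_on (chartAt E4 q).open_target hy (hG q)]
  have h2 : B.ricg q = B.scalG q := by
    rw [ricg, gInv, ← hG q _ hy]; rfl
  rw [densityEH, densityRtilde, h1, h2]
  ring

/-- The extra term with ∇g vanishes because it is built from the tangential part of □x, which is
zero for G = g. -/
theorem densityR_eq_densityEH (hG : ∀ q, ∀ y ∈ (chartAt E4 q).target, B.G q y = B.g q y)
    (q : M) : B.densityR q = B.densityEH q := by
  have h := B.divgdσ_eq q
  rw [B.ev_innLap, PatchBrane.trLap_eq_zero (P := B.patch q) (hG q) (chart_mem q),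
    Matrix.mulVec_zero, dotProduct_zero, neg_zero] at h
  rw [← B.densityRtilde_eq_densityEH hG, densityRtilde, densityR,
    (mul_eq_zero.1 h).resolve_left (B.ell_ne_zero q), mul_zero, add_zero]

end Brane

end

/-! ### Orders in ħ, symbols of the matrix Lagrangians, and traces -/

section

variable {M : Type*} [TopologicalSpace M] [ChartedSpace E4 M] [MeasurableSpace M]

namespace Quantization

variable {D : ℕ} {B : Brane D M} {𝒜 : Type*} [Ring 𝒜] [Algebra ℂ 𝒜] (Q : Quantization B 𝒜)

/-- The symbol as a smooth function. -/
def symbolF : 𝒜 →ₐ[ℂ] smoothFunctions M := Q.symbol.codRestrict _ Q.symbol_smooth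

/-- `A = ħ^k C` for an operator `C` with the symbol `f`. -/
def HasOrder (k : ℕ) (A : 𝒜) (f : smoothFunctions M) : Prop :=
  ∃ C, A = Q.hbar ^ k * C ∧ Q.symbolF C = f

theorem commute_pow (k : ℕ) (A : 𝒜) : Q.hbar ^ k * A = A * Q.hbar ^ k :=
  (show Commute Q.hbar A from Q.hbar_central A).pow_left k

namespace HasOrder

variable {Q} {k l : ℕ} {A A' : 𝒜} {f f' : smoothFunctions M}

theorem congr (h : Q.HasOrder k A f) (hA : A' = A) (hf : f' = f) : Q.HasOrder k A' f' := by
  rwa [hA, hf]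

theorem add (h : Q.HasOrder k A f) (h' : Q.HasOrder k A' f') :
    Q.HasOrder k (A + A') (f + f') := by
  obtain ⟨C, rfl, rfl⟩ := h
  obtain ⟨C', rfl, rfl⟩ := h'
  exact ⟨C + C', (mul_add _ _ _).symm, map_add _ _ _⟩

theorem smul (c : ℂ) (h : Q.HasOrder k A f) : Q.HasOrder k (c • A) (c • f) := by
  obtain ⟨C, rfl, rfl⟩ := h
  exact ⟨c • C, (mul_smul_comm _ _ _).symm, map_smul _ _ _⟩

theorem sub (h : Q.HasOrder k A f) (h' : Q.HasOrder k A' f') :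
    Q.HasOrder k (A - A') (f - f') := by
  obtain ⟨C, rfl, rfl⟩ := h
  obtain ⟨C', rfl, rfl⟩ := h'
  exact ⟨C - C', (mul_sub _ _ _).symm, map_sub _ _ _⟩

theorem zero : Q.HasOrder k 0 0 := ⟨0, (mul_zero _).symm, map_zero _⟩

theorem sum {ι : Type*} (s : Finset ι) {A : ι → 𝒜} {f : ι → smoothFunctions M}
    (h : ∀ i, Q.HasOrder k (A i) (f i)) : Q.HasOrder k (∑ i ∈ s, A i) (∑ i ∈ s, f i) := by
  choose C hC hf using h
  exact ⟨∑ i ∈ s, C i, by simp only [hC, Finset.mul_sum], by simp only [map_sum, hf]⟩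

theorem mul (h : Q.HasOrder k A f) (h' : Q.HasOrder l A' f') :
    Q.HasOrder (k + l) (A * A') (f * f') := by
  obtain ⟨C, rfl, rfl⟩ := h
  obtain ⟨C', rfl, rfl⟩ := h'
  refine ⟨C * C', ?_, map_mul _ _ _⟩
  rw [pow_add, mul_assoc, mul_assoc, ← mul_assoc C, ← Q.commute_pow l C, mul_assoc]

variable [T2Space M] [IsManifold (𝓡 4) ∞ M]

/-- Symbols commute, so a commutator lies in the kernel of the symbol map and one more ħ can be
divided out; the axiom on commutators identifies the symbol of the quotient. -/
theorem comm (h : Q.HasOrder k A f) (h' : Q.HasOrder l A' f') :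
    Q.HasOrder (k + l + 1) (Op.comm A A') (Complex.I • B.poisson.br f f') := by
  obtain ⟨C, rfl, rfl⟩ := h
  obtain ⟨C', rfl, rfl⟩ := h'
  have h1 : Q.symbol (C * C' - C' * C) = 0 := by
    rw [map_sub, map_mul, map_mul, mul_comm, sub_self]
  obtain ⟨E, hE⟩ := (Q.symbol_eq_zero_iff _).1 h1
  refine ⟨E, ?_, Subtype.ext (funext fun q => Q.symbol_commutator C C' E hE q)⟩
  have h2 : ∀ (i j : ℕ) (C C' : 𝒜),
      Q.hbar ^ i * C * (Q.hbar ^ j * C') = Q.hbar ^ (i + j) * (C * C') := fun i j C C' => by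
    rw [pow_add, mul_assoc, mul_assoc, ← mul_assoc C, ← Q.commute_pow j C, mul_assoc]
  rw [Op.comm, h2, h2, add_comm l k, ← mul_sub, hE, pow_succ, mul_assoc]

end HasOrder

variable [T2Space M] [IsManifold (𝓡 4) ∞ M] {Q}

/-- The operators `X^a` have the symbols `x^a`. -/
def IsEmbedding (Q : Quantization B 𝒜) (X : Fin D → 𝒜) : Prop :=
  ∀ a, Q.HasOrder 0 (X a) (B.poisson.x a)

theorem isEmbedding {X : Fin D → 𝒜} (hX : ∀ a, Q.symbol (X a) = B.emb a) : Q.IsEmbedding X :=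
  fun a => ⟨X a, by rw [pow_zero, one_mul], Subtype.ext (hX a)⟩

omit [MeasurableSpace M] [T2Space M] [IsManifold (𝓡 4) ∞ M] in
theorem ext_ev {f k : smoothFunctions M} (h : ∀ q, ev q f = ev q k) : f = k :=
  Subtype.ext (funext h)

omit [MeasurableSpace M] in
theorem br_smul (c : ℂ) (f k : smoothFunctions M) :
    B.poisson.br f (c • k) = c • B.poisson.br f k := by
  rw [Algebra.smul_def, Algebra.smul_def, PoissonEmbedding.br_mul]
  have h : B.poisson.br f (algebraMap ℂ _ c) = 0 := Subtype.ext (B.bracket_const f.2 c)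
  rw [h, zero_mul, add_zero]

namespace IsEmbedding

variable {X : Fin D → 𝒜} (hX : Q.IsEmbedding X) {k : ℕ} {A : 𝒜} {f : smoothFunctions M}

include hX

/-- Two commutators contribute ħ² and i² = -1; each pair of commutators in the actions accounts for
one sign. -/
theorem comm_comm (a b : Fin D) (h : Q.HasOrder k A f) :
    Q.HasOrder (k + 2) (Op.comm (X a) (Op.comm (X b) A))
      (-B.poisson.br (B.poisson.x a) (B.poisson.br (B.poisson.x b) f)) := by
  have h1 := (hX a).comm ((hX b).comm h)
  rw [br_smul, smul_smul, Complex.I_mul_I, neg_one_smul, zero_add, zero_add] at h1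
  exact h1

theorem box (h : Q.HasOrder k A f) :
    Q.HasOrder (k + 2) (Op.box B.η X A) (-B.poisson.box f) := by
  refine (HasOrder.sum Finset.univ fun a => (hX.comm_comm a a h).smul (B.η a : ℂ)).congr rfl
    (ext_ev fun q => ?_)
  simp only [PoissonEmbedding.box, map_neg, map_sum, map_mul, map_smul, smul_eq_mul, Brane.ev_e,
    mul_neg, Finset.sum_neg_distrib]

theorem H (a b : Fin D) : Q.HasOrder 2 (Op.H B.η X a b) (-B.poisson.H a b) := by
  have h1 := fun a b => (hX a).comm (hX b)
  refine ((HasOrder.sum Finset.univ fun c => (((h1 a c).mul (h1 b c)).add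
    ((h1 b c).mul (h1 a c))).smul (B.η c : ℂ)).smul (1 / 2)).congr rfl (ext_ev fun q => ?_)
  simp only [PoissonEmbedding.H, map_neg, map_sum, map_add, map_mul, map_smul, smul_eq_mul,
    Brane.ev_e]
  rw [← Finset.sum_neg_distrib, Finset.mul_sum]
  refine Finset.sum_congr rfl fun c _ => ?_
  linear_combination -(B.η c : ℂ) * (ev q (B.poisson.br (B.poisson.x a) (B.poisson.x c))
    * ev q (B.poisson.br (B.poisson.x b) (B.poisson.x c))) * Complex.I_mul_I

theorem trH : Q.HasOrder 2 (Op.trH B.η X) (-B.poisson.trH) := by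
  refine (HasOrder.sum Finset.univ fun a => (hX.H a a).smul (B.η a : ℂ)).congr rfl
    (ext_ev fun q => ?_)
  simp only [PoissonEmbedding.trH, map_neg, map_sum, map_mul, map_smul, smul_eq_mul, Brane.ev_e,
    mul_neg, Finset.sum_neg_distrib]

theorem boxXHXX : Q.HasOrder 6 (Op.boxXHXX B.η X)
    (-∑ c, B.poisson.e c * (B.poisson.box (B.poisson.x c) * B.poisson.Z c)) := by
  refine (HasOrder.sum Finset.univ fun a => HasOrder.sum Finset.univ fun b =>
    HasOrder.sum Finset.univ fun c => (((hX.box (hX c)).mul (hX.H a b)).mul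
      (hX.comm_comm a b (hX c))).smul ((B.η a * B.η b * B.η c : ℝ) : ℂ)).congr rfl
        (ext_ev fun q => ?_)
  simp only [PoissonEmbedding.Z, map_neg, map_sum, map_mul, map_smul, smul_eq_mul, Brane.ev_e,
    Finset.mul_sum, ← Finset.sum_neg_distrib, Complex.ofReal_mul]
  rw [Finset.sum_comm]
  refine Finset.sum_congr rfl fun a _ => ?_
  rw [Finset.sum_comm]
  exact Finset.sum_congr rfl fun b _ => Finset.sum_congr rfl fun c _ => by ring

theorem box_H (a b : Fin D) :
    Q.HasOrder 4 (Op.box B.η X (Op.H B.η X a b)) (B.poisson.box (B.poisson.H a b)) := by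
  refine (hX.box (hX.H a b)).congr rfl (ext_ev fun q => ?_)
  simp only [PoissonEmbedding.box, PoissonEmbedding.br_neg, map_neg, map_sum, map_mul, mul_neg,
    Finset.sum_neg_distrib, neg_neg]

/-- The symbol of the first matrix Lagrangian. -/
theorem opBare : Q.HasOrder 6 (Op.opBare B.η X) (-B.poisson.bare) := by
  refine ((HasOrder.sum Finset.univ fun a => HasOrder.sum Finset.univ fun b =>
    ((hX.H a b).mul (hX.box_H a b)).smul ((B.η a * B.η b : ℝ) : ℂ)).add
      (hX.boxXHXX.smul 2)).congr rfl (ext_ev fun q => ?_)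
  simp only [PoissonEmbedding.bare, map_neg, map_add, map_sum, map_mul, map_smul, map_ofNat,
    smul_eq_mul, Brane.ev_e, neg_mul, mul_neg, Finset.sum_neg_distrib, Complex.ofReal_mul, neg_add]

theorem T (a b : Fin D) : Q.HasOrder 2 (Op.T B.η X a b) (-B.poisson.H a b
    - (1 / 4 : ℂ) • if a = b then (B.η a : ℂ) • -B.poisson.trH else 0) := by
  have h2 : Q.HasOrder 2 (if a = b then (B.η a : ℂ) • Op.trH B.η X else 0)
      (if a = b then (B.η a : ℂ) • -B.poisson.trH else 0) := by
    split_ifs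
    exacts [hX.trH.smul _, HasOrder.zero]
  exact (hX.H a b).sub (h2.smul (1 / 4))

/-- The symbol of the second matrix Lagrangian. -/
theorem opR : Q.HasOrder 6 (Op.opR B.η X) (-((1 / 2 : ℂ) • B.poisson.bare
    - (1 / 8 : ℂ) • (B.poisson.trH * B.poisson.box B.poisson.trH))) := by
  refine ((HasOrder.sum Finset.univ fun a => HasOrder.sum Finset.univ fun b =>
    (((hX.T a b).mul (hX.box_H a b)).smul (1 / 2)).smul
      ((B.η a * B.η b : ℝ) : ℂ)).add hX.boxXHXX).congr rfl (ext_ev fun q => ?_)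
  have h2 : B.poisson.box B.poisson.trH = ∑ a, B.poisson.e a * B.poisson.box (B.poisson.H a a) := by
    simp only [PoissonEmbedding.box, PoissonEmbedding.trH, PoissonEmbedding.br_sum,
      PoissonEmbedding.br_e_mul, Finset.mul_sum]
    rw [Finset.sum_comm]
    exact Finset.sum_congr rfl fun a _ => Finset.sum_congr rfl fun b _ => by ring
  -- The trace part of T lives on the diagonal, where η_a² = 1 leaves the contraction that sums to
  -- H□H.
  have h3 : ∀ a b, (B.η a : ℂ) * B.η b * (1 / 2 * ((-ev q (B.poisson.H a b)
      - 1 / 4 * ev q (if a = b then (B.η a : ℂ) • -B.poisson.trH else 0))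
        * ev q (B.poisson.box (B.poisson.H a b))))
      = -(1 / 2) * ((B.η a : ℂ) * B.η b * (ev q (B.poisson.H a b)
        * ev q (B.poisson.box (B.poisson.H a b)))) + if a = b then 1 / 8 * (ev q B.poisson.trH
          * ((B.η a : ℂ) * ev q (B.poisson.box (B.poisson.H a a)))) else 0 := by
    intro a b
    split_ifs with hab
    · subst hab
      have he := congrArg (ev q) (B.poisson.e_sq a)
      rw [map_mul, map_one, Brane.ev_e] at he
      rw [map_smul, map_neg, smul_eq_mul]
      linear_combination (1 / 8 : ℂ) * (ev q B.poisson.trH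
          * ((B.η a : ℂ) * ev q (B.poisson.box (B.poisson.H a a)))) * he
    · rw [map_zero]; ring
  rw [h2, PoissonEmbedding.bare]
  simp only [map_neg, map_sub, map_add, map_sum, map_mul, map_smul, map_ofNat, smul_eq_mul,
    Brane.ev_e, Complex.ofReal_mul, h3, Finset.sum_add_distrib, ← Finset.mul_sum,
    Finset.sum_ite_eq, Finset.mem_univ, if_true]
  ring

/-- The symbol of the third matrix Lagrangian. -/
theorem opRtilde : Q.HasOrder 6 (Op.opRtilde B.η X)
    (-((1 / 2 : ℂ) • B.poisson.bare - (1 / 2 : ℂ) • B.poisson.HH)) := by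
  refine ((HasOrder.sum Finset.univ fun a => HasOrder.sum Finset.univ fun b =>
    (((hX.H a b).mul ((hX.box_H a b).sub (hX.comm_comm a b hX.trH))).smul (1 / 2)).smul
      ((B.η a * B.η b : ℝ) : ℂ)).add hX.boxXHXX).congr rfl (ext_ev fun q => ?_)
  have h3 : ∀ a b, (B.η a : ℂ) * B.η b * (1 / 2 * (-ev q (B.poisson.H a b)
      * (ev q (B.poisson.box (B.poisson.H a b)) - ev q (B.poisson.br (B.poisson.x a)
        (B.poisson.br (B.poisson.x b) B.poisson.trH)))))
      = -(1 / 2) * ((B.η a : ℂ) * B.η b * (ev q (B.poisson.H a b)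
        * ev q (B.poisson.box (B.poisson.H a b)))) + 1 / 2 * ((B.η a : ℂ) * B.η b *
          (ev q (B.poisson.H a b) * ev q (B.poisson.br (B.poisson.x a)
            (B.poisson.br (B.poisson.x b) B.poisson.trH)))) := fun a b => by ring
  rw [PoissonEmbedding.bare, PoissonEmbedding.HH]
  simp only [map_neg, map_sub, map_add, map_sum, map_mul, map_smul, map_ofNat, smul_eq_mul,
    Brane.ev_e, Complex.ofReal_mul, PoissonEmbedding.br_neg, neg_neg, h3, Finset.sum_add_distrib,
    ← Finset.mul_sum]
  ring

end IsEmbedding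

omit [T2Space M] [IsManifold (𝓡 4) ∞ M] in
variable (Q) in
theorem mem_of_pow_mul (k : ℕ) {C : 𝒜} (h : Q.hbar ^ k * C ∈ Q.traceClass) : C ∈ Q.traceClass := by
  induction k with
  | zero => simpa using h
  | succ k ih => exact ih (Q.mem_of_hbar_mul _ (by rwa [pow_succ', mul_assoc] at h))

omit [T2Space M] [IsManifold (𝓡 4) ∞ M] in
variable (Q) in
theorem tr_pow_mul (k : ℕ) {C : 𝒜} (hC : C ∈ Q.traceClass) (h : Q.hbar ^ k * C ∈ Q.traceClass) :
    Q.tr ⟨Q.hbar ^ k * C, h⟩ = PowerSeries.X ^ k * Q.tr ⟨C, hC⟩ := by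
  induction k with
  | zero => simp
  | succ k ih =>
    have h' := Q.mul_mem_left (Q.hbar ^ k) C hC
    have h1 := Q.tr_hbar ⟨_, h'⟩
    rw [ih h'] at h1
    rw [pow_succ' PowerSeries.X, mul_assoc, ← h1]
    congr 2
    rw [pow_succ', mul_assoc]

/-- The trace of an operator of order `ħ^k`. -/
theorem HasOrder.trace {k : ℕ} {A : 𝒜} {f : smoothFunctions M} (h : Q.HasOrder k A f)
    (hA : A ∈ Q.traceClass) : PowerSeries.X ^ k ∣ Q.tr ⟨A, hA⟩ ∧
      PowerSeries.coeff k (Q.tr ⟨A, hA⟩)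
        = (1 / (2 * Real.pi) ^ 2 : ℂ) * ∫ q, ev q (B.poisson.m * f) ∂B.vol := by
  obtain ⟨C, rfl, rfl⟩ := h
  have hC := Q.mem_of_pow_mul k hA
  rw [Q.tr_pow_mul k hC hA]
  refine ⟨dvd_mul_right _ _, ?_⟩
  have h1 := PowerSeries.coeff_X_pow_mul (Q.tr ⟨C, hC⟩) k 0
  rw [zero_add] at h1
  rw [h1, PowerSeries.coeff_zero_eq_constantCoeff_apply, Q.tr_leading]
  congr 2
  ext q
  rw [map_mul, Brane.ev_m, Brane.ell, Real.exp_neg, Complex.ofReal_inv]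
  rfl

end Quantization

end

/-! ### Assembling the semi-classical limit -/

section

variable {M : Type*} [TopologicalSpace M] [ChartedSpace E4 M] [T2Space M] [IsManifold (𝓡 4) ∞ M]
  [MeasurableSpace M] [BorelSpace M]

namespace Quantization

variable {D : ℕ} {B : Brane D M} {𝒜 : Type*} [Ring 𝒜] [Algebra ℂ 𝒜] {Q : Quantization B 𝒜}
  {K : Set M} {O : 𝒜} {S div L : smoothFunctions M}

omit [BorelSpace M] in
theorem HasOrder.coeff_neg {k : ℕ} (h : Q.HasOrder k O (-S)) (hO : O ∈ Q.traceClass) :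
    PowerSeries.coeff k (Q.tr ⟨O, hO⟩)
      = -((1 / (2 * Real.pi) ^ 2 : ℂ) * ∫ q, ev q (B.poisson.m * S) ∂B.vol) := by
  rw [(h.trace hO).2, ← mul_neg, ← integral_neg]
  simp only [map_mul, map_neg, mul_neg]

/-- Common end of the three proofs: the trace coefficient is the integral of the Lagrangian, the
divergence integrates to zero, and the pointwise remainder is bounded by the error density. -/
theorem HasOrder.hasSemiclassicalLimit (hK : IsCompact K) (h : Q.HasOrder 6 O (-S))
    (hO : O ∈ Q.traceClass) (hS : B.poisson.m * S ∈ vanishingIdeal K)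
    (hdiv : div ∈ B.nullFunctions hK) (hL : L ∈ vanishingIdeal K) {err : M → ℂ}
    (herr : ∀ q, ev q (B.poisson.m * S) - ev q div - ev q L = err q) {C δ : ℝ} (hC : 0 ≤ C)
    (hle : ∀ F, B.IsOrthonormalFrame F → ∀ q, B.hSq F q ≤ δ ^ 2 →
      ‖err q‖ ≤ C * B.errorDensity F q) :
    HasSemiclassicalLimit Q ⟨O, hO⟩ (fun q => ev q L) C δ := by
  refine ⟨(h.trace hO).1, B.integrable_of_mem hK hL, fun F hF hq => ?_⟩
  refine le_trans (ENNReal.ofReal_le_ofReal ?_)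
    (B.integral_sub_le hK hS hdiv hL hC fun q => (herr q).symm ▸ hle F hF q (hq q))
  rw [h.coeff_neg hO, ← mul_neg, ← mul_neg, ← mul_sub, norm_mul, neg_sub_neg, norm_sub_rev]
  -- The prefactor (2π)⁻² is at most 1 and is simply dropped from the bound.
  refine mul_le_of_le_one_left (norm_nonneg _) ?_
  have h1 : (1 : ℝ) ≤ (2 * Real.pi) ^ 2 := one_le_pow₀ (by linarith [Real.pi_gt_three])
  have h2 : ‖(1 / (2 * Real.pi) ^ 2 : ℂ)‖ = 1 / (2 * Real.pi) ^ 2 := by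
    rw [← Complex.ofReal_ofNat, ← Complex.ofReal_mul, ← Complex.ofReal_pow, norm_div, norm_one,
      Complex.norm_real, Real.norm_of_nonneg (by positivity)]
  rw [h2]
  exact (div_le_one (by positivity)).2 h1

end Quantization

namespace Brane

variable {D : ℕ} (B : Brane D M)

omit [MeasurableSpace M] [BorelSpace M] in
theorem m_mul_lagR : B.poisson.m * ((1 / 2 : ℂ) • B.poisson.bare
    - (1 / 8 : ℂ) • (B.poisson.trH * B.poisson.box B.poisson.trH)) = B.lagR := by
  rw [lagR, mul_sub, mul_smul_comm, mul_smul_comm]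

omit [MeasurableSpace M] [BorelSpace M] in
theorem m_mul_lagRtilde : B.poisson.m * ((1 / 2 : ℂ) • B.poisson.bare
    - (1 / 2 : ℂ) • B.poisson.HH) = B.lagRtilde := by
  rw [lagRtilde, mul_sub, mul_smul_comm, mul_smul_comm]

end Brane

end

end EmergentGravity

end

theorem mainTheorem5 :
    ∃ C δ : ℝ, 0 < C ∧ 0 < δ ∧
      ∀ (D : ℕ) (M : Type*) [TopologicalSpace M] [T2Space M] [SecondCountableTopology M]
        [ChartedSpace EmergentGravity.E4 M] [IsManifold (𝓡 4) ∞ M]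
        [MeasurableSpace M] [BorelSpace M]
        (B : EmergentGravity.Brane D M) (K : Set M), IsCompact K → B.FlatOutside K →
      ∀ (𝒜 : Type*) [Ring 𝒜] [Algebra ℂ 𝒜] (Q : EmergentGravity.Quantization B 𝒜)
        (X : Fin D → 𝒜), (∀ a, Q.symbol (X a) = B.emb a) →
      (∀ hO : EmergentGravity.Op.opBare B.η X ∈ Q.traceClass,
        EmergentGravity.HasSemiclassicalLimit Q ⟨_, hO⟩ B.densityBare C δ) ∧
      (∀ hO : EmergentGravity.Op.opR B.η X ∈ Q.traceClass,
        EmergentGravity.HasSemiclassicalLimit Q ⟨_, hO⟩ B.densityR C δ) ∧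
      (∀ hO : EmergentGravity.Op.opRtilde B.η X ∈ Q.traceClass,
        EmergentGravity.HasSemiclassicalLimit Q ⟨_, hO⟩ B.densityRtilde C δ) ∧
      ((∀ p : M, ∀ y ∈ (chartAt EmergentGravity.E4 p).target, B.G p y = B.g p y) →
        MeasureTheory.Integrable B.densityEH B.vol ∧
        (∀ hO : EmergentGravity.Op.opR B.η X ∈ Q.traceClass,
          PowerSeries.coeff 6 (Q.tr ⟨_, hO⟩)
            = -((1 / (2 * Real.pi) ^ 2 : ℂ) * ∫ p, B.densityEH p ∂B.vol)) ∧
        (∀ hO : EmergentGravity.Op.opRtilde B.η X ∈ Q.traceClass,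
          PowerSeries.coeff 6 (Q.tr ⟨_, hO⟩)
            = -((1 / (2 * Real.pi) ^ 2 : ℂ) * ∫ p, B.densityEH p ∂B.vol))) := by
  -- The first constant is the largest one in `err_bound`; the second is the smallness of h under
  -- which `exists_frame` controls the inverse of G.
  refine ⟨2 ^ 31, 1 / 100, by norm_num, by norm_num, ?_⟩
  intro D M _ _ _ _ _ _ _ B K hK hB 𝒜 _ _ Q X hX
  have hC : (0 : ℝ) ≤ 2 ^ 31 := by norm_num
  have hf := B.isFlat hK.isClosed hB
  have hX := EmergentGravity.Quantization.isEmbedding hX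
  have hR := B.m_mul_lagR ▸ B.lagR_mem hf
  have hRt := B.m_mul_lagRtilde ▸ B.lagRtilde_mem hf
  refine ⟨fun hO => ?_, fun hO => ?_, fun hO => ?_, fun hG => ⟨?_, fun hO => ?_, fun hO => ?_⟩⟩
  · rw [funext B.densityBare_eq]
    exact hX.opBare.hasSemiclassicalLimit hK hO (Ideal.mul_mem_left _ _ hf.bare_mem)
      (B.bareDv_mem hK hf) (B.densityBareF_mem hf)
      (fun q => B.densityBare_eq q ▸ B.bare_eq q) hC fun F hF q hq => (B.norm_err_le hF hq).1
  · rw [funext B.densityR_eq_ev]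
    exact hX.opR.hasSemiclassicalLimit hK hO hR (B.divR_mem hK hf) (B.densityRF_mem hf)
      (fun q => by rw [B.m_mul_lagR, ← B.densityR_eq_ev, B.R_eq]) hC
      fun F hF q hq => (B.norm_err_le hF hq).2.1
  · rw [funext B.densityRtilde_eq]
    exact hX.opRtilde.hasSemiclassicalLimit hK hO hRt (B.divRtilde_mem hK hf)
      (B.densityRtildeF_mem hf)
      (fun q => by rw [B.m_mul_lagRtilde, ← B.densityRtilde_eq, B.Rtilde_eq]) hC
      fun F hF q hq => (B.norm_err_le hF hq).2.2
  · rw [← funext (B.densityRtilde_eq_densityEH hG), funext B.densityRtilde_eq]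
    exact B.integrable_of_mem hK (B.densityRtildeF_mem hf)
  · rw [hX.opR.coeff_neg hO, ← funext (B.densityR_eq_densityEH hG), funext B.densityR_eq_ev,
      B.integral_eq_of_sub_eq_zero hK hR (B.divR_mem hK hf) (B.densityRF_mem hf) fun q => ?_]
    rw [B.m_mul_lagR, ← B.densityR_eq_ev, B.R_eq, (EmergentGravity.PatchBrane.err_eq_zero
      (P := B.patch q) (hG q) (EmergentGravity.Brane.chart_mem q)).2.1, mul_zero]
  · rw [hX.opRtilde.coeff_neg hO, ← funext (B.densityRtilde_eq_densityEH hG),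
      funext B.densityRtilde_eq, B.integral_eq_of_sub_eq_zero hK hRt (B.divRtilde_mem hK hf)
        (B.densityRtildeF_mem hf) fun q => ?_]
    rw [B.m_mul_lagRtilde, ← B.densityRtilde_eq, B.Rtilde_eq, (EmergentGravity.PatchBrane.err_eq_zero
      (P := B.patch q) (hG q) (EmergentGravity.Brane.chart_mem q)).2.2, mul_zero]
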